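/- Let $g,\mu,L>0$ and $\Omega=(2\pi L\mathbb{T})^2\times\mathbb{R}$, and let $\bar\rho:\mathbb{R}\to\mathbb{R}$ be a bounded smooth function with $\bar\rho'\in C_0^\infty(\mathbb{R})$, $\inf\bar\rho>0$ and $\bar\rho'(x_3^0)>0$ for some $x_3^0$. Put $$M_{\mathrm c}=\Big(\sup_{0\ne\psi\in H^1(\mathbb{R})}\frac{\int_{\mathbb R} g\bar\rho'\psi^2\,dx}{\int_{\mathbb R}|\psi'|^2\,dx}\Big)^{1/2}\in(0,\infty],$$ and let $\bar{\mathbf M}=M\mathbf e_1$ with $M\ne0$ (horizontal case) or $\bar{\mathbf M}=M\mathbf e_3$ with $0<|M|<M_{\mathrm c}$ (vertical case). The solvable domain $\mathbb{A}^{\mathrm g}\subset\mathbb{R}^2$ is, in the horizontal case, $$\big(\{\xi: 0<|M\xi_1|/|\xi|<M_{\mathrm c},\ |\xi|<S(\xi)\}\cup\{\xi_1=0\}\big)\setminus\{0\},\qquad S(\xi)^2=\sup_{0\ne\psi\in H^1(\mathbb{R})}\frac{\frac{g|\xi|^2}{(M\xi_1)^2}\int\bar\rho'\psi^2-\int|\psi'|^2}{\int\psi^2},$$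 and, in the vertical case, $\{\xi:|\xi|>|\xi|_{\mathrm{vc}}\}$, where $$|\xi|_{\mathrm{vc}}^2=\inf\Big\{\frac{M^2\int|\psi''|^2}{\int(g\bar\rho'\psi^2-M^2|\psi'|^2)}:\ \psi\in H^2(\mathbb{R}),\ \int(g\bar\rho'\psi^2-M^2|\psi'|^2)>0\Big\}.$$ For $\xi\neq 0$ and $s>0$ let $$\alpha(\xi,s)=\inf\Big\{|\xi|^2E_0(\psi)+sE_1(\psi):\ \psi\in H^2(\mathbb{R}),\ \int\bar\rho(|\xi|^2\psi^2+|\psi'|^2)=1\Big\},\qquad E_1(\psi)=\mu\int\big(4|\xi|^2|\psi'|^2+(|\xi|^2\psi+\psi'')^2\big),$$ where $E_0(\psi)=\int\big(M^2\xi_1^2(\psi^2+|\psi'|^2/|\xi|^2)-g\bar\rho'\psi^2\big)$ in the horizontal case and $E_0(\psi)=\int\big(M^2(|\psi'|^2+|\psi''|^2/|\xi|^2)-g\bar\rho'\psi^2\big)$ in the vertical case. Let $\mathfrak S_\xi=\sup\{s>0:\alpha(\xi,\tau)<0\ \forall\tau\in(0,s)\}$. Then for every $\xi\in\mathbb{A}^{\mathrm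 g}$ there is exactly one $s\in(0,\mathfrak S_\xi)$ with $s=\sqrt{-\alpha(\xi,s)}$; call it the growth rate $\lambda(\xi)$. The set $\mathbb{A}^{\mathrm g}\cap(L^{-1}\mathbb{Z})^2$ is nonempty, and $$\Lambda:=\sup_{\xi\in\mathbb{A}^{\mathrm g}\cap(L^{-1}\mathbb{Z})^2}\lambda(\xi)$$ is finite and positive. Moreover, there are $\Lambda^*>0$ with $\Lambda^*\in(2\Lambda/3,\Lambda]$ and a smooth real-valued solution $(\varrho,\mathbf u,\mathbf N,q)$, horizontally periodic (i.e. defined on $\Omega$), for $t\ge0$, of the linearized problem $$\varrho_t+\bar\rho'u_3=0,\quad \bar\rho\,\mathbf u_t+\nabla q+g\varrho\,\mathbf e_3=\mu\Delta\mathbf u+(\nabla\times\mathbf N)\times\bar{\mathbf M},\quad \mathbf N_t=\nabla\times(\mathbf u\times\bar{\mathbf M}),\quad \operatorname{div}\mathbf u=\operatorname{div}\mathbf N=0,$$ $$\lim_{|x_3|\to\infty}(\varrho,\mathbf u,\mathbf N)(t,x_1,x_2,x_3)=0\quad(t>0),$$ such that: 1. for every integer $k\ge0$, $\|(\varrho,\mathbf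 u,\mathbf N,q)(0)\|_{H^k(\Omega)}<\infty$; 2. for every integer $k\ge0$ and every $t>0$, $(\varrho,\mathbf u,\mathbf N,q)(t)\in H^k(\Omega)$ and $$\|(\varrho,\mathbf N,q)(t)\|_{H^k(\Omega)}=e^{\Lambda^*t}\|(\varrho,\mathbf N,q)(0)\|_{H^k(\Omega)},$$ and likewise $\|f(t)\|_{H^k(\Omega)}=e^{\Lambda^*t}\|f(0)\|_{H^k(\Omega)}$ for each single scalar component $f\in\{\varrho,u_1,u_2,u_3,N_1,N_2,N_3,q\}$; 3. $\operatorname{div}\mathbf u(0)=\operatorname{div}\mathbf N(0)=0$ and $\|(u_1,u_2)(0)\|_{L^2(\Omega)}\,\|u_3(0)\|_{L^2(\Omega)}>0$; 4. in the vertical case, $\|N_3(0)\|_{L^2(\Omega)}>0$. -/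

import Mathlib

open MeasureTheory Filter Topology
open scoped ContDiff ENNReal Matrix

noncomputable section

namespace RTMHD

/-! ### Sobolev functions on the line -/

/-- `f'` is a weak derivative of `f` on `ℝ`. -/
def HasWeakDeriv (f f' : ℝ → ℝ) : Prop :=
  ∀ η : ℝ → ℝ, ContDiff ℝ ∞ η → HasCompactSupport η →
    ∫ x, f x * deriv η x = -∫ x, f' x * η x

/-- An element of `H¹(ℝ)`, together with (a representative of) its weak derivative. -/
structure H1R where
  f : ℝ → ℝ
  d1 : ℝ → ℝ
  memLp_f : MemLp f 2 volume
  memLp_d1 : MemLp d1 2 volume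
  weak_d1 : HasWeakDeriv f d1

/-- An element of `H²(ℝ)`, together with its first two weak derivatives. -/
structure H2R extends H1R where
  d2 : ℝ → ℝ
  memLp_d2 : MemLp d2 2 volume
  weak_d2 : HasWeakDeriv d1 d2

/-! ### The data of the problem -/

/-- The steady magnetic field is `M e₁` (horizontal) or `M e₃` (vertical). -/
inductive FieldDir
  | horizontal
  | vertical

/-- Gravity `g`, viscosity `μ`, horizontal period `2πL`, field strength `M`, field direction, and
density profile `ρ`. -/
structure RTData where
  g : ℝ
  μ : ℝ
  L : ℝ
  M : ℝ
  dir : FieldDir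
  ρ : ℝ → ℝ

/-- Horizontal frequencies, with the Euclidean norm. -/
abbrev Freq := EuclideanSpace ℝ (Fin 2)

namespace RTData

variable (D : RTData)

/-- The steady magnetic field. -/
def Mbar : Fin 3 → ℝ :=
  match D.dir with
  | .horizontal => ![D.M, 0, 0]
  | .vertical => ![0, 0, D.M]

/-- The critical number `M_c`, possibly infinite: the square root of the supremum of
`∫ g ρ' ψ² / ∫ ψ'²` over nonzero `ψ ∈ H¹(ℝ)`. (Truncating negative quotients at `0` does not change
a supremum that is positive.) -/
def Mc : ℝ≥0∞ :=
  (⨆ (ψ : H1R) (_ : ¬ ψ.f =ᵐ[volume] 0),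
    ENNReal.ofReal ((∫ x, D.g * deriv D.ρ x * ψ.f x ^ 2) / ∫ x, ψ.d1 x ^ 2)) ^ (1 / 2 : ℝ)

/-- The standing assumptions: positive constants, a smooth bounded Rayleigh-Taylor density profile,
and a magnetic field that is horizontal and nonzero, or vertical, nonzero and below `M_c`. -/
structure Admissible : Prop where
  g_pos : 0 < D.g
  μ_pos : 0 < D.μ
  L_pos : 0 < D.L
  ρ_smooth : ContDiff ℝ ∞ D.ρ
  ρ_bdd : ∃ C : ℝ, ∀ x, |D.ρ x| ≤ C
  ρ'_supp : HasCompactSupport (deriv D.ρ)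
  ρ_pos : ∃ c : ℝ, 0 < c ∧ ∀ x, c ≤ D.ρ x
  ρ'_pos : ∃ x₀ : ℝ, 0 < deriv D.ρ x₀
  M_ne : D.M ≠ 0
  M_lt : D.dir = .vertical → ENNReal.ofReal |D.M| < D.Mc

/-! ### The variational problem and the growth rate -/

/-- The critical frequency function `S(ξ)` (used for the horizontal field, where
`0 < |M ξ₁| / |ξ| < M_c`). -/
def S (ξ : Freq) : ℝ :=
  √(sSup {r : ℝ | ∃ ψ : H1R, (¬ ψ.f =ᵐ[volume] 0) ∧
    r = (D.g * ‖ξ‖ ^ 2 * (∫ x, deriv D.ρ x * ψ.f x ^ 2) / (D.M * ξ 0) ^ 2 - ∫ x, ψ.d1 x ^ 2)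
      / ∫ x, ψ.f x ^ 2})

/-- The denominator `∫ (g ρ' ψ² - M² ψ'²)` in the critical frequency constant. -/
def vcDenom (ψ : H2R) : ℝ :=
  ∫ x, (D.g * deriv D.ρ x * ψ.f x ^ 2 - D.M ^ 2 * ψ.d1 x ^ 2)

/-- The critical frequency constant `|ξ|_vc` (used for the vertical field). -/
def xiVc : ℝ :=
  √(sInf {r : ℝ | ∃ ψ : H2R, 0 < D.vcDenom ψ ∧
    r = D.M ^ 2 * (∫ x, ψ.d2 x ^ 2) / D.vcDenom ψ})

/-- The solvable domain `𝔸^g`. -/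
def solvable : Set Freq :=
  match D.dir with
  | .horizontal =>
      ({ξ | 0 < |ξ 0 * D.M| / ‖ξ‖ ∧ ENNReal.ofReal (|ξ 0 * D.M| / ‖ξ‖) < D.Mc ∧ ‖ξ‖ < D.S ξ}
        ∪ {ξ | ξ 0 = 0}) \ {0}
  | .vertical => {ξ | D.xiVc < ‖ξ‖}

/-- The lattice `(L⁻¹ ℤ)²`. -/
def lattice : Set Freq := {ξ | ∀ i, ∃ n : ℤ, ξ i = n / D.L}

def E0 (ξ : Freq) (ψ : H2R) : ℝ :=
  match D.dir with
  | .horizontal =>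
      ∫ x, (D.M ^ 2 * ξ 0 ^ 2 * (ψ.f x ^ 2 + ψ.d1 x ^ 2 / ‖ξ‖ ^ 2)
        - D.g * deriv D.ρ x * ψ.f x ^ 2)
  | .vertical =>
      ∫ x, (D.M ^ 2 * (ψ.d1 x ^ 2 + ψ.d2 x ^ 2 / ‖ξ‖ ^ 2) - D.g * deriv D.ρ x * ψ.f x ^ 2)

def E1 (ξ : Freq) (ψ : H2R) : ℝ :=
  D.μ * ∫ x, (4 * ‖ξ‖ ^ 2 * ψ.d1 x ^ 2 + (‖ξ‖ ^ 2 * ψ.f x + ψ.d2 x) ^ 2)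

/-- The energy `E(ψ, s) = |ξ|² E₀(ψ) + s E₁(ψ)`. -/
def E (ξ : Freq) (s : ℝ) (ψ : H2R) : ℝ := ‖ξ‖ ^ 2 * D.E0 ξ ψ + s * D.E1 ξ ψ

def J (ξ : Freq) (ψ : H2R) : ℝ :=
  ∫ x, D.ρ x * (‖ξ‖ ^ 2 * ψ.f x ^ 2 + ψ.d1 x ^ 2)

/-- `α(s) = inf {E(ψ, s) : ψ ∈ H²(ℝ), J(ψ) = 1}`. -/
def α (ξ : Freq) (s : ℝ) : ℝ := sInf {r : ℝ | ∃ ψ : H2R, D.J ξ ψ = 1 ∧ r = D.E ξ s ψ}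

/-- The interval `(0, 𝔖)` with `𝔖 = sup {s : α(τ) < 0 for all τ ∈ (0, s)}`. -/
def sInterval (ξ : Freq) : Set ℝ :=
  {s | 0 < s ∧ ∃ s' : ℝ, s < s' ∧ ∀ τ ∈ Set.Ioo 0 s', D.α ξ τ < 0}

/-- `s` is the growth rate at `ξ`: a fixed point `s = λ(ξ, s) = √(-α(s))` in `(0, 𝔖)`. -/
def IsGrowthRate (ξ : Freq) (s : ℝ) : Prop := s ∈ D.sInterval ξ ∧ s = √(-D.α ξ s)

/-- The growth rate `λ(ξ)`, i.e. the fixed point above (which is unique for `ξ ∈ 𝔸^g`). -/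
def growthRate (ξ : Freq) : ℝ := Classical.epsilon (D.IsGrowthRate ξ)

/-- The values of `λ` at the lattice frequencies of the solvable domain. -/
def latticeRates : Set ℝ := D.growthRate '' (D.solvable ∩ D.lattice)

/-- `Λ = sup λ(ξ)` over the lattice frequencies of the solvable domain. -/
def Lam : ℝ := sSup D.latticeRates

end RTData

/-! ### Vector calculus and Sobolev norms on `Ω = (2πL𝕋)² × ℝ`

Functions on `Ω` are functions on `ℝ³` that are `2πL`-periodic in the first two variables. -/

/-- The partial derivative `∂ᵢ`. -/
def pd (i : Fin 3) (f : (Fin 3 → ℝ) → ℝ) (x : Fin 3 → ℝ) : ℝ := fderiv ℝ f x (Pi.single i 1)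

def grad (f : (Fin 3 → ℝ) → ℝ) (x : Fin 3 → ℝ) : Fin 3 → ℝ := fun i => pd i f x

def lap (f : (Fin 3 → ℝ) → ℝ) (x : Fin 3 → ℝ) : ℝ := ∑ i, pd i (pd i f) x

def div (F : (Fin 3 → ℝ) → Fin 3 → ℝ) (x : Fin 3 → ℝ) : ℝ := ∑ i, pd i (fun y => F y i) x

def curl (F : (Fin 3 → ℝ) → Fin 3 → ℝ) (x : Fin 3 → ℝ) : Fin 3 → ℝ :=
  ![pd 1 (fun y => F y 2) x - pd 2 (fun y => F y 1) x,
    pd 2 (fun y => F y 0) x - pd 0 (fun y => F y 2) x,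
    pd 0 (fun y => F y 1) x - pd 1 (fun y => F y 0) x]

/-- `f` is `2πL`-periodic in `x₁` and `x₂`. -/
def HorPeriodic (L : ℝ) (f : (Fin 3 → ℝ) → ℝ) : Prop :=
  ∀ x, f (x + Pi.single 0 (2 * Real.pi * L)) = f x ∧ f (x + Pi.single 1 (2 * Real.pi * L)) = f x

/-- The period cell `(0, 2πL)² × ℝ`. -/
def cell (L : ℝ) : Set (Fin 3 → ℝ) :=
  {x | x 0 ∈ Set.Ioo 0 (2 * Real.pi * L) ∧ x 1 ∈ Set.Ioo 0 (2 * Real.pi * L)}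

/-- The partial derivative `∂₁^{a₁} ∂₂^{a₂} ∂₃^{a₃}`. -/
def mpd (a : Fin 3 → ℕ) (f : (Fin 3 → ℝ) → ℝ) : (Fin 3 → ℝ) → ℝ :=
  (pd 0)^[a 0] ((pd 1)^[a 1] ((pd 2)^[a 2] f))

/-- The norm of `Hᵏ(Ω)` of a tuple `F` of smooth horizontally periodic functions: the square root of
the sum of the squared `L²(Ω)` norms of all partial derivatives of order at most `k` of all
components. It is finite exactly when all components lie in `Hᵏ(Ω)`. It is only used for smooth
functions, whose weak derivatives are the classical ones. -/
def hNorm (L : ℝ) (k : ℕ) {n : ℕ} (F : Fin n → (Fin 3 → ℝ) → ℝ) : ℝ≥0∞ :=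
  (∑ i, ∑ j ∈ Finset.range (k + 1), ∑ a ∈ Finset.Nat.antidiagonalTuple 3 j,
    ∫⁻ x in cell L, ENNReal.ofReal (mpd a (F i) x ^ 2)) ^ (1 / 2 : ℝ)

/-! ### The linearized problem -/

/-- `(ϱ, u, N, q)` is a smooth real-valued horizontally periodic solution, for times `t ≥ 0`, of the
linearized equations, with `(ϱ, u, N) → 0` as `|x₃| → ∞`. -/
structure IsSolution (D : RTData) (ϱ : ℝ → (Fin 3 → ℝ) → ℝ) (u N : ℝ → (Fin 3 → ℝ) → Fin 3 → ℝ)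
    (q : ℝ → (Fin 3 → ℝ) → ℝ) : Prop where
  smooth_ϱ : ContDiffOn ℝ ∞ (fun p : ℝ × (Fin 3 → ℝ) => ϱ p.1 p.2) (Set.Ici 0 ×ˢ Set.univ)
  smooth_u : ContDiffOn ℝ ∞ (fun p : ℝ × (Fin 3 → ℝ) => u p.1 p.2) (Set.Ici 0 ×ˢ Set.univ)
  smooth_N : ContDiffOn ℝ ∞ (fun p : ℝ × (Fin 3 → ℝ) => N p.1 p.2) (Set.Ici 0 ×ˢ Set.univ)
  smooth_q : ContDiffOn ℝ ∞ (fun p : ℝ × (Fin 3 → ℝ) => q p.1 p.2) (Set.Ici 0 ×ˢ Set.univ)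
  periodic_ϱ : ∀ t, 0 ≤ t → HorPeriodic D.L (ϱ t)
  periodic_u : ∀ t, 0 ≤ t → ∀ i, HorPeriodic D.L (fun x => u t x i)
  periodic_N : ∀ t, 0 ≤ t → ∀ i, HorPeriodic D.L (fun x => N t x i)
  periodic_q : ∀ t, 0 ≤ t → HorPeriodic D.L (q t)
  continuity : ∀ t, 0 < t → ∀ x,
    deriv (fun s => ϱ s x) t + deriv D.ρ (x 2) * u t x 2 = 0
  momentum : ∀ t, 0 < t → ∀ x,
    D.ρ (x 2) • deriv (fun s => u s x) t + grad (q t) x + (D.g * ϱ t x) • ![0, 0, 1]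
      = D.μ • (fun i => lap (fun y => u t y i) x) + curl (N t) x ⨯₃ D.Mbar
  induction : ∀ t, 0 < t → ∀ x,
    deriv (fun s => N s x) t = curl (fun y => u t y ⨯₃ D.Mbar) x
  div_u : ∀ t, 0 < t → ∀ x, div (u t) x = 0
  div_N : ∀ t, 0 < t → ∀ x, div (N t) x = 0
  decay_ϱ : ∀ t, 0 < t → ∀ x₁ x₂,
    Tendsto (fun x₃ => ϱ t ![x₁, x₂, x₃]) (cocompact ℝ) (𝓝 0)
  decay_u : ∀ t, 0 < t → ∀ x₁ x₂,
    Tendsto (fun x₃ => u t ![x₁, x₂, x₃]) (cocompact ℝ) (𝓝 0)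
  decay_N : ∀ t, 0 < t → ∀ x₁ x₂,
    Tendsto (fun x₃ => N t ![x₁, x₂, x₃]) (cocompact ℝ) (𝓝 0)

/-- The tuple `(ϱ, u₁, u₂, u₃, N₁, N₂, N₃, q)` at one time. -/
def allComp (ϱ : (Fin 3 → ℝ) → ℝ) (u N : (Fin 3 → ℝ) → Fin 3 → ℝ) (q : (Fin 3 → ℝ) → ℝ) :
    Fin 8 → (Fin 3 → ℝ) → ℝ :=
  ![ϱ, fun x => u x 0, fun x => u x 1, fun x => u x 2,
    fun x => N x 0, fun x => N x 1, fun x => N x 2, q]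

/-- The tuple `(ϱ, N₁, N₂, N₃, q)` at one time. -/
def rhoNq (ϱ : (Fin 3 → ℝ) → ℝ) (N : (Fin 3 → ℝ) → Fin 3 → ℝ) (q : (Fin 3 → ℝ) → ℝ) :
    Fin 5 → (Fin 3 → ℝ) → ℝ :=
  ![ϱ, fun x => N x 0, fun x => N x 1, fun x => N x 2, q]

end RTMHD

end

/-!
At the fixed point `s = √(-α(ξ, s))` the form `|ξ|² E₀ + s E₁ + s² J` is nonnegative on `H²(ℝ)` with
infimum `0` over `J = 1`. Its gravity part has a compactly supported weight; since point evaluations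
are bounded on `H¹(ℝ)`, it is a compact operator, and what remains is coercive. Hence the infimum is
attained: a nonnegative Fredholm form without kernel would be coercive. A kernel element solves a
fourth-order linear equation weakly, so it is smooth with all derivatives in `L²`, and it yields a
normal mode `e^{st} (f(x₃) cos (ξ · x_h) + h(x₃) sin (ξ · x_h))` with `N = s⁻¹ (M̄ · ∇) u`. All
norms of such a solution grow exactly like `e^{st}`, so it suffices to choose a lattice frequency
with `λ(ξ) > 2 Λ / 3`.
-/

noncomputable section

namespace RTMHD

open scoped InnerProductSpace

/-! ### Primitives and weak derivatives on the line -/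

lemma intervalIntegrable_of_locallyIntegrable {E : Type*} [NormedAddCommGroup E] {μ : Measure ℝ}
    {f : ℝ → E} (hf : LocallyIntegrable f μ) (a b : ℝ) : IntervalIntegrable f μ a b :=
  intervalIntegrable_iff.mpr
    ((hf.integrableOn_isCompact isCompact_uIcc).mono_set Set.uIoc_subset_uIcc)

lemma integrable_mul_of_hasCompactSupport {f η : ℝ → ℝ} (hf : LocallyIntegrable f)
    (hη : Continuous η) (hc : HasCompactSupport η) : Integrable fun x => f x * η x := by
  simpa only [smul_eq_mul, mul_comm] using hf.integrable_smul_right_of_hasCompactSupport hη hc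

lemma integral_eq_zero_of_intervalIntegral_eq_sub {P w : ℝ → ℝ} (hP : Integrable P)
    (hw : Integrable w) (h : ∀ a b, ∫ t in a..b, w t = P b - P a) : ∫ t, w t = 0 := by
  have htop : Tendsto P atTop (𝓝 (P 0 + ∫ t in Set.Ioi 0, w t)) := by
    refine ((intervalIntegral_tendsto_integral_Ioi 0 hw.integrableOn tendsto_id).const_add
      (P 0)).congr fun x => ?_
    rw [id, h, add_sub_cancel]
  have hbot : Tendsto P atBot (𝓝 (P 0 - ∫ t in Set.Iic 0, w t)) := by
    refine ((intervalIntegral_tendsto_integral_Iic 0 hw.integrableOn tendsto_id).const_sub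
      (P 0)).congr fun x => ?_
    rw [id, h, sub_sub_cancel]
  have htop_zero := (hP.integrableAtFilter atTop).eq_zero_of_tendsto (fun s hs => by
    obtain ⟨b, hb⟩ := mem_atTop_sets.1 hs
    exact measure_mono_top (fun _ => hb _) Real.volume_Ici) htop
  have hbot_zero := (hP.integrableAtFilter atBot).eq_zero_of_tendsto (fun s hs => by
    obtain ⟨b, hb⟩ := mem_atBot_sets.1 hs
    exact measure_mono_top (fun _ => hb _) Real.volume_Iic) hbot
  rw [← intervalIntegral.integral_Iic_add_Ioi (b := 0) hw.integrableOn hw.integrableOn]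
  linarith

/-- The primitive of `g` that takes the value `c` at `0`. -/
def prim (c : ℝ) (g : ℝ → ℝ) (x : ℝ) : ℝ := c + ∫ t in (0 : ℝ)..x, g t

section prim

variable {f g : ℝ → ℝ}

lemma prim_congr_ae (h : f =ᵐ[volume] g) (c : ℝ) : prim c f = prim c g := by
  funext x
  rw [prim, prim, intervalIntegral.integral_congr_ae (h.mono fun _ hx _ => hx)]

lemma prim_sub_prim (hg : LocallyIntegrable g) (c a b : ℝ) :
    prim c g b - prim c g a = ∫ t in a..b, g t := by
  rw [prim, prim, add_sub_add_left_eq_sub, intervalIntegral.integral_interval_sub_left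
    (intervalIntegrable_of_locallyIntegrable hg _ _)
    (intervalIntegrable_of_locallyIntegrable hg _ _)]

lemma continuous_prim (hg : LocallyIntegrable g) (c : ℝ) : Continuous (prim c g) :=
  continuous_const.add
    (intervalIntegral.continuous_primitive (intervalIntegrable_of_locallyIntegrable hg) 0)

lemma hasDerivAt_prim (hg : Continuous g) (c x : ℝ) : HasDerivAt (prim c g) (g x) x :=
  (hg.integral_hasStrictDerivAt 0 x).hasDerivAt.const_add c

lemma eq_prim_of_hasDerivAt (h : ∀ x, HasDerivAt f (g x) x) (hg : Continuous g) :
    f = prim (f 0) g := by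
  funext x
  rw [prim, intervalIntegral.integral_eq_sub_of_hasDerivAt (fun y _ => h y)
    (hg.intervalIntegrable _ _), add_sub_cancel]

lemma ae_deriv_prim (hg : LocallyIntegrable g) (c : ℝ) : ∀ᵐ x, deriv (prim c g) x = g x := by
  filter_upwards [LocallyIntegrable.ae_hasDerivAt_integral hg] with x hx
  exact ((hx 0).const_add c).deriv

lemma absolutelyContinuousOnInterval_prim (hg : LocallyIntegrable g) (c a b : ℝ) :
    AbsolutelyContinuousOnInterval (prim c g) a b := by
  have hconst : AbsolutelyContinuousOnInterval (fun _ : ℝ => prim c g a) a b :=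
    (LipschitzWith.const _).lipschitzOnWith.absolutelyContinuousOnInterval
  have hint := (intervalIntegrable_of_locallyIntegrable hg a b
    ).absolutelyContinuousOnInterval_intervalIntegral (c := a) Set.left_mem_uIcc
  have heq : prim c g = (fun _ => prim c g a) + fun x => ∫ t in a..x, g t := by
    funext x
    rw [Pi.add_apply, ← prim_sub_prim hg c a x, add_sub_cancel]
  rw [heq]
  exact hconst.add hint

lemma intervalIntegral_mul_prim_add_prim_mul (hf : LocallyIntegrable f) (hg : LocallyIntegrable g)
    (c d a b : ℝ) :
    ∫ x in a..b, (f x * prim d g x + prim c f x * g x)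
      = prim c f b * prim d g b - prim c f a * prim d g a := by
  rw [← (absolutelyContinuousOnInterval_prim hf c a b).integral_deriv_mul_eq_sub
    (absolutelyContinuousOnInterval_prim hg d a b)]
  refine intervalIntegral.integral_congr_ae ?_
  filter_upwards [ae_deriv_prim hf c, ae_deriv_prim hg d] with x hfx hgx _
  rw [hfx, hgx]

lemma integral_prim_mul (hf : LocallyIntegrable f) (hg : LocallyIntegrable g) {c d : ℝ}
    (hP : Integrable fun x => prim c f x * prim d g x)
    (hf_prim : Integrable fun x => f x * prim d g x)
    (hprim_g : Integrable fun x => prim c f x * g x) :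
    ∫ x, prim c f x * g x = -∫ x, f x * prim d g x := by
  have h := integral_eq_zero_of_intervalIntegral_eq_sub hP (hf_prim.add hprim_g)
    (intervalIntegral_mul_prim_add_prim_mul hf hg c d)
  rw [integral_add' hf_prim hprim_g] at h
  linarith

lemma hasWeakDeriv_prim (hg : LocallyIntegrable g) (c : ℝ) : HasWeakDeriv (prim c g) g := by
  intro η hη hηc
  have hη' : Continuous (deriv η) := hη.continuous_deriv (by simp)
  have hprim := (continuous_prim hg c).locallyIntegrable (μ := volume)
  have hη_eq : prim (η 0) (deriv η) = η :=
    (eq_prim_of_hasDerivAt (fun x => (hη.differentiable (by simp) x).hasDerivAt) hη').symm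
  have h := integral_prim_mul hg hη'.locallyIntegrable (c := c) (d := η 0)
  rw [hη_eq] at h
  exact h (integrable_mul_of_hasCompactSupport hprim hη.continuous hηc)
    (integrable_mul_of_hasCompactSupport hg hη.continuous hηc)
    (integrable_mul_of_hasCompactSupport hprim hη' hηc.deriv)

lemma hasWeakDeriv_of_hasDerivAt (h : ∀ x, HasDerivAt f (g x) x) (hg : Continuous g) :
    HasWeakDeriv f g := by
  rw [eq_prim_of_hasDerivAt h hg]
  exact hasWeakDeriv_prim hg.locallyIntegrable _

lemma HasWeakDeriv.congr {f₁ g₁ : ℝ → ℝ} (h : HasWeakDeriv f g) (hf : f =ᵐ[volume] f₁)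
    (hg : g =ᵐ[volume] g₁) : HasWeakDeriv f₁ g₁ := by
  intro η hη hηc
  exact (integral_congr_ae (hf.mul (ae_eq_refl (deriv η)))).symm.trans
    ((h η hη hηc).trans (congrArg Neg.neg (integral_congr_ae (hg.mul (ae_eq_refl η)))))

lemma HasWeakDeriv.sub {f₁ g₁ : ℝ → ℝ} (h : HasWeakDeriv f g) (h₁ : HasWeakDeriv f₁ g₁)
    (hf : LocallyIntegrable f) (hg : LocallyIntegrable g) (hf₁ : LocallyIntegrable f₁)
    (hg₁ : LocallyIntegrable g₁) : HasWeakDeriv (f - f₁) (g - g₁) := by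
  intro η hη hηc
  have hη' : Continuous (deriv η) := hη.continuous_deriv (by simp)
  simp only [Pi.sub_apply, sub_mul]
  rw [integral_sub (integrable_mul_of_hasCompactSupport hf hη' hηc.deriv)
      (integrable_mul_of_hasCompactSupport hf₁ hη' hηc.deriv),
    integral_sub (integrable_mul_of_hasCompactSupport hg hη.continuous hηc)
      (integrable_mul_of_hasCompactSupport hg₁ hη.continuous hηc),
    h η hη hηc, h₁ η hη hηc]
  ring

end prim

lemma exists_testFunction_deriv_eq {φ : ℝ → ℝ} (hφ : ContDiff ℝ ∞ φ) (hc : HasCompactSupport φ)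
    (h0 : ∫ x, φ x = 0) :
    ∃ η : ℝ → ℝ, ContDiff ℝ ∞ η ∧ HasCompactSupport η ∧ deriv η = φ := by
  set η : ℝ → ℝ := prim (∫ t in Set.Iic 0, φ t) φ
  have hη : ∀ x, HasDerivAt η (φ x) x := hasDerivAt_prim hφ.continuous _
  have hη' : deriv η = φ := funext fun x => (hη x).deriv
  have hη_eq : ∀ x, η x = ∫ t in Set.Iic x, φ t := fun x => by
    have hint := hφ.continuous.integrable_of_hasCompactSupport (μ := volume) hc
    simp only [η, prim]
    rw [← intervalIntegral.integral_Iic_sub_Iic hint.integrableOn hint.integrableOn,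
      add_sub_cancel]
  obtain ⟨R, -, hR⟩ := hc.exists_pos_le_norm
  refine ⟨η, ?_, HasCompactSupport.intro (isCompact_Icc (a := -R) (b := R)) fun x hx => ?_, hη'⟩
  · rw [contDiff_infty_iff_deriv, hη']
    exact ⟨fun x => (hη x).differentiableAt, hφ⟩
  · rw [hη_eq]
    rcases lt_or_ge x (-R) with hxR | hxR
    · refine setIntegral_eq_zero_of_forall_eq_zero fun t ht => hR t ?_
      exact le_abs.2 (.inr (by linarith [Set.mem_Iic.1 ht]))
    · have hRx : R < x := lt_of_not_ge fun h => hx ⟨hxR, h⟩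
      rw [setIntegral_eq_integral_of_forall_compl_eq_zero fun t ht => hR t ?_, h0]
      exact le_abs.2 (.inl (hRx.trans (lt_of_not_ge ht)).le)

lemma exists_testFunction_integral_eq_one :
    ∃ θ : ℝ → ℝ, ContDiff ℝ ∞ θ ∧ HasCompactSupport θ ∧ ∫ x, θ x = 1 := by
  let b : ContDiffBump (0 : ℝ) := ⟨1, 2, by norm_num, by norm_num⟩
  exact ⟨b.normed volume, b.contDiff_normed, b.hasCompactSupport_normed, b.integral_normed⟩

/-- The du Bois-Reymond lemma. -/
lemma ae_eq_const_of_hasWeakDeriv_zero {f : ℝ → ℝ} (hf : LocallyIntegrable f)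
    (h : HasWeakDeriv f 0) : ∃ c : ℝ, f =ᵐ[volume] fun _ => c := by
  obtain ⟨θ, hθ, hθc, hθ1⟩ := exists_testFunction_integral_eq_one
  refine ⟨∫ x, f x * θ x, ?_⟩
  refine ae_eq_of_integral_contDiff_smul_eq hf (locallyIntegrable_const _) fun φ hφ hφc => ?_
  have hφ_int : Integrable φ := hφ.continuous.integrable_of_hasCompactSupport hφc
  have hθ_int : Integrable θ := hθ.continuous.integrable_of_hasCompactSupport hθc
  obtain ⟨η, hη, hηc, hη'⟩ := exists_testFunction_deriv_eq
    (φ := fun x => φ x - (∫ y, φ y) * θ x) (hφ.sub (contDiff_const.mul hθ))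
    (hφc.sub (hθc.mul_left (f := fun _ => ∫ y, φ y)))
    (by rw [integral_sub hφ_int (hθ_int.const_mul _), integral_const_mul, hθ1, mul_one, sub_self])
  have horth : ∫ x, f x * (φ x - (∫ y, φ y) * θ x) = 0 := by
    simpa [hη'] using h η hη hηc
  have hsplit : ∫ x, f x * (φ x - (∫ y, φ y) * θ x)
      = (∫ x, f x * φ x) - (∫ y, φ y) * ∫ x, f x * θ x := by
    rw [← integral_const_mul, ← integral_sub
      (integrable_mul_of_hasCompactSupport hf hφ.continuous hφc)
      ((integrable_mul_of_hasCompactSupport hf hθ.continuous hθc).const_mul _)]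
    exact integral_congr_ae (Eventually.of_forall fun x => by ring)
  simp only [smul_eq_mul]
  rw [integral_mul_const]
  simp_rw [mul_comm (φ _)]
  linarith

lemma HasWeakDeriv.exists_ae_eq_prim {f g : ℝ → ℝ} (h : HasWeakDeriv f g)
    (hf : LocallyIntegrable f) (hg : LocallyIntegrable g) : ∃ c : ℝ, f =ᵐ[volume] prim c g := by
  have hp := (continuous_prim hg 0).locallyIntegrable (μ := volume)
  have hsub := h.sub (hasWeakDeriv_prim hg 0) hf hg hp hg
  rw [sub_self] at hsub
  obtain ⟨c, hc⟩ := ae_eq_const_of_hasWeakDeriv_zero (hf.sub hp) hsub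
  refine ⟨c, ?_⟩
  filter_upwards [hc] with x hx
  simp only [Pi.sub_apply, prim] at hx ⊢
  linarith

lemma locallyIntegrable_of_memLp_two {f : ℝ → ℝ} (hf : MemLp f 2 volume) : LocallyIntegrable f :=
  hf.locallyIntegrable (by norm_num)

namespace H1R

variable (u v : H1R)

lemma locallyIntegrable_f : LocallyIntegrable u.f := locallyIntegrable_of_memLp_two u.memLp_f

lemma locallyIntegrable_d1 : LocallyIntegrable u.d1 := locallyIntegrable_of_memLp_two u.memLp_d1

lemma exists_ae_eq_prim : ∃ c : ℝ, u.f =ᵐ[volume] prim c u.d1 :=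
  u.weak_d1.exists_ae_eq_prim u.locallyIntegrable_f u.locallyIntegrable_d1

lemma integral_f_mul_d1 : ∫ x, u.f x * v.d1 x = -∫ x, u.d1 x * v.f x := by
  obtain ⟨c, hc⟩ := u.exists_ae_eq_prim
  obtain ⟨d, hd⟩ := v.exists_ae_eq_prim
  have hprim_d1 := hc.mul (ae_eq_refl v.d1)
  have hd1_prim := (ae_eq_refl u.d1).mul hd
  rw [show ∫ x, u.f x * v.d1 x = _ from integral_congr_ae hprim_d1,
    show ∫ x, u.d1 x * v.f x = _ from integral_congr_ae hd1_prim]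
  exact integral_prim_mul u.locallyIntegrable_d1 v.locallyIntegrable_d1
    ((u.memLp_f.integrable_mul v.memLp_f).congr (hc.mul hd))
    ((u.memLp_d1.integrable_mul v.memLp_f).congr hd1_prim)
    ((u.memLp_f.integrable_mul v.memLp_d1).congr hprim_d1)

end H1R

/-! ### Sobolev spaces on the line as Hilbert spaces -/

/-- The Hilbert space `L²(ℝ)`. -/
abbrev L2R := Lp ℝ 2 (volume : Measure ℝ)

lemma inner_L2R (f g : L2R) : ⟪f, g⟫_ℝ = ∫ x, f x * g x := by
  simp only [L2.inner_def, RCLike.inner_apply, conj_trivial, mul_comm]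

lemma inner_toLp_left {f : ℝ → ℝ} (hf : MemLp f 2 volume) (g : L2R) :
    ⟪hf.toLp f, g⟫_ℝ = ∫ x, f x * g x :=
  (inner_L2R _ _).trans (integral_congr_ae (hf.coeFn_toLp.mul (ae_eq_refl g)))

lemma inner_toLp_toLp {f g : ℝ → ℝ} (hf : MemLp f 2 volume) (hg : MemLp g 2 volume) :
    ⟪hf.toLp f, hg.toLp g⟫_ℝ = ∫ x, f x * g x :=
  (inner_toLp_left hf _).trans (integral_congr_ae ((ae_eq_refl f).mul hg.coeFn_toLp))

/-- Multiplication by a bounded function on `L²(ℝ)`. -/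
def mulL (c : ℝ → ℝ) (hc : MemLp c ∞ volume) : L2R →L[ℝ] L2R :=
  (ContinuousLinearMap.mul ℝ ℝ).holderL volume ∞ 2 2 (hc.toLp c)

lemma coeFn_mulL {c : ℝ → ℝ} (hc : MemLp c ∞ volume) (f : L2R) :
    mulL c hc f =ᵐ[volume] fun x => c x * f x := by
  filter_upwards [(ContinuousLinearMap.mul ℝ ℝ).coeFn_holder (r := 2) (hc.toLp c) f,
    hc.coeFn_toLp] with x hholder hx
  rw [mulL, ContinuousLinearMap.holderL_apply_apply, hholder, hx,
    ContinuousLinearMap.mul_apply']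

lemma inner_mulL {c : ℝ → ℝ} (hc : MemLp c ∞ volume) (f g : L2R) :
    ⟪mulL c hc f, g⟫_ℝ = ∫ x, c x * f x * g x :=
  (inner_L2R _ _).trans (integral_congr_ae ((coeFn_mulL hc f).mul (ae_eq_refl g)))

/-- Test functions on the line. -/
abbrev TestFun := {η : ℝ → ℝ // ContDiff ℝ ∞ η ∧ HasCompactSupport η}

namespace TestFun

variable (η : TestFun)

/-- The derivative of a test function. -/
def deriv : TestFun := ⟨_root_.deriv η.1, (contDiff_infty_iff_deriv.1 η.2.1).2, η.2.2.deriv⟩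

lemma hasDerivAt (x : ℝ) : HasDerivAt η.1 (η.deriv.1 x) x :=
  (η.2.1.differentiable (by simp) x).hasDerivAt

lemma memLp : MemLp η.1 2 volume := η.2.1.continuous.memLp_of_hasCompactSupport η.2.2

/-- A test function as an element of `H²(ℝ)`. -/
def toH2R : H2R where
  f := η.1
  d1 := η.deriv.1
  d2 := η.deriv.deriv.1
  memLp_f := η.memLp
  memLp_d1 := η.deriv.memLp
  memLp_d2 := η.deriv.deriv.memLp
  weak_d1 := hasWeakDeriv_of_hasDerivAt η.hasDerivAt η.deriv.2.1.continuous
  weak_d2 := hasWeakDeriv_of_hasDerivAt η.deriv.hasDerivAt η.deriv.deriv.2.1.continuous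

end TestFun

/-- The functional `v ↦ ∫ vᵢ η' + ∫ vᵢ₊₁ η`. -/
def weakDefect (n : ℕ) (i : Fin n) (η : TestFun) :
    PiLp 2 (fun _ : Fin (n + 1) => L2R) →L[ℝ] ℝ :=
  innerSL ℝ (η.deriv.memLp.toLp _) ∘L PiLp.proj 2 (fun _ : Fin (n + 1) => L2R) i.castSucc
    + innerSL ℝ (η.memLp.toLp _) ∘L PiLp.proj 2 (fun _ : Fin (n + 1) => L2R) i.succ

/-- The Hilbert space `Hⁿ(ℝ)`, encoded as the space of tuples consisting of an `L²` function and its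
weak derivatives. -/
def sobolevSpace (n : ℕ) : Submodule ℝ (PiLp 2 (fun _ : Fin (n + 1) => L2R)) :=
  ⨅ i : Fin n, ⨅ η : TestFun, LinearMap.ker (weakDefect n i η).toLinearMap

lemma weakDefect_apply {n : ℕ} (i : Fin n) (η : TestFun)
    (v : PiLp 2 (fun _ : Fin (n + 1) => L2R)) :
    weakDefect n i η v = (∫ x, v i.castSucc x * deriv η.1 x) + ∫ x, v i.succ x * η.1 x := by
  simp only [weakDefect, add_apply, ContinuousLinearMap.comp_apply, innerSL_apply_apply,
    PiLp.proj_apply, inner_toLp_left, mul_comm, TestFun.deriv]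

lemma mem_sobolevSpace {n : ℕ} {v : PiLp 2 (fun _ : Fin (n + 1) => L2R)} :
    v ∈ sobolevSpace n ↔ ∀ i : Fin n, HasWeakDeriv (v i.castSucc) (v i.succ) := by
  simp only [sobolevSpace, Submodule.mem_iInf, LinearMap.mem_ker, ContinuousLinearMap.coe_coe,
    weakDefect_apply, add_eq_zero_iff_eq_neg, Subtype.forall, and_imp, HasWeakDeriv]

lemma isClosed_sobolevSpace (n : ℕ) :
    IsClosed (sobolevSpace n : Set (PiLp 2 (fun _ : Fin (n + 1) => L2R))) := by
  simp only [sobolevSpace, Submodule.coe_iInf]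
  exact isClosed_iInter fun i => isClosed_iInter fun η => (weakDefect n i η).isClosed_ker

instance (n : ℕ) : CompleteSpace (sobolevSpace n) := (isClosed_sobolevSpace n).completeSpace_coe

namespace sobolevSpace

/-- The `i`-th derivative of an element of `Hⁿ(ℝ)`. -/
def coord (n : ℕ) (i : Fin (n + 1)) : sobolevSpace n →L[ℝ] L2R :=
  PiLp.proj 2 (fun _ : Fin (n + 1) => L2R) i ∘L (sobolevSpace n).subtypeL

variable {n : ℕ} (v w : sobolevSpace n)

lemma inner_eq : ⟪v, w⟫_ℝ = ∑ i, ⟪coord n i v, coord n i w⟫_ℝ := by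
  rw [Submodule.coe_inner, PiLp.inner_apply]
  rfl

lemma norm_coord_le (i : Fin (n + 1)) : ‖coord n i v‖ ≤ ‖v‖ := PiLp.norm_apply_le v.1 i

lemma hasWeakDeriv_coord (i : Fin n) : HasWeakDeriv (coord n i.castSucc v) (coord n i.succ v) :=
  mem_sobolevSpace.1 v.2 i

/-- The element of `H¹(ℝ)` given by a point of the Hilbert space. -/
def toH1R (v : sobolevSpace 1) : H1R where
  f := coord 1 0 v
  d1 := coord 1 1 v
  memLp_f := Lp.memLp _
  memLp_d1 := Lp.memLp _
  weak_d1 := hasWeakDeriv_coord v 0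

/-- The element of `H²(ℝ)` given by a point of the Hilbert space. -/
def toH2R (v : sobolevSpace 2) : H2R where
  f := coord 2 0 v
  d1 := coord 2 1 v
  d2 := coord 2 2 v
  memLp_f := Lp.memLp _
  memLp_d1 := Lp.memLp _
  memLp_d2 := Lp.memLp _
  weak_d1 := hasWeakDeriv_coord v 0
  weak_d2 := hasWeakDeriv_coord v 1

end sobolevSpace

open sobolevSpace

/-- The point of the Hilbert space `H¹(ℝ)` given by a function and its weak derivative. -/
def H1R.toSobolevSpace (u : H1R) : sobolevSpace 1 :=
  ⟨WithLp.toLp 2 ![u.memLp_f.toLp u.f, u.memLp_d1.toLp u.d1], mem_sobolevSpace.2 fun i => by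
    fin_cases i
    exact u.weak_d1.congr u.memLp_f.coeFn_toLp.symm u.memLp_d1.coeFn_toLp.symm⟩

lemma H1R.coord_toSobolevSpace_zero (u : H1R) :
    coord 1 0 u.toSobolevSpace = u.memLp_f.toLp u.f := rfl

lemma H1R.coord_toSobolevSpace_one (u : H1R) :
    coord 1 1 u.toSobolevSpace = u.memLp_d1.toLp u.d1 := rfl

/-- The family `ψ, ψ', ψ''`. -/
def H2R.jet (ψ : H2R) : Fin 3 → ℝ → ℝ := ![ψ.f, ψ.d1, ψ.d2]

lemma H2R.memLp_jet (ψ : H2R) : ∀ i, MemLp (ψ.jet i) 2 volume := by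
  simp [Fin.forall_fin_succ, H2R.jet, ψ.memLp_f, ψ.memLp_d1, ψ.memLp_d2]

/-- The point of the Hilbert space `H²(ℝ)` given by a function and its weak derivatives. -/
def H2R.toSobolevSpace (ψ : H2R) : sobolevSpace 2 :=
  ⟨WithLp.toLp 2 fun i => (ψ.memLp_jet i).toLp (ψ.jet i), mem_sobolevSpace.2 fun i => by
    fin_cases i
    · exact ψ.weak_d1.congr ψ.memLp_f.coeFn_toLp.symm ψ.memLp_d1.coeFn_toLp.symm
    · exact ψ.weak_d2.congr ψ.memLp_d1.coeFn_toLp.symm ψ.memLp_d2.coeFn_toLp.symm⟩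

lemma H2R.coord_toSobolevSpace (ψ : H2R) (i : Fin 3) :
    coord 2 i ψ.toSobolevSpace = (ψ.memLp_jet i).toLp (ψ.jet i) := rfl

lemma hasWeakDeriv_coord_sub {f : ℝ → ℝ} (hf : LocallyIntegrable f) (u : sobolevSpace 1)
    (hu : ∀ η : TestFun, ⟪u, η.toH2R.toH1R.toSobolevSpace⟫_ℝ = ∫ x, f x * η.1 x) :
    HasWeakDeriv (coord 1 1 u) fun x => coord 1 0 u x - f x := by
  intro η hη hηc
  have h := hu ⟨η, hη, hηc⟩
  rw [inner_eq, Fin.sum_univ_two, H1R.coord_toSobolevSpace_zero, H1R.coord_toSobolevSpace_one,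
    real_inner_comm, real_inner_comm (MemLp.toLp _ _), inner_toLp_left, inner_toLp_left] at h
  simp only [TestFun.toH2R, TestFun.deriv, mul_comm (η _), mul_comm (deriv η _)] at h
  have hcoord : LocallyIntegrable (coord 1 0 u) := (toH1R u).locallyIntegrable_f
  simp only [sub_mul]
  rw [integral_sub (integrable_mul_of_hasCompactSupport hcoord hη.continuous hηc)
    (integrable_mul_of_hasCompactSupport hf hη.continuous hηc)]
  linarith

/-- Every `f ∈ L²(ℝ)` is `v - v''` for some `v ∈ H²(ℝ)`, by the Riesz representation theorem
in `H¹(ℝ)`. -/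
lemma exists_H2R_d2_eq_sub {f : ℝ → ℝ} (hf : MemLp f 2 volume) :
    ∃ v : H2R, v.d2 = fun x => v.f x - f x := by
  let u : sobolevSpace 1 :=
    (InnerProductSpace.toDual ℝ (sobolevSpace 1)).symm (innerSL ℝ (hf.toLp f) ∘L coord 1 0)
  have hu : ∀ η : TestFun, ⟪u, η.toH2R.toH1R.toSobolevSpace⟫_ℝ = ∫ x, f x * η.1 x := fun η => by
    rw [InnerProductSpace.toDual_symm_apply, ContinuousLinearMap.comp_apply, innerSL_apply_apply,
      H1R.coord_toSobolevSpace_zero, inner_toLp_toLp]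
    rfl
  exact ⟨{ toH1R u with
    d2 := fun x => (toH1R u).f x - f x
    memLp_d2 := (toH1R u).memLp_f.sub hf
    weak_d2 := hasWeakDeriv_coord_sub (locallyIntegrable_of_memLp_two hf) u hu }, rfl⟩

namespace sobolevSpace

/-- The inclusion of `H²(ℝ)` into `H¹(ℝ)`. -/
def incl : sobolevSpace 2 →ₗ[ℝ] sobolevSpace 1 where
  toFun v := ⟨WithLp.toLp 2 ![coord 2 0 v, coord 2 1 v], mem_sobolevSpace.2 fun i => by
    fin_cases i
    exact hasWeakDeriv_coord v 0⟩
  map_add' v w := by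
    ext1
    ext1 i
    fin_cases i <;> simp
  map_smul' c v := by
    ext1
    ext1 i
    fin_cases i <;> simp

lemma incl_toSobolevSpace (v : H2R) : incl v.toSobolevSpace = v.toH1R.toSobolevSpace := rfl

lemma toSobolevSpace_toH1R (u : sobolevSpace 1) : (toH1R u).toSobolevSpace = u := by
  ext1
  ext1 i
  fin_cases i
  · exact Lp.toLp_coeFn (u.1 0) (Lp.memLp _)
  · exact Lp.toLp_coeFn (u.1 1) (Lp.memLp _)

/-- A vector `u` orthogonal to `H²(ℝ)` in `H¹(ℝ)` satisfies `u'' = u`, so it lies in `H²(ℝ)`. -/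
lemma dense_range_incl : Dense (LinearMap.range incl : Set (sobolevSpace 1)) := by
  rw [Submodule.dense_iff_topologicalClosure_eq_top, Submodule.topologicalClosure_eq_top_iff,
    Submodule.eq_bot_iff]
  intro u hu
  rw [Submodule.mem_orthogonal'] at hu
  have hweak := hasWeakDeriv_coord_sub (f := 0) (locallyIntegrable_const 0) u fun η => by
    rw [hu _ ⟨η.toH2R.toSobolevSpace, incl_toSobolevSpace _⟩]
    simp
  let v : H2R := { toH1R u with
    d2 := fun x => (toH1R u).f x - (0 : ℝ → ℝ) x
    memLp_d2 := (toH1R u).memLp_f.sub MemLp.zero'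
    weak_d2 := hweak }
  exact inner_self_eq_zero.1 (hu u ⟨v.toSobolevSpace, toSobolevSpace_toH1R u⟩)

end sobolevSpace

lemma H1R.integral_mul_sq_toSobolevSpace {c : ℝ → ℝ} (hc : MemLp c ∞ volume) (u : H1R) :
    ⟪mulL c hc (coord 1 0 u.toSobolevSpace), coord 1 0 u.toSobolevSpace⟫_ℝ
      = ∫ x, c x * u.f x ^ 2 := by
  rw [inner_mulL, H1R.coord_toSobolevSpace_zero]
  refine integral_congr_ae ?_
  filter_upwards [u.memLp_f.coeFn_toLp] with x hx
  rw [hx, mul_assoc, sq]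

lemma exists_H2R_form_pos {c : ℝ → ℝ} (hc : MemLp c ∞ volume) (b : ℝ) (u : H1R)
    (h : 0 < (∫ x, c x * u.f x ^ 2) - b * ∫ x, u.d1 x ^ 2) :
    ∃ v : H2R, 0 < (∫ x, c x * v.f x ^ 2) - b * ∫ x, v.d1 x ^ 2 := by
  let F : sobolevSpace 1 → ℝ := fun w =>
    ⟪mulL c hc (coord 1 0 w), coord 1 0 w⟫_ℝ - b * ⟪coord 1 1 w, coord 1 1 w⟫_ℝ
  have hF : Continuous F := by fun_prop
  have hF_eq : ∀ u : H1R, F u.toSobolevSpace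
      = (∫ x, c x * u.f x ^ 2) - b * ∫ x, u.d1 x ^ 2 := fun u => by
    simp only [F, H1R.integral_mul_sq_toSobolevSpace, H1R.coord_toSobolevSpace_one,
      inner_toLp_toLp, sq]
  obtain ⟨_, hw, v, rfl⟩ := dense_range_incl.inter_open_nonempty _
    (isOpen_lt continuous_const hF) ⟨u.toSobolevSpace, h.trans_eq (hF_eq u).symm⟩
  refine ⟨toH2R v, ?_⟩
  have hv : (toH2R v).toH1R.toSobolevSpace = incl v := toSobolevSpace_toH1R (incl v)
  rw [← hF_eq, hv]
  exact hw

/-! ### Point evaluation and compactness -/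

lemma memLp_indicator_Ioc {φ : ℝ → ℝ} (hφ : Continuous φ) (a b : ℝ) :
    MemLp ((Set.Ioc a b).indicator φ) 2 volume :=
  (memLp_indicator_iff_restrict measurableSet_Ioc).2
    ((memLp_two_iff_integrable_sq hφ.aestronglyMeasurable).2 (hφ.pow 2).integrableOn_Ioc)

lemma inner_indicator_Ioc {φ : ℝ → ℝ} (hφ : Continuous φ) {a b : ℝ} (hab : a ≤ b) (g : L2R) :
    ⟪(memLp_indicator_Ioc hφ a b).toLp _, g⟫_ℝ = ∫ x in a..b, φ x * g x := by
  rw [inner_toLp_left, intervalIntegral.integral_of_le hab, ← integral_indicator measurableSet_Ioc]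
  simp only [Set.indicator_mul_left]

lemma inner_indicatorConstLp_Ioc {a b : ℝ} (hab : a ≤ b) (g : L2R) :
    ⟪indicatorConstLp 2 measurableSet_Ioc (measure_Ioc_lt_top (a := a) (b := b)).ne (1 : ℝ), g⟫_ℝ
      = ∫ x in a..b, g x := by
  rw [L2.inner_indicatorConstLp_one, intervalIntegral.integral_of_le hab]

lemma norm_indicatorConstLp_Ioc {a b : ℝ} (hab : a ≤ b) :
    ‖(indicatorConstLp 2 measurableSet_Ioc (measure_Ioc_lt_top (a := a) (b := b)).ne (1 : ℝ) :
      L2R)‖ = √(b - a) := by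
  rw [norm_indicatorConstLp (by norm_num) (by norm_num), norm_one, one_mul, Real.volume_real_Ioc,
    max_eq_left (sub_nonneg.2 hab), Real.sqrt_eq_rpow]
  norm_num

/-- Averaging `f x = f y - ∫ t in x..y, f' t` over `y ∈ (x, x + 1)`. -/
lemma prim_eq_intervalIntegral {g : ℝ → ℝ} (hg : LocallyIntegrable g) (c x : ℝ) :
    prim c g x = (∫ y in x..(x + 1), prim c g y) + ∫ y in x..(x + 1), (y - (1 + x)) * g y := by
  have hlin : prim (-(1 + x)) (fun _ => 1) = fun y => y - (1 + x) := by
    funext y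
    simp only [prim, intervalIntegral.integral_const, smul_eq_mul]
    ring
  have h := intervalIntegral_mul_prim_add_prim_mul hg (g := fun _ => 1)
    (locallyIntegrable_const _) c (-(1 + x)) x (x + 1)
  rw [hlin, intervalIntegral.integral_add
    ((intervalIntegrable_of_locallyIntegrable hg _ _).mul_continuousOn (by fun_prop))
    (by simpa only [mul_one] using (continuous_prim hg c).intervalIntegrable _ _)] at h
  simp only [mul_one, mul_comm (g _)] at h
  linarith

/-- The representer of point evaluation at `x` on `H²(ℝ)`. -/
def evalVec (x : ℝ) : sobolevSpace 2 :=
  (coord 2 0).adjoint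
      (indicatorConstLp 2 measurableSet_Ioc (measure_Ioc_lt_top (a := x) (b := x + 1)).ne 1)
    + (coord 2 1).adjoint
      ((memLp_indicator_Ioc (φ := fun y => y - (1 + x)) (by fun_prop) x (x + 1)).toLp _)

lemma exists_inner_evalVec_eq_prim (v : sobolevSpace 2) :
    ∃ c : ℝ, coord 2 0 v =ᵐ[volume] prim c (coord 2 1 v) ∧
      ∀ x, ⟪evalVec x, v⟫_ℝ = prim c (coord 2 1 v) x := by
  obtain ⟨c, hc⟩ := (toH2R v).toH1R.exists_ae_eq_prim
  refine ⟨c, hc, fun x => ?_⟩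
  have hint : ∫ y in x..(x + 1), coord 2 0 v y = ∫ y in x..(x + 1), prim c (coord 2 1 v) y :=
    intervalIntegral.integral_congr_ae (hc.mono fun _ hy _ => hy)
  rw [evalVec, inner_add_left, ContinuousLinearMap.adjoint_inner_left,
    ContinuousLinearMap.adjoint_inner_left, inner_indicatorConstLp_Ioc (by linarith),
    inner_indicator_Ioc (by fun_prop) (by linarith), hint]
  exact (prim_eq_intervalIntegral (toH2R v).toH1R.locallyIntegrable_d1 c x).symm

lemma norm_evalVec_sub_le {x y : ℝ} (hxy : x ≤ y) : ‖evalVec y - evalVec x‖ ≤ √(y - x) := by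
  set w := evalVec y - evalVec x with hw
  obtain ⟨c, -, hc⟩ := exists_inner_evalVec_eq_prim w
  have hinner : ⟪w, w⟫_ℝ = ∫ t in x..y, coord 2 1 w t := by
    nth_rw 1 [hw]
    rw [inner_sub_left, hc, hc]
    exact prim_sub_prim (toH2R w).toH1R.locallyIntegrable_d1 c x y
  have hle : ‖w‖ * ‖w‖ ≤ √(y - x) * ‖w‖ := by
    rw [← real_inner_self_eq_norm_mul_norm, hinner, ← inner_indicatorConstLp_Ioc hxy,
      ← norm_indicatorConstLp_Ioc hxy]
    exact (real_inner_le_norm _ _).trans (by gcongr; exact norm_coord_le w 1)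
  rcases (norm_nonneg w).eq_or_lt with hw0 | hw0
  · rw [← hw0]
    positivity
  · exact le_of_mul_le_mul_right hle hw0

lemma continuous_evalVec : Continuous evalVec := by
  refine continuous_iff_continuousAt.2 fun x => tendsto_iff_norm_sub_tendsto_zero.2 ?_
  have hlim : Tendsto (fun y => √|y - x|) (𝓝 x) (𝓝 0) := by
    have hcont : Continuous fun y => √|y - x| := by fun_prop
    simpa using hcont.tendsto x
  refine squeeze_zero (fun _ => norm_nonneg _) (fun y => ?_) hlim
  rcases le_total x y with hxy | hxy
  · rw [abs_of_nonneg (by linarith)]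
    exact norm_evalVec_sub_le hxy
  · rw [abs_of_nonpos (by linarith), neg_sub, norm_sub_rev]
    exact norm_evalVec_sub_le hxy

lemma isCompactOperator_rankOne {H : Type*} [NormedAddCommGroup H] [InnerProductSpace ℝ H]
    (v w : H) : IsCompactOperator (InnerProductSpace.rankOne ℝ v w) := by
  rw [InnerProductSpace.rankOne_def']
  exact (isCompactOperator_of_locallyCompactSpace_dom (innerSL ℝ w)).clm_comp
    (ContinuousLinearMap.toSpanSingleton ℝ v)

lemma integral_mem_of_isClosed {α E : Type*} [MeasurableSpace α] {μ : Measure α}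
    [NormedAddCommGroup E] [NormedSpace ℝ E] [CompleteSpace E] {S : Submodule ℝ E}
    (hS : IsClosed (S : Set E)) {T : α → E} (hT : ∀ x, T x ∈ S) : ∫ x, T x ∂μ ∈ S := by
  by_cases hint : Integrable T μ
  · rw [← Submodule.Quotient.mk_eq_zero S]
    exact (S.mkQL.integral_comp_comm hint).symm.trans
      (integral_eq_zero_of_ae (Eventually.of_forall fun x =>
        (Submodule.Quotient.mk_eq_zero S).2 (hT x)))
  · rw [integral_undef hint]
    exact S.zero_mem

lemma isCompactOperator_integral {α H : Type*} [MeasurableSpace α] {μ : Measure α}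
    [NormedAddCommGroup H] [NormedSpace ℝ H] [CompleteSpace H] {T : α → H →L[ℝ] H}
    (hT : ∀ x, IsCompactOperator (T x)) : IsCompactOperator (∫ x, T x ∂μ : H →L[ℝ] H) :=
  integral_mem_of_isClosed (S := compactOperator (RingHom.id ℝ) H H)
    isClosed_setOfPred_isCompactOperator hT

/-- The operator `∫ V(x) ⟪k x, ·⟫ k x dx` as a norm-convergent integral of rank-one operators. -/
lemma exists_isCompactOperator_inner_eq_integral {H : Type*} [NormedAddCommGroup H]
    [InnerProductSpace ℝ H] [CompleteSpace H] {V : ℝ → ℝ} (hV : Continuous V)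
    (hVc : HasCompactSupport V) {k : ℝ → H} (hk : Continuous k) :
    ∃ T : H →L[ℝ] H, IsCompactOperator T ∧
      ∀ v w, ⟪T v, w⟫_ℝ = ∫ x, V x * (⟪k x, v⟫_ℝ * ⟪k x, w⟫_ℝ) := by
  let T : ℝ → H →L[ℝ] H := fun x => V x • InnerProductSpace.rankOne ℝ (k x) (k x)
  have hcont : Continuous T :=
    hV.smul (((InnerProductSpace.rankOne ℝ).continuous.comp hk).clm_apply hk)
  have hint : Integrable T := hcont.integrable_of_hasCompactSupport hVc.smul_right
  refine ⟨∫ x, T x, isCompactOperator_integral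
    fun x => (isCompactOperator_rankOne _ _).smul (V x), fun v w => ?_⟩
  rw [ContinuousLinearMap.integral_apply hint, real_inner_comm,
    ← integral_inner (hint.apply_continuousLinearMap v) w]
  simp only [T, smul_apply, InnerProductSpace.rankOne_apply, inner_smul_right,
    real_inner_comm w]

lemma isCompactOperator_adjoint_mulL_coord {V : ℝ → ℝ} (hV : Continuous V)
    (hVc : HasCompactSupport V) (hV' : MemLp V ∞ volume) :
    IsCompactOperator ((coord 2 0).adjoint ∘L mulL V hV' ∘L coord 2 0) := by
  obtain ⟨T, hT, hT_inner⟩ := exists_isCompactOperator_inner_eq_integral hV hVc continuous_evalVec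
  have heq : (coord 2 0).adjoint ∘L mulL V hV' ∘L coord 2 0 = T := by
    refine ContinuousLinearMap.ext fun v => ext_inner_right ℝ fun w => ?_
    rw [hT_inner, ContinuousLinearMap.comp_apply, ContinuousLinearMap.adjoint_inner_left,
      ContinuousLinearMap.comp_apply, inner_mulL]
    obtain ⟨c, hc, hc'⟩ := exists_inner_evalVec_eq_prim v
    obtain ⟨d, hd, hd'⟩ := exists_inner_evalVec_eq_prim w
    refine integral_congr_ae ?_
    filter_upwards [hc, hd] with x hcx hdx
    rw [hc', hd', hcx, hdx, mul_assoc]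
  rwa [heq]

/-! ### Compact perturbations of coercive operators -/

section kernel

variable {H : Type*} [NormedAddCommGroup H] [InnerProductSpace ℝ H]

lemma norm_sq_apply_le_of_isPositive {Q : H →L[ℝ] H} (hQ : Q.IsPositive) (v : H) :
    ‖Q v‖ ^ 2 ≤ ‖Q‖ * ⟪Q v, v⟫_ℝ := by
  have hcs := LinearMap.BilinForm.apply_mul_apply_le_of_forall_zero_le
    ((innerₗ H).comp Q.toLinearMap) hQ.inner_nonneg_left v (Q v)
  simp only [LinearMap.comp_apply, ContinuousLinearMap.coe_coe, innerₗ_apply_apply] at hcs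
  rw [show ⟪Q (Q v), v⟫_ℝ = ⟪Q v, Q v⟫_ℝ from hQ.isSymmetric (Q v) v,
    real_inner_self_eq_norm_sq] at hcs
  have hle : ⟪Q (Q v), Q v⟫_ℝ ≤ ‖Q‖ * ‖Q v‖ ^ 2 := by
    calc ⟪Q (Q v), Q v⟫_ℝ ≤ ‖Q (Q v)‖ * ‖Q v‖ := real_inner_le_norm _ _
      _ ≤ ‖Q‖ * ‖Q v‖ * ‖Q v‖ := by gcongr; exact Q.le_opNorm _
      _ = ‖Q‖ * ‖Q v‖ ^ 2 := by ring
  have hnonneg : 0 ≤ ⟪Q v, v⟫_ℝ := hQ.inner_nonneg_left v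
  rcases (sq_nonneg ‖Q v‖).eq_or_lt with hzero | hpos
  · rw [← hzero]
    positivity
  · refine le_of_mul_le_mul_right ?_ hpos
    calc ‖Q v‖ ^ 2 * ‖Q v‖ ^ 2 ≤ ⟪Q v, v⟫_ℝ * ⟪Q (Q v), Q v⟫_ℝ := hcs
      _ ≤ ⟪Q v, v⟫_ℝ * (‖Q‖ * ‖Q v‖ ^ 2) := by gcongr
      _ = ‖Q‖ * ⟪Q v, v⟫_ℝ * ‖Q v‖ ^ 2 := by ring

variable [CompleteSpace H] {A K : H →L[ℝ] H} {c : ℝ}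

lemma exists_continuousLinearEquiv_of_coercive (hc : 0 < c)
    (hA : ∀ v, c * ‖v‖ ^ 2 ≤ ⟪A v, v⟫_ℝ) : ∃ e : H ≃L[ℝ] H, (e : H →L[ℝ] H) = A := by
  have hco : IsCoercive (innerSL ℝ ∘L A) := ⟨c, hc, fun v => by
    rw [mul_assoc, ← sq]
    exact hA v⟩
  exact ⟨hco.continuousLinearEquivOfBilin, ContinuousLinearMap.ext fun v =>
    ext_inner_right ℝ fun w => hco.continuousLinearEquivOfBilin_apply v w⟩

/-- The Fredholm alternative for `A⁻¹ K`. -/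
lemma exists_antilipschitzWith_sub (hK : IsCompactOperator K) (hc : 0 < c)
    (hA : ∀ v, c * ‖v‖ ^ 2 ≤ ⟪A v, v⟫_ℝ) (hinj : ∀ v, A v = K v → v = 0) :
    ∃ C, AntilipschitzWith C (A - K) := by
  obtain ⟨e, rfl⟩ := exists_continuousLinearEquiv_of_coercive hc hA
  let T : H →L[ℝ] H := (e.symm : H →L[ℝ] H) ∘L K
  have hT : ¬ Module.End.HasEigenvalue (T : Module.End ℝ H) 1 := fun hev => by
    obtain ⟨v, hv⟩ := hev.exists_hasEigenvector
    refine hv.2 (hinj v ?_)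
    rw [ContinuousLinearEquiv.coe_coe, ← e.eq_symm_apply, ← one_smul ℝ v]
    exact (hv.apply_eq_smul.symm.trans (by rw [one_smul]; rfl))
  obtain ⟨C, hC⟩ := (hK.clm_comp (e.symm : H →L[ℝ] H)).antilipschitz_of_not_hasEigenvalue
    one_ne_zero hT
  have heq : ⇑((e : H →L[ℝ] H) - K) = fun v => -(e ((T - (1 : ℝ) • 1) v)) := by
    funext v
    simp [T]
  have hanti := e.antilipschitz.comp hC
  exact ⟨_, fun v w => by
    rw [heq, edist_neg_neg]
    exact hanti v w⟩

lemma exists_ne_zero_apply_eq_of_not_coercive (hK : IsCompactOperator K) (hc : 0 < c)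
    (hA : ∀ v, c * ‖v‖ ^ 2 ≤ ⟪A v, v⟫_ℝ) (hQ : (A - K).IsPositive)
    (hinf : ∀ ε > 0, ∃ v, ⟪(A - K) v, v⟫_ℝ < ε * ‖v‖ ^ 2) : ∃ v ≠ 0, A v = K v := by
  by_contra! hker
  obtain ⟨C, hC⟩ := exists_antilipschitzWith_sub hK hc hA fun v hv => by_contra (hker v · hv)
  set Q := A - K
  set B : ℝ := C ^ 2 * ‖Q‖
  have hB : 0 < B + 1 := by positivity
  have hcoercive : ∀ v, ‖v‖ ^ 2 ≤ B * ⟪Q v, v⟫_ℝ := fun v => by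
    have hv := hC.le_mul_dist v 0
    rw [map_zero, dist_zero_right, dist_zero_right] at hv
    calc ‖v‖ ^ 2 ≤ (C * ‖Q v‖) ^ 2 := by gcongr
      _ = C ^ 2 * ‖Q v‖ ^ 2 := by ring
      _ ≤ C ^ 2 * (‖Q‖ * ⟪Q v, v⟫_ℝ) := by gcongr; exact norm_sq_apply_le_of_isPositive hQ v
      _ = B * ⟪Q v, v⟫_ℝ := by ring
  obtain ⟨v, hv⟩ := hinf (B + 1)⁻¹ (by positivity)
  rw [inv_mul_eq_div, lt_div_iff₀ hB] at hv
  have hnonneg : 0 ≤ ⟪Q v, v⟫_ℝ := hQ.inner_nonneg_left v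
  linarith [hcoercive v]

end kernel

/-! ### Functions with derivatives in `Lᵖ` -/

/-- `y` is of class `Cⁿ` with `y, y', …, y⁽ⁿ⁾` all in `Lᵖ(ℝ)`. For `p = 2` this is the classical
counterpart of `Hⁿ(ℝ)`, for `p = ∞` the space of functions with bounded derivatives. -/
def ContDiffLp (p : ℝ≥0∞) (n : ℕ∞) (y : ℝ → ℝ) : Prop :=
  ContDiff ℝ n y ∧ ∀ k : ℕ, (k : ℕ∞) ≤ n → MemLp (iteratedDeriv k y) p volume

namespace ContDiffLp

variable {p q r : ℝ≥0∞} {n : ℕ∞} {y z : ℝ → ℝ}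

lemma memLp (hy : ContDiffLp p n y) : MemLp y p volume := by
  simpa only [iteratedDeriv_zero] using hy.2 0 bot_le

lemma hasDerivAt (hy : ContDiffLp p ⊤ y) (x : ℝ) : HasDerivAt y (deriv y x) x :=
  (hy.1.differentiable (by simp) x).hasDerivAt

lemma deriv (hy : ContDiffLp p ⊤ y) : ContDiffLp p ⊤ (deriv y) :=
  ⟨(contDiff_infty_iff_deriv.1 hy.1).2, fun k _ => by
    simpa only [← iteratedDeriv_succ'] using hy.2 (k + 1) le_top⟩

lemma add (hy : ContDiffLp p n y) (hz : ContDiffLp p n z) :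
    ContDiffLp p n fun x => y x + z x := by
  refine ⟨hy.1.add hz.1, fun k hk => ?_⟩
  have hkn : (k : WithTop ℕ∞) ≤ n := mod_cast hk
  have heq : iteratedDeriv k (fun x => y x + z x) =
      fun x => iteratedDeriv k y x + iteratedDeriv k z x := funext fun x =>
    iteratedDeriv_fun_add (hy.1.of_le hkn).contDiffAt (hz.1.of_le hkn).contDiffAt
  rw [heq]
  exact (hy.2 k hk).add (hz.2 k hk)

lemma mul [ENNReal.HolderTriple p q r] (hy : ContDiffLp p n y) (hz : ContDiffLp q n z) :
    ContDiffLp r n fun x => y x * z x := by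
  refine ⟨hy.1.mul hz.1, fun k hk => ?_⟩
  have hkn : (k : WithTop ℕ∞) ≤ n := mod_cast hk
  have heq : iteratedDeriv k (fun x => y x * z x) = fun x => ∑ i ∈ Finset.range (k + 1),
      k.choose i * iteratedDeriv i y x * iteratedDeriv (k - i) z x := funext fun x =>
    iteratedDeriv_fun_mul (hy.1.of_le hkn).contDiffAt (hz.1.of_le hkn).contDiffAt
  rw [heq]
  refine memLp_finsetSum _ fun i hi => ?_
  have hik : i ≤ k := Finset.mem_range_succ_iff.1 hi
  simp only [mul_assoc]
  exact ((hz.2 (k - i) (le_trans (mod_cast k.sub_le i) hk)).mul'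
    (hy.2 i (le_trans (mod_cast hik) hk))).const_mul _

lemma sum {ι : Type*} (s : Finset ι) {y : ι → ℝ → ℝ} (hy : ∀ i ∈ s, ContDiffLp p n (y i)) :
    ContDiffLp p n fun x => ∑ i ∈ s, y i x := by
  refine ⟨ContDiff.sum fun i hi => (hy i hi).1, fun k hk => ?_⟩
  have hkn : (k : WithTop ℕ∞) ≤ n := mod_cast hk
  have heq : iteratedDeriv k (fun x => ∑ i ∈ s, y i x) =
      fun x => ∑ i ∈ s, iteratedDeriv k (y i) x := funext fun x =>
    iteratedDeriv_fun_sum fun i hi => ((hy i hi).1.of_le hkn).contDiffAt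
  rw [heq]
  exact memLp_finsetSum _ fun i hi => (hy i hi).2 k hk

lemma const (a : ℝ) : ContDiffLp ∞ n fun _ => a :=
  ⟨contDiff_const, fun k _ => by
    have heq : iteratedDeriv k (fun _ : ℝ => a) = fun _ => if k = 0 then a else 0 :=
      funext fun _ => iteratedDeriv_const
    rw [heq]
    exact memLp_top_const _⟩

lemma const_mul (a : ℝ) (hy : ContDiffLp p n y) : ContDiffLp p n fun x => a * y x :=
  (const a).mul hy

lemma neg (hy : ContDiffLp p n y) : ContDiffLp p n (-y) := by
  simpa only [neg_one_mul, ← Pi.neg_def] using hy.const_mul (-1)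

lemma sub (hy : ContDiffLp p n y) (hz : ContDiffLp p n z) : ContDiffLp p n fun x => y x - z x := by
  simpa only [sub_eq_add_neg, Pi.neg_apply] using hy.add hz.neg

lemma of_hasCompactSupport (hy : ContDiff ℝ n y) (hc : HasCompactSupport y) :
    ContDiffLp p n y := by
  have hcompact : ∀ k, HasCompactSupport (iteratedDeriv k y) := fun k => by
    induction k with
    | zero => simpa only [iteratedDeriv_zero] using hc
    | succ k ih => simpa only [iteratedDeriv_succ] using ih.deriv
  exact ⟨hy, fun k hk => (hy.continuous_iteratedDeriv k (mod_cast hk)).memLp_of_hasCompactSupport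
    (hcompact k)⟩

lemma of_deriv (hd : ∀ x, HasDerivAt y (z x) x) (hy : MemLp y p volume)
    (hz : ContDiffLp p n z) : ContDiffLp p (n + 1) y := by
  have hderiv : _root_.deriv y = z := funext fun x => (hd x).deriv
  refine ⟨?_, fun k hk => ?_⟩
  · push_cast
    refine contDiff_succ_iff_deriv.2 ⟨fun x => (hd x).differentiableAt, by simp, hderiv ▸ hz.1⟩
  · cases k with
    | zero => simpa only [iteratedDeriv_zero] using hy
    | succ k =>
      rw [iteratedDeriv_succ', hderiv]
      exact hz.2 k ((ENat.add_le_add_iff_right ENat.one_ne_top).1 (mod_cast hk))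

lemma of_forall_nat (h : ∀ n : ℕ, ContDiffLp p n y) : ContDiffLp p ⊤ y :=
  ⟨contDiff_infty.2 fun n => (h n).1, fun k _ => (h k).2 k le_rfl⟩

lemma of_le {m : ℕ∞} (hy : ContDiffLp p n y) (hmn : m ≤ n) : ContDiffLp p m y :=
  ⟨hy.1.of_le (mod_cast hmn), fun k hk => hy.2 k (hk.trans hmn)⟩

/-- Solutions of linear systems with smooth bounded coefficients are as integrable as they are
smooth. -/
lemma of_linear_system {ι : Type*} [Fintype ι] {y : ι → ℝ → ℝ} {a : ι → ι → ℝ → ℝ}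
    (ha : ∀ i j, ContDiffLp ∞ ⊤ (a i j))
    (hd : ∀ i x, HasDerivAt (y i) (∑ j, a i j x * y j x) x) (hy : ∀ i, MemLp (y i) p volume)
    (i : ι) : ContDiffLp p ⊤ (y i) := by
  refine of_forall_nat fun n => ?_
  induction n generalizing i with
  | zero =>
    have hcont : Continuous (y i) :=
      continuous_iff_continuousAt.2 fun x => (hd i x).continuousAt
    refine ⟨contDiff_zero.2 hcont, fun k hk => ?_⟩
    obtain rfl : k = 0 := by simpa using hk
    simpa only [iteratedDeriv_zero] using hy i
  | succ n ih =>
    exact of_deriv (hd i) (hy i) (sum _ fun j _ => ((ha i j).of_le le_top).mul (ih j))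

end ContDiffLp

lemma tendsto_cocompact_zero_of_memLp_two {y z : ℝ → ℝ} (hd : ∀ x, HasDerivAt y (z x) x)
    (hy : MemLp y 2 volume) (hz : MemLp z 2 volume) : Tendsto y (cocompact ℝ) (𝓝 0) := by
  have hdsq : ∀ x, HasDerivAt (y * y) ((z * y + y * z) x) x := fun x => (hd x).mul (hd x)
  have hint := (hz.integrable_mul hy).add (hy.integrable_mul hz)
  have hintsq := hy.integrable_mul hy
  have hsq : Tendsto (y * y) (cocompact ℝ) (𝓝 0) := by
    rw [cocompact_eq_atBot_atTop]
    exact (tendsto_zero_of_hasDerivAt_of_integrableOn_Iic (a := 0) (fun x _ => hdsq x)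
      hint.integrableOn hintsq.integrableOn).sup
      (tendsto_zero_of_hasDerivAt_of_integrableOn_Ioi (a := 0) (fun x _ => hdsq x)
        hint.integrableOn hintsq.integrableOn)
  have habs := hsq.sqrt
  simp only [Pi.mul_apply, Real.sqrt_mul_self_eq_abs, Real.sqrt_zero] at habs
  exact (tendsto_zero_iff_abs_tendsto_zero _).2 habs

lemma ContDiffLp.exists_deriv_ne_zero {y : ℝ → ℝ} (hy : ContDiffLp 2 ⊤ y) (hy0 : y ≠ 0) :
    ∃ x, _root_.deriv y x ≠ 0 := by
  by_contra! h
  have hlim := tendsto_cocompact_zero_of_memLp_two hy.hasDerivAt hy.memLp hy.deriv.memLp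
  have hconst := is_const_of_deriv_eq_zero (hy.1.differentiable (by simp)) h
  exact hy0 (funext fun x =>
    tendsto_nhds_unique (tendsto_const_nhds.congr fun z => hconst x z) hlim)

/-! ### Regularity of weak solutions -/

lemma HasWeakDeriv.ae_eq_zero {f g : ℝ → ℝ} (h : HasWeakDeriv f g) (hg : LocallyIntegrable g)
    (hf : f =ᵐ[volume] 0) : g =ᵐ[volume] 0 := by
  refine ae_eq_zero_of_integral_contDiff_smul_eq_zero hg fun η hη hηc => ?_
  have hzero := (h.congr hf (ae_eq_refl g)) η hη hηc
  simp only [Pi.zero_apply, zero_mul, integral_zero] at hzero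
  simp only [smul_eq_mul, mul_comm (η _)]
  linarith

lemma HasWeakDeriv.mul {f g c : ℝ → ℝ} (h : HasWeakDeriv f g) (hf : LocallyIntegrable f)
    (hg : LocallyIntegrable g) (hc : ContDiff ℝ ∞ c) :
    HasWeakDeriv (fun x => c x * f x) fun x => deriv c x * f x + c x * g x := by
  intro η hη hηc
  have hderiv : ∀ x, deriv (fun x => c x * η x) x = deriv c x * η x + c x * deriv η x := fun x =>
    deriv_fun_mul (hc.differentiable (by simp) x) (hη.differentiable (by simp) x)
  have hcη := h _ (hc.mul hη) hηc.mul_left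
  have hint₁ := integrable_mul_of_hasCompactSupport hf
    ((hc.continuous_deriv (by simp)).fun_mul hη.continuous) hηc.mul_left
  have hint₂ := integrable_mul_of_hasCompactSupport hf
    (hc.continuous.fun_mul (hη.continuous_deriv (by simp))) hηc.deriv.mul_left
  have hint₃ := integrable_mul_of_hasCompactSupport hg (hc.continuous.fun_mul hη.continuous)
    hηc.mul_left
  simp only [hderiv, mul_add] at hcη
  rw [integral_add hint₁ hint₂] at hcη
  calc ∫ x, c x * f x * deriv η x = ∫ x, f x * (c x * deriv η x) := by
        simp only [mul_comm (c _), mul_assoc]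
    _ = -((∫ x, f x * (deriv c x * η x)) + ∫ x, g x * (c x * η x)) := by linarith
    _ = -∫ x, (deriv c x * f x + c x * g x) * η x := by
        rw [← integral_add hint₁ hint₃]
        congr 2 with x
        ring

/-- The product of an element of `H¹(ℝ)` and a smooth function with bounded derivatives. -/
def H1R.mul (u : H1R) {c : ℝ → ℝ} (hc : ContDiffLp ∞ ⊤ c) : H1R where
  f x := c x * u.f x
  d1 x := deriv c x * u.f x + c x * u.d1 x
  memLp_f := u.memLp_f.mul' hc.memLp
  memLp_d1 := (u.memLp_f.mul' hc.deriv.memLp).add (u.memLp_d1.mul' hc.memLp)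
  weak_d1 := u.weak_d1.mul u.locallyIntegrable_f u.locallyIntegrable_d1 hc.1

/-- The derivative of an element of `H²(ℝ)`. -/
def H2R.derivH1 (ψ : H2R) : H1R where
  f := ψ.d1
  d1 := ψ.d2
  memLp_f := ψ.memLp_d1
  memLp_d1 := ψ.memLp_d2
  weak_d1 := ψ.weak_d2

lemma H2R.integral_f_mul_d2_comm (ψ φ : H2R) : ∫ x, ψ.f x * φ.d2 x = ∫ x, ψ.d2 x * φ.f x :=
  calc ∫ x, ψ.f x * φ.d2 x = -∫ x, ψ.d1 x * φ.d1 x := ψ.toH1R.integral_f_mul_d1 φ.derivH1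
    _ = ∫ x, ψ.d2 x * φ.f x := by
      rw [show ∫ x, ψ.d1 x * φ.d1 x = -∫ x, ψ.d2 x * φ.f x from
        ψ.derivH1.integral_f_mul_d1 φ.toH1R, neg_neg]

/-- Very weak solutions in `L²` of `u'' = F` lie in `H²`: subtracting the `H²` solution of
`v'' = v - (u - F)` leaves a function orthogonal to the range of `φ ↦ φ - φ''`. -/
lemma exists_H2R_of_weak_second {u F : ℝ → ℝ} (hu : MemLp u 2 volume) (hF : MemLp F 2 volume)
    (h : ∀ φ : H2R, ∫ x, u x * φ.d2 x = ∫ x, F x * φ.f x) :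
    ∃ v : H2R, u =ᵐ[volume] v.f ∧ v.d2 =ᵐ[volume] F := by
  obtain ⟨v, hv⟩ := exists_H2R_d2_eq_sub (hu.sub hF)
  let e : ℝ → ℝ := u - v.f
  have he : MemLp e 2 volume := hu.sub v.memLp_f
  have hF_sub : ∀ x, F x - v.d2 x = e x := fun x => by
    simp only [hv, e, Pi.sub_apply]
    ring
  have hweak : ∀ φ : H2R, ∫ x, e x * φ.d2 x = ∫ x, e x * φ.f x := fun φ =>
    calc ∫ x, e x * φ.d2 x = (∫ x, u x * φ.d2 x) - ∫ x, v.f x * φ.d2 x := by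
          simp only [e, Pi.sub_apply, sub_mul]
          exact integral_sub (hu.integrable_mul φ.memLp_d2) (v.memLp_f.integrable_mul φ.memLp_d2)
      _ = (∫ x, F x * φ.f x) - ∫ x, v.d2 x * φ.f x := by rw [h, v.integral_f_mul_d2_comm]
      _ = ∫ x, e x * φ.f x := by
          simp only [← hF_sub, sub_mul]
          exact (integral_sub (hF.integrable_mul φ.memLp_f)
            (v.memLp_d2.integrable_mul φ.memLp_f)).symm
  obtain ⟨φ, hφ⟩ := exists_H2R_d2_eq_sub he
  have hsq : ∫ x, e x * e x = 0 := by
    have hφ_weak := hweak φ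
    simp only [hφ, mul_sub] at hφ_weak
    have hsub : ∫ x, (e x * φ.f x - e x * e x) = (∫ x, e x * φ.f x) - ∫ x, e x * e x :=
      integral_sub (he.integrable_mul φ.memLp_f) (he.integrable_mul he)
    linarith
  have hzero : e =ᵐ[volume] 0 := by
    filter_upwards [(integral_eq_zero_iff_of_nonneg (fun x => mul_self_nonneg (e x))
      (he.integrable_mul he)).1 hsq] with x hx
    exact mul_self_eq_zero.1 hx
  refine ⟨v, (sub_ae_eq_zero _ _).1 hzero, ?_⟩
  filter_upwards [hzero] with x hx
  linarith [hF_sub x, hx.trans (Pi.zero_apply x)]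

lemma H1R.exists_hasDerivAt (u : H1R) {g : ℝ → ℝ} (hg : Continuous g) (h : u.d1 =ᵐ[volume] g) :
    ∃ y, u.f =ᵐ[volume] y ∧ ∀ x, HasDerivAt y (g x) x := by
  obtain ⟨c, hc⟩ := u.exists_ae_eq_prim
  exact ⟨prim c g, by rwa [← prim_congr_ae h], hasDerivAt_prim hg c⟩

lemma exists_contDiffLp_of_weak_linear_system {ι : Type*} [Fintype ι] {a : ι → ι → ℝ → ℝ}
    (ha : ∀ i j, ContDiffLp ∞ ⊤ (a i j)) (u : ι → H1R)
    (hu : ∀ i, (u i).d1 =ᵐ[volume] fun x => ∑ j, a i j x * (u j).f x) :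
    ∃ y : ι → ℝ → ℝ, ∀ i, ContDiffLp 2 ⊤ (y i) ∧ (u i).f =ᵐ[volume] y i ∧
      ∀ x, HasDerivAt (y i) (∑ j, a i j x * y j x) x := by
  choose c hc using fun i => (u i).exists_ae_eq_prim
  let z : ι → ℝ → ℝ := fun i => prim (c i) (u i).d1
  have hz : ∀ i, Continuous (z i) := fun i => continuous_prim (u i).locallyIntegrable_d1 (c i)
  have hsum : ∀ i, Continuous fun x => ∑ j, a i j x * z j x := fun i =>
    continuous_finsetSum _ fun j _ => (ha i j).1.continuous.mul (hz j)
  have hd1 : ∀ i, (u i).d1 =ᵐ[volume] fun x => ∑ j, a i j x * z j x := fun i => by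
    filter_upwards [hu i, ae_all_iff.2 hc] with x hx hcx
    simp only [hx, hcx, z]
  choose y hy hd using fun i => (u i).exists_hasDerivAt (hsum i) (hd1 i)
  have hyz : ∀ i, y i = z i := fun i => Continuous.ae_eq_iff_eq volume
    (continuous_iff_continuousAt.2 fun x => (hd i x).continuousAt) (hz i) |>.1
      ((hy i).symm.trans (hc i))
  simp only [← hyz] at hd
  exact ⟨y, fun i => ⟨ContDiffLp.of_linear_system ha hd (fun i => (u i).memLp_f.ae_eq (hy i)) i,
    hy i, hd i⟩⟩

section fourthOrder

variable {a : ℝ} {b c : ℝ → ℝ}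

lemma exists_H2R_ae_eq_d2_of_weak (ha : a ≠ 0) (hb : ContDiffLp ∞ ⊤ b) (hc : ContDiffLp ∞ ⊤ c)
    (ψ : H2R)
    (h : ∀ φ : H2R, a * (∫ x, ψ.d2 x * φ.d2 x) + (∫ x, b x * ψ.d1 x * φ.d1 x)
      + ∫ x, c x * ψ.f x * φ.f x = 0) :
    ∃ v : H2R, ψ.d2 =ᵐ[volume] v.f ∧
      v.d2 =ᵐ[volume] fun x => a⁻¹ * (deriv b x * ψ.d1 x + b x * ψ.d2 x - c x * ψ.f x) := by
  let w : H1R := ψ.derivH1.mul hb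
  have hcψ : MemLp (fun x => c x * ψ.f x) 2 volume := ψ.memLp_f.mul' hc.memLp
  refine exists_H2R_of_weak_second ψ.memLp_d2 ((w.memLp_d1.sub hcψ).const_mul a⁻¹) fun φ => ?_
  have hw : ∫ x, b x * ψ.d1 x * φ.d1 x = -∫ x, w.d1 x * φ.f x := w.integral_f_mul_d1 φ.toH1R
  have hψ : a * (∫ x, ψ.d2 x * φ.d2 x) = (∫ x, w.d1 x * φ.f x) - ∫ x, c x * ψ.f x * φ.f x := by
    linarith [h φ]
  calc ∫ x, ψ.d2 x * φ.d2 x = a⁻¹ * ((∫ x, w.d1 x * φ.f x) - ∫ x, c x * ψ.f x * φ.f x) := by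
        rw [← hψ, inv_mul_cancel_left₀ ha]
    _ = a⁻¹ * ∫ x, (w.d1 x * φ.f x - c x * ψ.f x * φ.f x) := congrArg _ (integral_sub
        (w.memLp_d1.integrable_mul φ.memLp_f) (hcψ.integrable_mul φ.memLp_f)).symm
    _ = ∫ x, a⁻¹ * (w.d1 x - c x * ψ.f x) * φ.f x := by
        simp only [← integral_const_mul, mul_assoc, sub_mul]

lemma exists_contDiffLp_of_weak (ha : a ≠ 0) (hb : ContDiffLp ∞ ⊤ b) (hc : ContDiffLp ∞ ⊤ c)
    (ψ : H2R)
    (h : ∀ φ : H2R, a * (∫ x, ψ.d2 x * φ.d2 x) + (∫ x, b x * ψ.d1 x * φ.d1 x)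
      + ∫ x, c x * ψ.f x * φ.f x = 0) :
    ∃ y, ContDiffLp 2 ⊤ y ∧ ψ.f =ᵐ[volume] y ∧
      ∀ x, a * deriv (deriv (deriv (deriv y))) x
        = deriv b x * deriv y x + b x * deriv (deriv y) x - c x * y x := by
  obtain ⟨v, hv, hv2⟩ := exists_H2R_ae_eq_d2_of_weak ha hb hc ψ h
  let A : Fin 4 → Fin 4 → ℝ → ℝ :=
    ![![fun _ => 0, fun _ => 1, fun _ => 0, fun _ => 0],
      ![fun _ => 0, fun _ => 0, fun _ => 1, fun _ => 0],
      ![fun _ => 0, fun _ => 0, fun _ => 0, fun _ => 1],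
      ![fun x => -a⁻¹ * c x, fun x => a⁻¹ * deriv b x, fun x => a⁻¹ * b x, fun _ => 0]]
  have hA : ∀ i j, ContDiffLp ∞ ⊤ (A i j) := by
    simp [-neg_mul, Fin.forall_fin_succ, A, ContDiffLp.const, hc.const_mul, hb.const_mul,
      hb.deriv.const_mul]
  obtain ⟨y, hy⟩ := exists_contDiffLp_of_weak_linear_system hA
    ![ψ.toH1R, ψ.derivH1, v.toH1R, v.derivH1] <| by
      simp only [Fin.forall_fin_succ, Fin.sum_univ_four, A]
      refine ⟨?_, ?_, ?_, ?_, fun i => i.elim0⟩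
      · simp [H2R.derivH1]
      · simpa [H2R.derivH1] using hv
      · simp [H2R.derivH1]
      · filter_upwards [hv, hv2] with x hx hx2
        simp [H2R.derivH1, hx2, ← hx]
        ring
  have hd : ∀ i x, deriv (y i) x = ∑ j, A i j x * y j x := fun i x => ((hy i).2.2 x).deriv
  have h0 : deriv (y 0) = y 1 := funext fun x => by simpa [Fin.sum_univ_four, A] using hd 0 x
  have h1 : deriv (y 1) = y 2 := funext fun x => by simpa [Fin.sum_univ_four, A] using hd 1 x
  have h2 : deriv (y 2) = y 3 := funext fun x => by simpa [Fin.sum_univ_four, A] using hd 2 x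
  have h3 : ∀ x, deriv (y 3) x = -a⁻¹ * c x * y 0 x + a⁻¹ * deriv b x * y 1 x
      + a⁻¹ * b x * y 2 x := fun x => by simpa [Fin.sum_univ_four, A] using hd 3 x
  refine ⟨y 0, (hy 0).1, (hy 0).2.1, fun x => ?_⟩
  rw [h0, h1, h2, h3]
  field_simp
  ring

end fourthOrder

/-! ### Kernels of weighted forms -/

/-- The operator on `H²(ℝ)` representing the form `∫ c ψ⁽ⁱ⁾ φ⁽ⁱ⁾`. -/
def weightOp (i : Fin 3) (c : ℝ → ℝ) (hc : MemLp c ∞ volume) :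
    sobolevSpace 2 →L[ℝ] sobolevSpace 2 :=
  (coord 2 i).adjoint ∘L mulL c hc ∘L coord 2 i

lemma inner_weightOp (i : Fin 3) {c : ℝ → ℝ} (hc : MemLp c ∞ volume) (ψ φ : H2R) :
    ⟪weightOp i c hc ψ.toSobolevSpace, φ.toSobolevSpace⟫_ℝ
      = ∫ x, c x * ψ.jet i x * φ.jet i x := by
  rw [weightOp, ContinuousLinearMap.comp_apply, ContinuousLinearMap.adjoint_inner_left,
    ContinuousLinearMap.comp_apply, inner_mulL, H2R.coord_toSobolevSpace, H2R.coord_toSobolevSpace]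
  refine integral_congr_ae ?_
  filter_upwards [(ψ.memLp_jet i).coeFn_toLp, (φ.memLp_jet i).coeFn_toLp] with x hψ hφ
  rw [hψ, hφ]

lemma sobolevSpace.toSobolevSpace_toH2R (v : sobolevSpace 2) : (toH2R v).toSobolevSpace = v := by
  ext1
  ext1 i
  fin_cases i <;> exact Lp.toLp_coeFn _ (Lp.memLp _)

lemma H2R.norm_sq_toSobolevSpace (ψ : H2R) :
    ‖ψ.toSobolevSpace‖ ^ 2 = ∑ i, ∫ x, ψ.jet i x ^ 2 := by
  rw [← real_inner_self_eq_norm_sq, inner_eq]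
  simp only [H2R.coord_toSobolevSpace, inner_toLp_toLp, sq]

lemma H2R.toSobolevSpace_eq_zero {ψ : H2R} (h : ψ.f =ᵐ[volume] 0) : ψ.toSobolevSpace = 0 := by
  have h1 := ψ.weak_d1.ae_eq_zero ψ.locallyIntegrable_d1 h
  have h2 := ψ.weak_d2.ae_eq_zero ψ.derivH1.locallyIntegrable_d1 h1
  have hint : ∀ {f : ℝ → ℝ}, f =ᵐ[volume] 0 → ∫ x, f x ^ 2 = 0 := fun hf =>
    integral_eq_zero_of_ae (by filter_upwards [hf] with x hx; simp [hx])
  rw [← norm_eq_zero, ← sq_eq_zero_iff, H2R.norm_sq_toSobolevSpace, Fin.sum_univ_three]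
  simp [H2R.jet, hint h, hint h1, hint h2]

/-- The form `∫ c₂ ψ'' φ'' + c₁ ψ' φ' + c₀ ψ φ - V ψ φ`. -/
def weightedForm (c : Fin 3 → ℝ → ℝ) (V : ℝ → ℝ) (ψ φ : H2R) : ℝ :=
  (∑ i, ∫ x, c i x * ψ.jet i x * φ.jet i x) - ∫ x, V x * ψ.f x * φ.f x

section weightedForm

variable {c : Fin 3 → ℝ → ℝ} {V : ℝ → ℝ} {m : ℝ}

lemma weightedForm_comm (ψ φ : H2R) : weightedForm c V ψ φ = weightedForm c V φ ψ := by
  simp only [weightedForm, mul_assoc, mul_comm (ψ.jet _ _), mul_comm (ψ.f _)]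

lemma inner_sum_weightOp_sub (hc : ∀ i, MemLp (c i) ∞ volume) (hV : MemLp V ∞ volume)
    (ψ φ : H2R) :
    ⟪((∑ i, weightOp i (c i) (hc i)) - weightOp 0 V hV) ψ.toSobolevSpace, φ.toSobolevSpace⟫_ℝ
      = weightedForm c V ψ φ := by
  simp only [sub_apply, sum_apply, inner_sub_left, sum_inner, inner_weightOp]
  rfl

lemma le_inner_sum_weightOp (hc : ∀ i, MemLp (c i) ∞ volume) (hcm : ∀ i x, m ≤ c i x) (ψ : H2R) :
    m * ‖ψ.toSobolevSpace‖ ^ 2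
      ≤ ⟪(∑ i, weightOp i (c i) (hc i)) ψ.toSobolevSpace, ψ.toSobolevSpace⟫_ℝ := by
  simp only [sum_apply, sum_inner, inner_weightOp]
  rw [H2R.norm_sq_toSobolevSpace, Finset.mul_sum]
  refine Finset.sum_le_sum fun i _ => ?_
  rw [← integral_const_mul]
  have hψ := ψ.memLp_jet i
  have hcψ : MemLp (fun x => c i x * ψ.jet i x) 2 volume := hψ.mul' (hc i)
  refine integral_mono (hψ.integrable_sq.const_mul m) (hcψ.integrable_mul hψ) fun x => ?_
  calc m * ψ.jet i x ^ 2 ≤ c i x * ψ.jet i x ^ 2 := by gcongr; exact hcm i x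
    _ = c i x * ψ.jet i x * ψ.jet i x := by ring

lemma exists_weightedForm_eq_zero (hm : 0 < m) (hc : ∀ i, MemLp (c i) ∞ volume)
    (hcm : ∀ i x, m ≤ c i x) (hV : Continuous V) (hVc : HasCompactSupport V)
    (hpos : ∀ ψ, 0 ≤ weightedForm c V ψ ψ)
    (hinf : ∀ ε > 0, ∃ ψ : H2R, weightedForm c V ψ ψ < ε * ‖ψ.toSobolevSpace‖ ^ 2) :
    ∃ ψ : H2R, ψ.toSobolevSpace ≠ 0 ∧ ∀ φ, weightedForm c V ψ φ = 0 := by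
  have hVb : MemLp V ∞ volume := hV.memLp_of_hasCompactSupport hVc
  let A := ∑ i, weightOp i (c i) (hc i)
  let K := weightOp 0 V hVb
  have hQ : ∀ v w : sobolevSpace 2, ⟪(A - K) v, w⟫_ℝ = weightedForm c V (toH2R v) (toH2R w) :=
    fun v w => by
      conv_lhs => rw [← toSobolevSpace_toH2R v, ← toSobolevSpace_toH2R w]
      exact inner_sum_weightOp_sub hc hVb _ _
  have hA : ∀ v, m * ‖v‖ ^ 2 ≤ ⟪A v, v⟫_ℝ := fun v => by
    simpa only [toSobolevSpace_toH2R] using le_inner_sum_weightOp hc hcm (toH2R v)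
  have hpositive : (A - K).IsPositive := by
    refine (ContinuousLinearMap.isPositive_iff _).2 ⟨fun v w => ?_, fun v => ?_⟩
    · exact (hQ v w).trans <| (weightedForm_comm _ _).trans <|
        (hQ w v).symm.trans (real_inner_comm _ _)
    · exact (hpos _).trans_eq (hQ v v).symm
  obtain ⟨v, hv0, hv⟩ := exists_ne_zero_apply_eq_of_not_coercive (A := A) (K := K)
    (isCompactOperator_adjoint_mulL_coord hV hVc hVb) hm hA hpositive fun ε hε =>
      (hinf ε hε).imp' _ fun ψ hψ => (inner_sum_weightOp_sub hc hVb ψ ψ).trans_lt hψ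
  refine ⟨toH2R v, by rwa [toSobolevSpace_toH2R], fun φ => ?_⟩
  calc weightedForm c V (toH2R v) φ = ⟪(A - K) v, φ.toSobolevSpace⟫_ℝ := by
        rw [← inner_sum_weightOp_sub hc hVb, toSobolevSpace_toH2R]
    _ = 0 := by rw [sub_apply, hv, sub_self, inner_zero_left]

end weightedForm

/-- A nonnegative non-coercive weighted form with constant leading weight has a smooth kernel
element. -/
lemma exists_contDiffLp_of_not_coercive {a m : ℝ} {c : Fin 3 → ℝ → ℝ} {V : ℝ → ℝ} (hm : 0 < m)
    (hc : ∀ i, ContDiffLp ∞ ⊤ (c i)) (hcm : ∀ i x, m ≤ c i x) (hca : ∀ x, c 2 x = a)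
    (hV : ContDiff ℝ ∞ V) (hVc : HasCompactSupport V) (hpos : ∀ ψ, 0 ≤ weightedForm c V ψ ψ)
    (hinf : ∀ ε > 0, ∃ ψ : H2R, weightedForm c V ψ ψ < ε * ‖ψ.toSobolevSpace‖ ^ 2) :
    ∃ y, ContDiffLp 2 ⊤ y ∧ y ≠ 0 ∧ ∀ x, a * deriv (deriv (deriv (deriv y))) x
      = deriv (c 1) x * deriv y x + c 1 x * deriv (deriv y) x - (c 0 x - V x) * y x := by
  obtain ⟨ψ, hψ0, hψ⟩ := exists_weightedForm_eq_zero hm (fun i => (hc i).memLp) hcm hV.continuous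
    hVc hpos hinf
  have hVb : ContDiffLp ∞ ⊤ V := .of_hasCompactSupport hV hVc
  have hcV : ContDiffLp ∞ ⊤ fun x => c 0 x - V x := by
    simpa only [neg_one_mul, ← sub_eq_add_neg] using (hc 0).add (hVb.const_mul (-1))
  have ha : a ≠ 0 := (hm.trans_le ((hcm 2 0).trans_eq (hca 0))).ne'
  obtain ⟨y, hy, hψy, hode⟩ := exists_contDiffLp_of_weak ha (hc 1) hcV ψ fun φ => by
    have hcψ : MemLp (fun x => c 0 x * ψ.f x) 2 volume := ψ.memLp_f.mul' (hc 0).memLp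
    have hVψ : MemLp (fun x => V x * ψ.f x) 2 volume := ψ.memLp_f.mul' hVb.memLp
    have hsub : ∫ x, (c 0 x - V x) * ψ.f x * φ.f x
        = (∫ x, c 0 x * ψ.f x * φ.f x) - ∫ x, V x * ψ.f x * φ.f x := by
      simp only [sub_mul]
      exact integral_sub (hcψ.integrable_mul φ.memLp_f) (hVψ.integrable_mul φ.memLp_f)
    have hzero := hψ φ
    simp only [weightedForm, Fin.sum_univ_three, H2R.jet, Matrix.cons_val, hca, mul_assoc a,
      integral_const_mul] at hzero
    linarith
  refine ⟨y, hy, ?_, hode⟩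
  rintro rfl
  exact hψ0 (H2R.toSobolevSpace_eq_zero hψy)

/-! ### The energies -/

/-- Scalar multiples in `H²(ℝ)`. -/
def H2R.smul (a : ℝ) (ψ : H2R) : H2R where
  f x := a * ψ.f x
  d1 x := a * ψ.d1 x
  d2 x := a * ψ.d2 x
  memLp_f := ψ.memLp_f.const_mul a
  memLp_d1 := ψ.memLp_d1.const_mul a
  memLp_d2 := ψ.memLp_d2.const_mul a
  weak_d1 := fun η hη hc => by
    simp only [mul_assoc, integral_const_mul]
    rw [ψ.weak_d1 η hη hc, mul_neg]
  weak_d2 := fun η hη hc => by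
    simp only [mul_assoc, integral_const_mul]
    rw [ψ.weak_d2 η hη hc, mul_neg]

lemma integrable_mul_sq {c f : ℝ → ℝ} (hc : MemLp c ∞ volume) (hf : MemLp f 2 volume) :
    Integrable fun x => c x * f x ^ 2 := by
  have hcf : MemLp (fun x => c x * f x) 2 volume := hf.mul' hc
  simp only [sq, ← mul_assoc]
  exact hcf.integrable_mul hf

lemma integral_const_mul_add_const_mul {f g : ℝ → ℝ} (hf : Integrable f) (hg : Integrable g)
    (a b : ℝ) : ∫ x, (a * f x + b * g x) = a * (∫ x, f x) + b * ∫ x, g x := by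
  rw [integral_add (hf.const_mul a) (hg.const_mul b), integral_const_mul, integral_const_mul]

lemma integral_sq_nonneg (f : ℝ → ℝ) : 0 ≤ ∫ x, f x ^ 2 := integral_nonneg fun _ => sq_nonneg _

lemma H2R.integral_sum_mul_jet_sq (ψ : H2R) (c : Fin 3 → ℝ) :
    ∫ x, ∑ i, c i * ψ.jet i x ^ 2 = ∑ i, c i * ∫ x, ψ.jet i x ^ 2 := by
  rw [integral_finsetSum _ fun i _ => (ψ.memLp_jet i).integrable_sq.const_mul (c i)]
  simp only [integral_const_mul]

namespace RTData

variable (D : RTData) (ξ : Freq)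

/-- The weights of `∫ ψ²`, `∫ ψ'²` and `∫ ψ''²` in the magnetic part of `E₀`. -/
def magneticCoeff : Fin 3 → ℝ :=
  match D.dir with
  | .horizontal => ![D.M ^ 2 * ξ 0 ^ 2, D.M ^ 2 * ξ 0 ^ 2 / ‖ξ‖ ^ 2, 0]
  | .vertical => ![0, D.M ^ 2, D.M ^ 2 / ‖ξ‖ ^ 2]

/-- The weights of `∫ ψ²`, `∫ ψ'²` and `∫ ψ''²` in `E₁`, up to the factor `μ`. -/
def viscousCoeff : Fin 3 → ℝ := ![‖ξ‖ ^ 4, 2 * ‖ξ‖ ^ 2, 1]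

/-- The weights of `∫ ρ ψ²`, `∫ ρ ψ'²` and `∫ ρ ψ''²` in `J`. -/
def kineticCoeff : Fin 3 → ℝ := ![‖ξ‖ ^ 2, 1, 0]

lemma magneticCoeff_nonneg (i : Fin 3) : 0 ≤ D.magneticCoeff ξ i := by
  unfold magneticCoeff
  cases D.dir <;> fin_cases i <;>
    simp only [Fin.zero_eta, Fin.mk_one, Fin.reduceFinMk, Matrix.cons_val] <;> positivity

lemma viscousCoeff_pos {ξ : Freq} (hξ : ξ ≠ 0) (i : Fin 3) : 0 < viscousCoeff ξ i := by
  have := norm_pos_iff.2 hξ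
  fin_cases i <;>
    simp only [viscousCoeff, Fin.zero_eta, Fin.mk_one, Fin.reduceFinMk, Matrix.cons_val] <;>
    positivity

lemma kineticCoeff_nonneg (i : Fin 3) : 0 ≤ kineticCoeff ξ i := by
  fin_cases i <;> simp [kineticCoeff]

variable {D}

lemma E1_eq (ψ : H2R) :
    D.E1 ξ ψ = D.μ * ∑ i, viscousCoeff ξ i * ∫ x, ψ.jet i x ^ 2 := by
  have hcross : ∫ x, ψ.f x * ψ.d2 x = -∫ x, ψ.d1 x ^ 2 := by
    simpa only [H2R.derivH1, ← sq] using ψ.toH1R.integral_f_mul_d1 ψ.derivH1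
  have hint : Integrable fun x => ∑ i, ![‖ξ‖ ^ 4, 4 * ‖ξ‖ ^ 2, 1] i * ψ.jet i x ^ 2 :=
    integrable_finsetSum _ fun i _ => (ψ.memLp_jet i).integrable_sq.const_mul _
  have hint' : Integrable fun x => ψ.f x * ψ.d2 x := ψ.memLp_f.integrable_mul ψ.memLp_d2
  calc D.E1 ξ ψ = D.μ * ∫ x, (1 * ∑ i, ![‖ξ‖ ^ 4, 4 * ‖ξ‖ ^ 2, 1] i * ψ.jet i x ^ 2
          + 2 * ‖ξ‖ ^ 2 * (ψ.f x * ψ.d2 x)) := by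
        rw [E1]
        congr 2 with x
        simp only [Fin.sum_univ_three, H2R.jet, Matrix.cons_val]
        ring
    _ = D.μ * ∑ i, viscousCoeff ξ i * ∫ x, ψ.jet i x ^ 2 := by
        rw [integral_const_mul_add_const_mul hint hint', ψ.integral_sum_mul_jet_sq, hcross]
        simp only [Fin.sum_univ_three, H2R.jet, viscousCoeff, Matrix.cons_val]
        ring

namespace Admissible

section

variable (hD : D.Admissible)
include hD

lemma contDiffLp_ρ : ContDiffLp ∞ ⊤ D.ρ := by
  obtain ⟨C, hC⟩ := hD.ρ_bdd
  exact .of_deriv (fun x => (hD.ρ_smooth.differentiable (by simp) x).hasDerivAt)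
    (memLp_top_of_bound hD.ρ_smooth.continuous.aestronglyMeasurable C (ae_of_all _ hC))
    (.of_hasCompactSupport (n := ⊤) (contDiff_infty_iff_deriv.1 hD.ρ_smooth).2 hD.ρ'_supp)

lemma ρ_pos' (x : ℝ) : 0 < D.ρ x :=
  let ⟨_, hc, hcρ⟩ := hD.ρ_pos
  hc.trans_le (hcρ x)

lemma integrable_ρ_mul_sq {f : ℝ → ℝ} (hf : MemLp f 2 volume) :
    Integrable fun x => D.ρ x * f x ^ 2 :=
  integrable_mul_sq hD.contDiffLp_ρ.memLp hf

lemma integrable_ρ'_mul_sq {f : ℝ → ℝ} (hf : MemLp f 2 volume) :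
    Integrable fun x => deriv D.ρ x * f x ^ 2 :=
  integrable_mul_sq hD.contDiffLp_ρ.deriv.memLp hf

lemma integral_ρ_mul_sq_nonneg (f : ℝ → ℝ) : 0 ≤ ∫ x, D.ρ x * f x ^ 2 :=
  integral_nonneg fun x => mul_nonneg (hD.ρ_pos' x).le (sq_nonneg _)

lemma E0_eq (ψ : H2R) : D.E0 ξ ψ = (∑ i, D.magneticCoeff ξ i * ∫ x, ψ.jet i x ^ 2)
    - D.g * ∫ x, deriv D.ρ x * ψ.f x ^ 2 := by
  have hint : Integrable fun x => ∑ i, D.magneticCoeff ξ i * ψ.jet i x ^ 2 :=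
    integrable_finsetSum _ fun i _ => (ψ.memLp_jet i).integrable_sq.const_mul _
  have hint' : Integrable fun x => D.g * (deriv D.ρ x * ψ.f x ^ 2) :=
    (hD.integrable_ρ'_mul_sq ψ.memLp_f).const_mul _
  rw [← ψ.integral_sum_mul_jet_sq, ← integral_const_mul, ← integral_sub hint hint']
  unfold E0 magneticCoeff
  cases D.dir <;>
  · refine integral_congr_ae (ae_of_all _ fun x => ?_)
    simp only [Fin.sum_univ_three, H2R.jet, Matrix.cons_val]
    ring

lemma J_eq (ψ : H2R) :
    D.J ξ ψ = ∑ i, kineticCoeff ξ i * ∫ x, D.ρ x * ψ.jet i x ^ 2 := by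
  simp only [← integral_const_mul]
  rw [← integral_finsetSum _ fun i _ => (hD.integrable_ρ_mul_sq (ψ.memLp_jet i)).const_mul _, J]
  congr 1 with x
  simp only [Fin.sum_univ_three, H2R.jet, kineticCoeff, Matrix.cons_val]
  ring

lemma E_add_mul_J (s t : ℝ) (ψ : H2R) :
    D.E ξ s ψ + t * D.J ξ ψ = weightedForm
      (fun i x => (‖ξ‖ ^ 2 * D.magneticCoeff ξ i + s * D.μ * viscousCoeff ξ i)
        + t * kineticCoeff ξ i * D.ρ x)
      (fun x => D.g * ‖ξ‖ ^ 2 * deriv D.ρ x) ψ ψ := by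
  have hterm : ∀ i (a b : ℝ), ∫ x, (a + b * D.ρ x) * ψ.jet i x * ψ.jet i x
      = a * (∫ x, ψ.jet i x ^ 2) + b * ∫ x, D.ρ x * ψ.jet i x ^ 2 := fun i a b => by
    rw [← integral_const_mul_add_const_mul (ψ.memLp_jet i).integrable_sq
      (hD.integrable_ρ_mul_sq (ψ.memLp_jet i))]
    congr 1 with x
    ring
  simp only [weightedForm, hterm, mul_assoc (D.g * _), mul_assoc (deriv D.ρ _), ← sq,
    integral_const_mul]
  rw [E, hD.E0_eq, E1_eq, hD.J_eq]
  simp only [Fin.sum_univ_three]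
  ring

lemma J_nonneg (ψ : H2R) : 0 ≤ D.J ξ ψ := by
  rw [hD.J_eq]
  exact Finset.sum_nonneg fun i _ =>
    mul_nonneg (kineticCoeff_nonneg ξ i) (hD.integral_ρ_mul_sq_nonneg _)

lemma sq_norm_mul_integral_le_J (ψ : H2R) : ‖ξ‖ ^ 2 * (∫ x, D.ρ x * ψ.f x ^ 2) ≤ D.J ξ ψ := by
  rw [hD.J_eq]
  exact Finset.single_le_sum (f := fun i => kineticCoeff ξ i * ∫ x, D.ρ x * ψ.jet i x ^ 2)
    (fun i _ => mul_nonneg (kineticCoeff_nonneg ξ i) (hD.integral_ρ_mul_sq_nonneg _))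
    (Finset.mem_univ 0)

lemma E1_nonneg (ψ : H2R) : 0 ≤ D.E1 ξ ψ :=
  mul_nonneg hD.μ_pos.le (integral_nonneg fun x => by positivity)

lemma exists_integral_ρ'_le : ∃ C > 0, ∀ f : ℝ → ℝ, MemLp f 2 volume →
    ∫ x, deriv D.ρ x * f x ^ 2 ≤ C * ∫ x, D.ρ x * f x ^ 2 := by
  obtain ⟨c, hc, hcρ⟩ := hD.ρ_pos
  obtain ⟨B, hB⟩ := hD.ρ'_supp.exists_bound_of_continuous
    hD.contDiffLp_ρ.deriv.1.continuous
  have hB0 : 0 ≤ B := (norm_nonneg _).trans (hB 0)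
  have hρ' : ∀ x, deriv D.ρ x ≤ (B + 1) / c * D.ρ x := fun x =>
    calc deriv D.ρ x ≤ B + 1 := by linarith [(Real.le_norm_self _).trans (hB x)]
      _ = (B + 1) / c * c := by field_simp
      _ ≤ (B + 1) / c * D.ρ x := by gcongr; exact hcρ x
  refine ⟨(B + 1) / c, by positivity, fun f hf => ?_⟩
  rw [← integral_const_mul]
  refine integral_mono (hD.integrable_ρ'_mul_sq hf) ((hD.integrable_ρ_mul_sq hf).const_mul _)
    fun x => ?_
  simp only [← mul_assoc]
  gcongr
  exact hρ' x

/-- The bound is uniform in the frequency because the gravity term carries the same factor `|ξ|²`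
as the vertical part of `J`. -/
lemma exists_neg_mul_J_le_E : ∃ C > 0, ∀ (ξ : Freq) (s : ℝ) (ψ : H2R), 0 ≤ s →
    -(C * D.J ξ ψ) ≤ D.E ξ s ψ := by
  obtain ⟨C, hC, hCρ⟩ := hD.exists_integral_ρ'_le
  have hg := hD.g_pos
  refine ⟨D.g * C, by positivity, fun ξ s ψ hs => ?_⟩
  have hmag : 0 ≤ ∑ i, D.magneticCoeff ξ i * ∫ x, ψ.jet i x ^ 2 :=
    Finset.sum_nonneg fun i _ => mul_nonneg (D.magneticCoeff_nonneg ξ i) (integral_sq_nonneg _)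
  calc -(D.g * C * D.J ξ ψ) ≤ -(D.g * C * (‖ξ‖ ^ 2 * ∫ x, D.ρ x * ψ.f x ^ 2)) := by
        gcongr
        exact hD.sq_norm_mul_integral_le_J ξ ψ
    _ = ‖ξ‖ ^ 2 * (0 - D.g * (C * ∫ x, D.ρ x * ψ.f x ^ 2)) := by ring
    _ ≤ ‖ξ‖ ^ 2 * D.E0 ξ ψ := by
        rw [hD.E0_eq]
        gcongr
        exact hCρ _ ψ.memLp_f
    _ ≤ D.E ξ s ψ := le_add_of_nonneg_right (mul_nonneg hs (hD.E1_nonneg ξ ψ))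

lemma exists_integral_ρ'_pos : ∃ ψ : H2R, 0 < ∫ x, deriv D.ρ x * ψ.f x ^ 2 := by
  obtain ⟨x₀, hx₀⟩ := hD.ρ'_pos
  have hcont : Continuous (deriv D.ρ) := hD.contDiffLp_ρ.deriv.1.continuous
  obtain ⟨r, hr, hball⟩ := Metric.isOpen_iff.1 (isOpen_lt continuous_const hcont) x₀ hx₀
  let b : ContDiffBump x₀ := ⟨r / 2, r, by positivity, by linarith⟩
  refine ⟨TestFun.toH2R ⟨b, b.contDiff, b.hasCompactSupport⟩,
    Continuous.integral_pos_of_hasCompactSupport_nonneg_nonzero (x := x₀)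
      (hcont.mul (b.continuous.pow 2)) hD.ρ'_supp.mul_right (fun x => ?_) ?_⟩
  · by_cases hx : x ∈ Metric.ball x₀ r
    · exact mul_nonneg (hball hx).le (sq_nonneg _)
    · have hbx : b x = 0 := b.zero_of_le_dist (not_lt.1 hx)
      simp [TestFun.toH2R, hbx]
  · have hbx₀ : b x₀ = 1 := b.one_of_mem_closedBall (Metric.mem_closedBall_self (by positivity))
    simp [TestFun.toH2R, hbx₀, hx₀.ne']

lemma E_smul (s a : ℝ) (ψ : H2R) : D.E ξ s (ψ.smul a) = a ^ 2 * D.E ξ s ψ := by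
  have hjet : ∀ i x, (ψ.smul a).jet i x = a * ψ.jet i x := fun i x => by fin_cases i <;> rfl
  have hsq : ∀ i, ∫ x, (ψ.smul a).jet i x ^ 2 = a ^ 2 * ∫ x, ψ.jet i x ^ 2 := fun i => by
    simp only [hjet, mul_pow, integral_const_mul]
  have hρ' : ∫ x, deriv D.ρ x * (ψ.smul a).f x ^ 2 = a ^ 2 * ∫ x, deriv D.ρ x * ψ.f x ^ 2 := by
    simp only [H2R.smul, mul_pow, mul_left_comm (deriv D.ρ _), integral_const_mul]
  simp only [E, hD.E0_eq, E1_eq, hsq, hρ', Fin.sum_univ_three]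
  ring

end

lemma J_smul (a : ℝ) (ψ : H2R) : D.J ξ (ψ.smul a) = a ^ 2 * D.J ξ ψ := by
  rw [J, J, ← integral_const_mul]
  congr 1 with x
  simp only [H2R.smul]
  ring

lemma J_smul_inv_sqrt {ψ : H2R} (h : 0 < D.J ξ ψ) : D.J ξ (ψ.smul (√(D.J ξ ψ))⁻¹) = 1 := by
  rw [J_smul, inv_pow, Real.sq_sqrt h.le, inv_mul_cancel₀ h.ne']

/-! ### The growth rate -/

section

variable (hD : D.Admissible) {ξ : Freq}
include hD

lemma exists_J_eq_one (hξ : ξ ≠ 0) : ∃ ψ : H2R, D.J ξ ψ = 1 := by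
  obtain ⟨ψ, hψ⟩ := hD.exists_integral_ρ'_pos
  obtain ⟨C, hC, hCρ⟩ := hD.exists_integral_ρ'_le
  have hρ : 0 < ∫ x, D.ρ x * ψ.f x ^ 2 := pos_of_mul_pos_right (hψ.trans_le (hCρ _ ψ.memLp_f)) hC.le
  have hJ : 0 < D.J ξ ψ :=
    (mul_pos (by positivity) hρ).trans_le (hD.sq_norm_mul_integral_le_J ξ ψ)
  exact ⟨_, J_smul_inv_sqrt ξ hJ⟩

lemma bddBelow_E {s : ℝ} (hs : 0 ≤ s) :
    BddBelow {r : ℝ | ∃ ψ : H2R, D.J ξ ψ = 1 ∧ r = D.E ξ s ψ} := by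
  obtain ⟨C, -, hCE⟩ := hD.exists_neg_mul_J_le_E
  refine ⟨-C, ?_⟩
  rintro r ⟨ψ, hψ, rfl⟩
  simpa only [hψ, mul_one] using hCE ξ s ψ hs

lemma α_mul_J_le {s : ℝ} (hs : 0 ≤ s) (ψ : H2R) : D.α ξ s * D.J ξ ψ ≤ D.E ξ s ψ := by
  rcases (hD.J_nonneg ξ ψ).eq_or_lt with hJ | hJ
  · obtain ⟨C, -, hCE⟩ := hD.exists_neg_mul_J_le_E
    simpa only [← hJ, mul_zero, neg_zero] using hCE ξ s ψ hs
  · have hα : D.α ξ s ≤ D.E ξ s (ψ.smul (√(D.J ξ ψ))⁻¹) :=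
      csInf_le (hD.bddBelow_E hs) ⟨_, J_smul_inv_sqrt ξ hJ, rfl⟩
    rwa [hD.E_smul, inv_pow, Real.sq_sqrt hJ.le, inv_mul_eq_div, le_div_iff₀ hJ] at hα

lemma le_α (hξ : ξ ≠ 0) {s a : ℝ} (h : ∀ ψ : H2R, D.J ξ ψ = 1 → a ≤ D.E ξ s ψ) : a ≤ D.α ξ s := by
  obtain ⟨ψ, hψ⟩ := hD.exists_J_eq_one hξ
  refine le_csInf ⟨_, ψ, hψ, rfl⟩ ?_
  rintro r ⟨φ, hφ, rfl⟩
  exact h φ hφ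

lemma α_le {s : ℝ} (hs : 0 ≤ s) {ψ : H2R} (hψ : D.J ξ ψ = 1) : D.α ξ s ≤ D.E ξ s ψ := by
  simpa only [hψ, mul_one] using hD.α_mul_J_le (ξ := ξ) hs ψ

lemma monotoneOn_α (hξ : ξ ≠ 0) : MonotoneOn (D.α ξ) (Set.Ioi 0) := fun s hs t _ hst =>
  hD.le_α hξ fun ψ hψ => (hD.α_le (le_of_lt hs) hψ).trans <| by
    unfold E
    gcongr
    exact hD.E1_nonneg ξ ψ

/-- As an infimum of functions that are affine in `s`, `α` is concave. -/
lemma continuousOn_α (hξ : ξ ≠ 0) : ContinuousOn (D.α ξ) (Set.Ioi 0) := by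
  refine ConcaveOn.continuousOn isOpen_Ioi
    ⟨convex_Ioi 0, fun s hs t ht a b ha hb hab => hD.le_α hξ fun ψ hψ => ?_⟩
  calc a • D.α ξ s + b • D.α ξ t ≤ a * D.E ξ s ψ + b * D.E ξ t ψ := by
        simp only [smul_eq_mul]
        gcongr
        exacts [hD.α_le (le_of_lt hs) hψ, hD.α_le (le_of_lt ht) hψ]
    _ = D.E ξ (a • s + b • t) ψ := by
        simp only [E, smul_eq_mul]
        linear_combination ‖ξ‖ ^ 2 * D.E0 ξ ψ * hab

lemma exists_neg_le_α : ∃ C > 0, ∀ ξ : Freq, ξ ≠ 0 → ∀ s, 0 ≤ s → -C ≤ D.α ξ s := by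
  obtain ⟨C, hC, hCE⟩ := hD.exists_neg_mul_J_le_E
  exact ⟨C, hC, fun ξ hξ s hs => hD.le_α hξ fun ψ hψ => by
    simpa only [hψ, mul_one] using hCE ξ s ψ hs⟩

lemma exists_α_neg (hξ : ξ ≠ 0) {ψ : H2R} (hψ : D.E0 ξ ψ < 0) : ∃ s > 0, D.α ξ s < 0 := by
  have hE0 : ‖ξ‖ ^ 2 * D.E0 ξ ψ < 0 := mul_neg_of_pos_of_neg (by positivity) hψ
  have hcont : Continuous fun s => D.E ξ s ψ := by
    unfold E
    fun_prop
  have hzero : D.E ξ 0 ψ < 0 := by simpa only [E, zero_mul, add_zero] using hE0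
  obtain ⟨s, hs0, hs⟩ := (hcont.continuousAt.eventually_lt continuousAt_const hzero).exists_gt
  have hneg : D.α ξ s * D.J ξ ψ < 0 :=
    (hD.α_mul_J_le hs0.le ψ).trans_lt hs
  exact ⟨s, hs0, neg_of_mul_neg_left hneg (hD.J_nonneg ξ ψ)⟩

lemma isGrowthRate_iff (hξ : ξ ≠ 0) {s : ℝ} : D.IsGrowthRate ξ s ↔ 0 < s ∧ s ^ 2 = -D.α ξ s := by
  refine ⟨fun h => ⟨h.1.1, ?_⟩, fun ⟨hs, hα⟩ => ⟨⟨hs, ?_⟩, ?_⟩⟩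
  · have hsqrt : 0 < √(-D.α ξ s) := h.2 ▸ h.1.1
    calc s ^ 2 = √(-D.α ξ s) ^ 2 := by rw [← h.2]
      _ = -D.α ξ s := Real.sq_sqrt (Real.sqrt_pos.1 hsqrt).le
  · have hneg : D.α ξ s < 0 := by linarith [pow_pos hs 2]
    obtain ⟨s', hs', hlt⟩ := (((hD.continuousOn_α hξ).continuousAt
      (Ioi_mem_nhds hs)).eventually_lt continuousAt_const hneg).exists_gt
    refine ⟨s', hs', fun τ hτ => ?_⟩
    exact (hD.monotoneOn_α hξ hτ.1 (hs.trans hs') hτ.2.le).trans_lt hlt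
  · rw [← hα, Real.sqrt_sq hs.le]

end

end Admissible

end RTData

lemma existsUnique_sq_eq_neg {a : ℝ → ℝ} {C s₀ : ℝ} (hmono : MonotoneOn a (Set.Ioi 0))
    (hcont : ContinuousOn a (Set.Ioi 0)) (hC : ∀ s, 0 < s → -C ≤ a s) (hs₀ : 0 < s₀)
    (ha : a s₀ < 0) : ∃! s, 0 < s ∧ s ^ 2 = -a s := by
  have hanti : StrictMonoOn (fun s => s ^ 2 + a s) (Set.Ioi 0) := fun s hs t ht hst =>
    add_lt_add_of_lt_of_le (pow_lt_pow_left₀ hst (le_of_lt hs) two_ne_zero) (hmono hs ht hst.le)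
  have hadd : ContinuousOn (fun s => s ^ 2 + a s) (Set.Ioi 0) := by fun_prop
  obtain ⟨r, hr, hr2⟩ : ∃ r ∈ Set.Ioc 0 s₀, r ^ 2 < -a s₀ := by
    have htendsto : Tendsto (fun r : ℝ => r ^ 2) (𝓝[>] 0) (𝓝 0) :=
      ((continuous_pow 2).tendsto' 0 0 (by simp)).mono_left nhdsWithin_le_nhds
    exact ((htendsto.eventually_lt_const (neg_pos.2 ha)).and
      (Ioc_mem_nhdsGT hs₀)).exists.imp fun r h => h.symm
  have hR : r ≤ r + (|C| + 1) := by linarith [abs_nonneg C]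
  have hleft : r ^ 2 + a r ≤ 0 := by linarith [hmono hr.1 hs₀ hr.2]
  have hright : 0 ≤ (r + (|C| + 1)) ^ 2 + a (r + (|C| + 1)) := by
    nlinarith [hC (r + (|C| + 1)) (hr.1.trans_le hR), hr.1, le_abs_self C, abs_nonneg C]
  obtain ⟨s, hs, hs0 : s ^ 2 + a s = 0⟩ := intermediate_value_Icc hR
    (hadd.mono fun x hx => hr.1.trans_le hx.1) ⟨hleft, hright⟩
  refine ⟨s, ⟨hr.1.trans_le hs.1, by linarith⟩, fun t ⟨ht, hat⟩ => ?_⟩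
  have ht0 : t ^ 2 + a t = 0 := by linarith
  exact hanti.injOn ht (hr.1.trans_le hs.1) (ht0.trans hs0.symm)

namespace RTData.Admissible

variable {D : RTData} {ξ : Freq}

lemma existsUnique_growthRate (hD : D.Admissible) (hξ : ξ ≠ 0) {ψ : H2R} (hψ : D.E0 ξ ψ < 0) :
    ∃! s : ℝ, D.IsGrowthRate ξ s := by
  obtain ⟨s₀, hs₀, hα⟩ := hD.exists_α_neg hξ hψ
  obtain ⟨C, -, hC⟩ := hD.exists_neg_le_α
  simp only [hD.isGrowthRate_iff hξ]
  exact existsUnique_sq_eq_neg (hD.monotoneOn_α hξ) (hD.continuousOn_α hξ)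
    (fun s hs => hC ξ hξ s hs.le) hs₀ hα

lemma exists_growthRate_le (hD : D.Admissible) :
    ∃ C, ∀ ξ : Freq, ξ ≠ 0 → ∀ s, D.IsGrowthRate ξ s → s ≤ C := by
  obtain ⟨C, -, hCα⟩ := hD.exists_neg_le_α
  refine ⟨√C, fun ξ hξ s hs => Real.le_sqrt_of_sq_le ?_⟩
  obtain ⟨hs0, hs2⟩ := (hD.isGrowthRate_iff hξ).1 hs
  linarith [hCα ξ hξ s hs0.le]

end RTData.Admissible

/-! ### Negative energies on the solvable domain -/

namespace RTData

variable {D : RTData} {ξ : Freq}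

lemma ne_zero_of_mem_solvable (h : ξ ∈ D.solvable) : ξ ≠ 0 := by
  unfold solvable at h
  cases hdir : D.dir with
  | horizontal =>
    rw [hdir] at h
    exact h.2
  | vertical =>
    rw [hdir] at h
    exact norm_pos_iff.1 ((Real.sqrt_nonneg _).trans_lt h)

namespace Admissible

variable (hD : D.Admissible)
include hD

lemma vcDenom_eq (ψ : H2R) : D.vcDenom ψ
    = D.g * (∫ x, deriv D.ρ x * ψ.f x ^ 2) - D.M ^ 2 * ∫ x, ψ.d1 x ^ 2 := by
  rw [sub_eq_add_neg, ← neg_mul, ← integral_const_mul_add_const_mul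
    (hD.integrable_ρ'_mul_sq ψ.memLp_f) ψ.memLp_d1.integrable_sq, vcDenom]
  congr 1 with x
  ring

lemma exists_vcDenom_pos (hdir : D.dir = .vertical) : ∃ ψ : H2R, 0 < D.vcDenom ψ := by
  obtain ⟨u, hu⟩ : ∃ u : H1R,
      D.M ^ 2 < (∫ x, D.g * deriv D.ρ x * u.f x ^ 2) / ∫ x, u.d1 x ^ 2 := by
    have hM := hD.M_lt hdir
    rw [Mc, one_div, ENNReal.lt_rpow_inv_iff two_pos, lt_iSup_iff] at hM
    obtain ⟨u, hM⟩ := hM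
    obtain ⟨-, hM⟩ := lt_iSup_iff.1 hM
    rw [ENNReal.ofReal_rpow_of_nonneg (abs_nonneg _) zero_le_two, Real.rpow_two, sq_abs] at hM
    exact ⟨u, (ENNReal.ofReal_lt_ofReal_iff'.1 hM).1⟩
  have hd1 : 0 < ∫ x, u.d1 x ^ 2 := (integral_sq_nonneg _).lt_of_ne fun h0 => by
    rw [← h0, div_zero] at hu
    exact hu.not_ge (sq_nonneg _)
  obtain ⟨v, hv⟩ := exists_H2R_form_pos (hD.contDiffLp_ρ.deriv.const_mul D.g).memLp (D.M ^ 2) u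
    (sub_pos.2 ((lt_div_iff₀ hd1).1 hu))
  refine ⟨v, ?_⟩
  rw [hD.vcDenom_eq]
  simpa only [mul_assoc, integral_const_mul] using hv

lemma exists_E0_neg_of_xiVc_lt (hdir : D.dir = .vertical) (h : D.xiVc < ‖ξ‖) :
    ∃ ψ : H2R, D.E0 ξ ψ < 0 := by
  have hξ : 0 < ‖ξ‖ := (Real.sqrt_nonneg _).trans_lt h
  obtain ⟨ψ₀, hψ₀⟩ := hD.exists_vcDenom_pos hdir
  obtain ⟨_, ⟨ψ, hψ, rfl⟩, hlt⟩ :=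
    exists_lt_of_csInf_lt (by exact ⟨_, ψ₀, hψ₀, rfl⟩) ((Real.sqrt_lt' hξ).1 h)
  refine ⟨ψ, ?_⟩
  rw [div_lt_comm₀ hψ (by positivity), hD.vcDenom_eq] at hlt
  rw [hD.E0_eq]
  simp only [Fin.sum_univ_three, magneticCoeff, hdir, H2R.jet, Matrix.cons_val]
  linarith [mul_div_right_comm (D.M ^ 2) (∫ x, ψ.d2 x ^ 2) (‖ξ‖ ^ 2)]

lemma exists_E0_neg_of_zero (hdir : D.dir = .horizontal) (h : ξ 0 = 0) :
    ∃ ψ : H2R, D.E0 ξ ψ < 0 := by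
  obtain ⟨ψ, hψ⟩ := hD.exists_integral_ρ'_pos
  refine ⟨ψ, ?_⟩
  rw [hD.E0_eq]
  simp only [Fin.sum_univ_three, magneticCoeff, hdir, h, Matrix.cons_val]
  linear_combination mul_pos hD.g_pos hψ

lemma exists_E0_neg_of_lt_S (hdir : D.dir = .horizontal) (hM : D.M * ξ 0 ≠ 0) (h : ‖ξ‖ < D.S ξ) :
    ∃ ψ : H2R, D.E0 ξ ψ < 0 := by
  set a := D.g * ‖ξ‖ ^ 2 / (D.M * ξ 0) ^ 2 with ha
  have hξ : 0 < ‖ξ‖ := norm_pos_iff.2 fun h0 => hM (by simp [h0])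
  have hform : ∀ u : H1R, ∫ x, (a * deriv D.ρ x + -‖ξ‖ ^ 2) * u.f x ^ 2
      = a * (∫ x, deriv D.ρ x * u.f x ^ 2) + -‖ξ‖ ^ 2 * ∫ x, u.f x ^ 2 := fun u => by
    rw [← integral_const_mul_add_const_mul (hD.integrable_ρ'_mul_sq u.memLp_f)
      u.memLp_f.integrable_sq]
    congr 1 with x
    ring
  obtain ⟨u, hu⟩ : ∃ u : H1R, ‖ξ‖ ^ 2
      < (a * (∫ x, deriv D.ρ x * u.f x ^ 2) - ∫ x, u.d1 x ^ 2) / ∫ x, u.f x ^ 2 := by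
    have hlt := (Real.lt_sqrt hξ.le).1 h
    obtain ⟨_, ⟨u, -, rfl⟩, hu⟩ := exists_lt_of_lt_csSup
      (Set.nonempty_iff_ne_empty.2 fun he => by
        rw [he, Real.sSup_empty] at hlt
        exact hlt.not_ge (sq_nonneg _)) hlt
    exact ⟨u, by rwa [mul_div_right_comm] at hu⟩
  have hf : 0 < ∫ x, u.f x ^ 2 := (integral_sq_nonneg _).lt_of_ne fun h0 => by
    rw [← h0, div_zero] at hu
    exact hu.not_ge (sq_nonneg _)
  obtain ⟨v, hv⟩ := exists_H2R_form_pos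
    ((hD.contDiffLp_ρ.deriv.const_mul a).add (.const _)).memLp 1 u (by
      rw [hform]
      linarith [(lt_div_iff₀ hf).1 hu])
  refine ⟨v, neg_pos.1 ?_⟩
  rw [hform] at hv
  calc 0 < (D.M * ξ 0) ^ 2 / ‖ξ‖ ^ 2 * _ := mul_pos (by positivity) hv
    _ = -D.E0 ξ v := by
      rw [hD.E0_eq, ha]
      simp only [Fin.sum_univ_three, magneticCoeff, hdir, H2R.jet, Matrix.cons_val]
      have hM0 := left_ne_zero_of_mul hM
      have hξ0 := right_ne_zero_of_mul hM
      field_simp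
      ring

lemma exists_E0_neg (h : ξ ∈ D.solvable) : ∃ ψ : H2R, D.E0 ξ ψ < 0 := by
  unfold solvable at h
  cases hdir : D.dir with
  | horizontal =>
    rw [hdir] at h
    obtain ⟨⟨hpos, -, hS⟩ | h0, -⟩ := h
    · refine hD.exists_E0_neg_of_lt_S hdir (fun h0 => ?_) hS
      rw [mul_comm, h0, abs_zero, zero_div] at hpos
      exact hpos.false
    · exact hD.exists_E0_neg_of_zero hdir h0
  | vertical =>
    rw [hdir] at h
    exact hD.exists_E0_neg_of_xiVc_lt hdir h

/-! ### The eigenfunction -/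

lemma exists_J_le : ∃ C > 0, ∀ ψ : H2R, D.J ξ ψ ≤ C * ‖ψ.toSobolevSpace‖ ^ 2 := by
  obtain ⟨B, hB⟩ := hD.ρ_bdd
  have hB0 : 0 < B := (hD.ρ_pos' 0).trans_le ((le_abs_self _).trans (hB 0))
  refine ⟨(‖ξ‖ ^ 2 + 1) * B, by positivity, fun ψ => ?_⟩
  rw [hD.J_eq, H2R.norm_sq_toSobolevSpace, mul_assoc, Finset.mul_sum, Finset.mul_sum]
  refine Finset.sum_le_sum fun i _ => mul_le_mul ?_ ?_ (hD.integral_ρ_mul_sq_nonneg _)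
    (by positivity)
  · fin_cases i <;>
      simp only [kineticCoeff, Fin.zero_eta, Fin.mk_one, Fin.reduceFinMk, Matrix.cons_val] <;>
      linarith [sq_nonneg ‖ξ‖]
  · rw [← integral_const_mul]
    exact integral_mono (hD.integrable_ρ_mul_sq (ψ.memLp_jet i))
      ((ψ.memLp_jet i).integrable_sq.const_mul B) fun x =>
        mul_le_mul_of_nonneg_right ((le_abs_self _).trans (hB x)) (sq_nonneg _)

lemma exists_E_sub_α_lt (hξ : ξ ≠ 0) (s : ℝ) {ε : ℝ} (hε : 0 < ε) :
    ∃ ψ : H2R, D.E ξ s ψ - D.α ξ s * D.J ξ ψ < ε * ‖ψ.toSobolevSpace‖ ^ 2 := by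
  obtain ⟨C, hC, hJ⟩ := hD.exists_J_le (ξ := ξ)
  obtain ⟨ψ₀, hψ₀⟩ := hD.exists_J_eq_one hξ
  obtain ⟨_, ⟨ψ, hψ, rfl⟩, hE⟩ :=
    exists_lt_of_csInf_lt (by exact ⟨_, ψ₀, hψ₀, rfl⟩)
      (lt_add_of_pos_right (D.α ξ s) (div_pos hε hC))
  refine ⟨ψ, ?_⟩
  rw [hψ, mul_one]
  calc D.E ξ s ψ - D.α ξ s < ε / C * D.J ξ ψ := by rwa [hψ, mul_one, sub_lt_iff_lt_add']
    _ ≤ ε / C * (C * ‖ψ.toSobolevSpace‖ ^ 2) := by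
      gcongr
      exact hJ ψ
    _ = ε * ‖ψ.toSobolevSpace‖ ^ 2 := by field_simp

/-- The equation satisfied by `y` is the Euler-Lagrange equation of the form
`|ξ|² E₀ + s E₁ + s² J`, which at the growth rate is nonnegative but not coercive. -/
lemma exists_eigenfunction (hξ : ξ ≠ 0) {s : ℝ} (hs : D.IsGrowthRate ξ s) :
    ∃ y, ContDiffLp 2 ⊤ y ∧ y ≠ 0 ∧ ∀ x,
      (‖ξ‖ ^ 2 * D.magneticCoeff ξ 2 + s * D.μ) * deriv (deriv (deriv (deriv y))) x
        = s ^ 2 * deriv D.ρ x * deriv y x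
          + (‖ξ‖ ^ 2 * D.magneticCoeff ξ 1 + 2 * s * D.μ * ‖ξ‖ ^ 2 + s ^ 2 * D.ρ x)
            * deriv (deriv y) x
          - (‖ξ‖ ^ 2 * D.magneticCoeff ξ 0 + s * D.μ * ‖ξ‖ ^ 4 + s ^ 2 * ‖ξ‖ ^ 2 * D.ρ x
            - D.g * ‖ξ‖ ^ 2 * deriv D.ρ x) * y x := by
  obtain ⟨hs0, hsα⟩ := (hD.isGrowthRate_iff hξ).1 hs
  have hsμ : 0 < s * D.μ := mul_pos hs0 hD.μ_pos
  obtain ⟨i₀, hi₀⟩ := Finite.exists_min (viscousCoeff ξ)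
  have hvis : 0 < viscousCoeff ξ i₀ := viscousCoeff_pos hξ i₀
  have hform : ∀ ψ : H2R, D.E ξ s ψ - D.α ξ s * D.J ξ ψ = weightedForm _ _ ψ ψ := fun ψ => by
    rw [← hD.E_add_mul_J ξ s (s ^ 2), hsα, neg_mul, sub_eq_add_neg]
  have hcoeff : ∀ i x, s * D.μ * viscousCoeff ξ i₀
      ≤ (‖ξ‖ ^ 2 * D.magneticCoeff ξ i + s * D.μ * viscousCoeff ξ i)
        + s ^ 2 * kineticCoeff ξ i * D.ρ x := fun i x => by
    have hmag : 0 ≤ ‖ξ‖ ^ 2 * D.magneticCoeff ξ i :=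
      mul_nonneg (sq_nonneg _) (D.magneticCoeff_nonneg ξ i)
    have hkin : 0 ≤ s ^ 2 * kineticCoeff ξ i * D.ρ x :=
      mul_nonneg (mul_nonneg (sq_nonneg _) (kineticCoeff_nonneg ξ i)) (hD.ρ_pos' x).le
    linarith [mul_le_mul_of_nonneg_left (hi₀ i) hsμ.le]
  obtain ⟨y, hy, hy0, hode⟩ := exists_contDiffLp_of_not_coercive
    (a := ‖ξ‖ ^ 2 * D.magneticCoeff ξ 2 + s * D.μ) (mul_pos hsμ hvis)
    (fun i => (ContDiffLp.const _).add (hD.contDiffLp_ρ.const_mul _)) hcoeff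
    (fun x => by simp only [viscousCoeff, kineticCoeff, Matrix.cons_val]; ring)
    (contDiff_const.mul (contDiff_infty_iff_deriv.1 hD.ρ_smooth).2) hD.ρ'_supp.mul_left
    (fun ψ => by rw [← hform, sub_nonneg]; exact hD.α_mul_J_le hs0.le ψ)
    (fun ε hε => by simpa only [hform] using hD.exists_E_sub_α_lt hξ s hε)
  refine ⟨y, hy, hy0, fun x => ?_⟩
  rw [hode x, deriv_const_add, deriv_const_mul _ (hD.contDiffLp_ρ.hasDerivAt x).differentiableAt]
  simp only [viscousCoeff, kineticCoeff, Matrix.cons_val]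
  ring

end Admissible

end RTData

/-! ### Vector calculus -/

/-- The directional derivative `(m · ∇) F`. -/
def dirDeriv (m : Fin 3 → ℝ) (F : (Fin 3 → ℝ) → ℝ) (x : Fin 3 → ℝ) : ℝ := ∑ i, m i * pd i F x

lemma pd_const_mul (r : ℝ) (i : Fin 3) (F : (Fin 3 → ℝ) → ℝ) :
    pd i (fun x => r * F x) = fun x => r * pd i F x := by
  funext x
  change fderiv ℝ (r • F) x _ = _
  rw [fderiv_const_smul_field]
  rfl

lemma pd_sub {F G : (Fin 3 → ℝ) → ℝ} (hF : Differentiable ℝ F) (hG : Differentiable ℝ G)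
    (i : Fin 3) : pd i (fun x => F x - G x) = fun x => pd i F x - pd i G x := by
  funext x
  rw [pd, fderiv_fun_sub (hF x) (hG x)]
  rfl

lemma pd_sum {ι : Type*} (s : Finset ι) {F : ι → (Fin 3 → ℝ) → ℝ}
    (hF : ∀ j, Differentiable ℝ (F j)) (i : Fin 3) :
    pd i (fun x => ∑ j ∈ s, F j x) = fun x => ∑ j ∈ s, pd i (F j) x := by
  funext x
  rw [pd, fderiv_fun_sum fun j _ => hF j x, sum_apply]
  rfl

lemma differentiable_pd {F : (Fin 3 → ℝ) → ℝ} (hF : ContDiff ℝ 2 F) (i : Fin 3) :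
    Differentiable ℝ (pd i F) :=
  ((hF.fderiv_right (m := 1) le_rfl).differentiable one_ne_zero).clm_apply
    (differentiable_const _)

lemma pd_comm {F : (Fin 3 → ℝ) → ℝ} (hF : ContDiff ℝ 2 F) (i j : Fin 3) :
    pd i (pd j F) = pd j (pd i F) := by
  have hsnd : ∀ i j x, pd i (pd j F) x
      = fderiv ℝ (fderiv ℝ F) x (Pi.single i 1) (Pi.single j 1) := fun i j x => by
    change fderiv ℝ (fun y => fderiv ℝ F y (Pi.single j 1)) x _ = _
    rw [fderiv_clm_apply ((hF.fderiv_right (m := 1) le_rfl).differentiable one_ne_zero x)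
      (differentiableAt_const _)]
    simp
  funext x
  rw [hsnd, hsnd]
  exact (hF.contDiffAt.isSymmSndFDerivAt (by simp)).eq _ _

lemma grad_const_mul (r : ℝ) (F : (Fin 3 → ℝ) → ℝ) (x : Fin 3 → ℝ) :
    grad (fun y => r * F y) x = r • grad F x := by
  funext i
  simp only [grad, pd_const_mul, Pi.smul_apply, smul_eq_mul]

lemma lap_const_mul (r : ℝ) (F : (Fin 3 → ℝ) → ℝ) (x : Fin 3 → ℝ) :
    lap (fun y => r * F y) x = r * lap F x := by
  simp only [lap, pd_const_mul, Finset.mul_sum]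

lemma div_smul (r : ℝ) (F : (Fin 3 → ℝ) → Fin 3 → ℝ) (x : Fin 3 → ℝ) :
    div (fun y => r • F y) x = r * div F x := by
  simp only [div, Pi.smul_apply, smul_eq_mul, pd_const_mul, Finset.mul_sum]

lemma curl_smul (r : ℝ) (F : (Fin 3 → ℝ) → Fin 3 → ℝ) (x : Fin 3 → ℝ) :
    curl (fun y => r • F y) x = r • curl F x := by
  funext i
  fin_cases i <;> simp [curl, pd_const_mul, mul_sub]

lemma dirDeriv_const_mul (m : Fin 3 → ℝ) (r : ℝ) (F : (Fin 3 → ℝ) → ℝ) :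
    dirDeriv m (fun x => r * F x) = fun x => r * dirDeriv m F x := by
  funext x
  simp only [dirDeriv, pd_const_mul, Finset.mul_sum, mul_left_comm]

lemma div_dirDeriv {U : (Fin 3 → ℝ) → Fin 3 → ℝ} (hU : ∀ i, ContDiff ℝ 2 fun x => U x i)
    (m x : Fin 3 → ℝ) :
    div (fun y i => dirDeriv m (fun z => U z i) y) x = dirDeriv m (div U) x := by
  have hpd : ∀ i j, Differentiable ℝ (pd j fun y => U y i) := fun i j => differentiable_pd (hU i) j
  calc div (fun y i => dirDeriv m (fun z => U z i) y) x
      = ∑ i, ∑ j, m j * pd i (pd j fun y => U y i) x := by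
        simp only [div, dirDeriv, pd_sum _ fun j => (hpd _ j).const_mul (m j), pd_const_mul]
    _ = ∑ j, ∑ i, m j * pd j (pd i fun y => U y i) x := by
        rw [Finset.sum_comm]
        simp only [pd_comm (hU _)]
    _ = dirDeriv m (div U) x := by
        simp only [dirDeriv, ← Finset.mul_sum]
        refine Finset.sum_congr rfl fun j _ => ?_
        rw [← congrFun (pd_sum _ (fun i => hpd i i) j) x]
        rfl

lemma curl_cross_const {U : (Fin 3 → ℝ) → Fin 3 → ℝ} (hU : ∀ i, Differentiable ℝ fun x => U x i)
    (m x : Fin 3 → ℝ) (i : Fin 3) :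
    curl (fun y => U y ⨯₃ m) x i = dirDeriv m (fun y => U y i) x - m i * div U x := by
  have hsub : ∀ i j l (a b : ℝ), pd l (fun y => U y i * a - U y j * b) x
      = a * pd l (fun y => U y i) x - b * pd l (fun y => U y j) x := fun i j l a b => by
    rw [pd_sub ((hU i).mul_const a) ((hU j).mul_const b)]
    simp only [mul_comm _ a, mul_comm _ b, pd_const_mul]
  simp only [curl, cross_apply, Matrix.cons_val, hsub, dirDeriv, div, Fin.sum_univ_three]
  fin_cases i <;>
  · simp only [Fin.zero_eta, Fin.mk_one, Fin.reduceFinMk, Matrix.cons_val]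
    ring

lemma curl_cross (N : (Fin 3 → ℝ) → Fin 3 → ℝ) (m x : Fin 3 → ℝ) (i : Fin 3) :
    (curl N x ⨯₃ m) i
      = dirDeriv m (fun y => N y i) x - ∑ j, m j * pd i (fun y => N y j) x := by
  simp only [curl, cross_apply, Matrix.cons_val, dirDeriv, Fin.sum_univ_three]
  fin_cases i <;>
  · simp only [Fin.zero_eta, Fin.mk_one, Fin.reduceFinMk, Matrix.cons_val]
    ring

lemma isOpen_cell (L : ℝ) : IsOpen (cell L) :=
  (isOpen_Ioo.preimage (continuous_apply 0)).inter (isOpen_Ioo.preimage (continuous_apply 1))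

lemma mem_closure_cell {L : ℝ} (hL : 0 < L) (z : ℝ) : ![0, 0, z] ∈ closure (cell L) := by
  have hT : 0 < 2 * Real.pi * L := by positivity
  have hcell : cell L = Set.univ.pi ![Set.Ioo 0 (2 * Real.pi * L), Set.Ioo 0 (2 * Real.pi * L),
      Set.univ] := by
    ext x
    simp [cell, Fin.forall_fin_succ]
  rw [hcell, closure_pi_set, Set.mem_univ_pi]
  intro i
  fin_cases i <;> simp [closure_Ioo hT.ne, hT.le]

/-! ### Fourier modes -/

/-- The function `f(x₃) cos(ξ · x_h) + h(x₃) sin(ξ · x_h)`, where `x_h = (x₁, x₂)`. -/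
def mode (ξ : Freq) (f h : ℝ → ℝ) (x : Fin 3 → ℝ) : ℝ :=
  f (x 2) * Real.cos (∑ j : Fin 2, ξ j * x j.castSucc)
    + h (x 2) * Real.sin (∑ j : Fin 2, ξ j * x j.castSucc)

section mode

variable {ξ : Freq} {f h : ℝ → ℝ}

lemma hasFDerivAt_mode (hf : Differentiable ℝ f) (hh : Differentiable ℝ h) (x : Fin 3 → ℝ) :
    HasFDerivAt (mode ξ f h)
      (mode ξ (deriv f) (deriv h) x • ContinuousLinearMap.proj (R := ℝ) (φ := fun _ => ℝ) 2
        + mode ξ h (-f) x • ∑ j : Fin 2, ξ j •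
          ContinuousLinearMap.proj (R := ℝ) (φ := fun _ => ℝ) j.castSucc) x := by
  have hphase : HasFDerivAt (fun y : Fin 3 → ℝ => ∑ j : Fin 2, ξ j * y j.castSucc)
      (∑ j : Fin 2, ξ j • ContinuousLinearMap.proj (R := ℝ) (φ := fun _ => ℝ) j.castSucc) x :=
    HasFDerivAt.fun_sum fun j _ => (hasFDerivAt_apply j.castSucc x).const_mul (ξ j)
  have hprofile : ∀ {g : ℝ → ℝ}, Differentiable ℝ g → HasFDerivAt (fun y : Fin 3 → ℝ => g (y 2))
      (deriv g (x 2) • ContinuousLinearMap.proj (R := ℝ) (φ := fun _ => ℝ) 2) x := fun hg =>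
    (hg (x 2)).hasDerivAt.comp_hasFDerivAt x (hasFDerivAt_apply 2 x)
  refine (((hprofile hf).mul hphase.cos).add ((hprofile hh).mul hphase.sin)).congr_fderiv ?_
  simp only [mode, Pi.neg_apply]
  module

lemma pd_castSucc_mode (hf : Differentiable ℝ f) (hh : Differentiable ℝ h) (j : Fin 2) :
    pd j.castSucc (mode ξ f h) = mode ξ (fun z => ξ j * h z) (fun z => -(ξ j * f z)) := by
  funext x
  rw [pd, (hasFDerivAt_mode hf hh x).fderiv]
  fin_cases j <;> simp [mode] <;> ring

lemma pd_two_mode (hf : Differentiable ℝ f) (hh : Differentiable ℝ h) :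
    pd 2 (mode ξ f h) = mode ξ (deriv f) (deriv h) := by
  funext x
  rw [pd, (hasFDerivAt_mode hf hh x).fderiv]
  simp

lemma contDiff_mode (hf : ContDiff ℝ ∞ f) (hh : ContDiff ℝ ∞ h) : ContDiff ℝ ∞ (mode ξ f h) := by
  unfold mode
  fun_prop

lemma mode_add_single {L : ℝ} (hL : L ≠ 0) {j : Fin 2} (hξ : ∃ n : ℤ, ξ j = n / L)
    (x : Fin 3 → ℝ) :
    mode ξ f h (x + Pi.single j.castSucc (2 * Real.pi * L)) = mode ξ f h x := by
  obtain ⟨n, hn⟩ := hξ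
  have hphase :
      ∑ l : Fin 2, ξ l * (x + Pi.single j.castSucc (2 * Real.pi * L) : Fin 3 → ℝ) l.castSucc
      = (∑ l : Fin 2, ξ l * x l.castSucc) + n * (2 * Real.pi) := by
    simp only [Pi.add_apply, mul_add, Finset.sum_add_distrib, Pi.single_apply,
      Fin.castSucc_inj, mul_ite, mul_zero, Finset.sum_ite_eq', Finset.mem_univ, if_true, hn]
    field_simp
  have hlast : (x + Pi.single j.castSucc (2 * Real.pi * L) : Fin 3 → ℝ) 2 = x 2 := by
    fin_cases j <;> simp
  simp only [mode, hphase, hlast, Real.cos_add_int_mul_two_pi, Real.sin_add_int_mul_two_pi]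

lemma tendsto_mode (hf : Tendsto f (cocompact ℝ) (𝓝 0)) (hh : Tendsto h (cocompact ℝ) (𝓝 0))
    (x₁ x₂ : ℝ) : Tendsto (fun x₃ => mode ξ f h ![x₁, x₂, x₃]) (cocompact ℝ) (𝓝 0) := by
  simpa [mode, Fin.sum_univ_two] using
    (hf.mul_const (Real.cos (ξ 0 * x₁ + ξ 1 * x₂))).add
      (hh.mul_const (Real.sin (ξ 0 * x₁ + ξ 1 * x₂)))

lemma mode_sq_le (x : Fin 3 → ℝ) : mode ξ f h x ^ 2 ≤ f (x 2) ^ 2 + h (x 2) ^ 2 := by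
  rw [mode]
  set θ := ∑ j : Fin 2, ξ j * x j.castSucc
  nlinarith [sq_nonneg (f (x 2) * Real.sin θ - h (x 2) * Real.cos θ), Real.sin_sq_add_cos_sq θ]

lemma pd_castSucc_pd_castSucc_mode (hf : Differentiable ℝ f) (hh : Differentiable ℝ h)
    (j : Fin 2) : pd j.castSucc (pd j.castSucc (mode ξ f h))
      = mode ξ (fun z => ξ j * -(ξ j * f z)) fun z => -(ξ j * (ξ j * h z)) := by
  rw [pd_castSucc_mode hf hh, pd_castSucc_mode (hh.const_mul _) (hf.const_mul _).fun_neg]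

lemma pd_two_pd_two_mode (hf : ContDiff ℝ ∞ f) (hh : ContDiff ℝ ∞ h) :
    pd 2 (pd 2 (mode ξ f h)) = mode ξ (deriv (deriv f)) (deriv (deriv h)) := by
  have hd : ∀ {y : ℝ → ℝ}, ContDiff ℝ ∞ y → Differentiable ℝ y := fun hy =>
    hy.differentiable (by simp)
  rw [pd_two_mode (hd hf) (hd hh),
    pd_two_mode (hd (contDiff_infty_iff_deriv.1 hf).2) (hd (contDiff_infty_iff_deriv.1 hh).2)]

lemma lap_mode (hf : ContDiff ℝ ∞ f) (hh : ContDiff ℝ ∞ h) :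
    lap (mode ξ f h) = mode ξ (fun z => deriv (deriv f) z - ‖ξ‖ ^ 2 * f z)
      (fun z => deriv (deriv h) z - ‖ξ‖ ^ 2 * h z) := by
  funext x
  rw [lap, Fin.sum_univ_castSucc, EuclideanSpace.real_norm_sq_eq]
  simp only [Fin.reduceLast, pd_two_pd_two_mode hf hh,
    pd_castSucc_pd_castSucc_mode (hf.differentiable (by simp)) (hh.differentiable (by simp))]
  simp only [mode, Fin.sum_univ_two]
  ring

end mode

/-- `F` is a mode of horizontal frequency `ξ` whose profiles are smooth and have all derivatives
in `L²`. -/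
def IsMode (ξ : Freq) (F : (Fin 3 → ℝ) → ℝ) : Prop :=
  ∃ f h, ContDiffLp 2 ⊤ f ∧ ContDiffLp 2 ⊤ h ∧ F = mode ξ f h

lemma isMode_mode {ξ : Freq} {f h : ℝ → ℝ} (hf : ContDiffLp 2 ⊤ f) (hh : ContDiffLp 2 ⊤ h) :
    IsMode ξ (mode ξ f h) :=
  ⟨f, h, hf, hh, rfl⟩

namespace IsMode

variable {ξ : Freq} {F G : (Fin 3 → ℝ) → ℝ}

lemma const_mul (r : ℝ) (hF : IsMode ξ F) : IsMode ξ fun x => r * F x := by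
  obtain ⟨f, h, hf, hh, rfl⟩ := hF
  exact ⟨_, _, hf.const_mul r, hh.const_mul r, by funext x; simp only [mode]; ring⟩

lemma sub (hF : IsMode ξ F) (hG : IsMode ξ G) : IsMode ξ fun x => F x - G x := by
  obtain ⟨f, h, hf, hh, rfl⟩ := hF
  obtain ⟨f', h', hf', hh', rfl⟩ := hG
  exact ⟨_, _, hf.sub hf', hh.sub hh', by
    funext x; simp only [mode]; ring⟩

lemma sum {ι : Type*} (s : Finset ι) {F : ι → (Fin 3 → ℝ) → ℝ} (hF : ∀ i, IsMode ξ (F i)) :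
    IsMode ξ fun x => ∑ i ∈ s, F i x := by
  choose f h hf hh hF using hF
  exact ⟨_, _, .sum s fun i _ => hf i, .sum s fun i _ => hh i, by
    funext x; simp only [hF, mode, Finset.sum_add_distrib, Finset.sum_mul]⟩

protected lemma pd (i : Fin 3) (hF : IsMode ξ F) : IsMode ξ (pd i F) := by
  obtain ⟨f, h, hf, hh, rfl⟩ := hF
  have hdf := hf.1.differentiable (by simp)
  have hdh := hh.1.differentiable (by simp)
  induction i using Fin.lastCases with
  | last => exact ⟨_, _, hf.deriv, hh.deriv, pd_two_mode hdf hdh⟩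
  | cast j =>
    refine ⟨_, _, hh.const_mul (ξ j), hf.const_mul (-ξ j), ?_⟩
    simp only [neg_mul]
    exact pd_castSucc_mode hdf hdh j

protected lemma mpd (a : Fin 3 → ℕ) (hF : IsMode ξ F) : IsMode ξ (mpd a F) := by
  have hiter : ∀ (i : Fin 3) (n : ℕ) {G}, IsMode ξ G → IsMode ξ ((RTMHD.pd i)^[n] G) :=
    fun i n G hG => Function.Iterate.rec (IsMode ξ) hG (fun _ hG => hG.pd i) n
  exact hiter 0 _ (hiter 1 _ (hiter 2 _ hF))

protected lemma dirDeriv (m : Fin 3 → ℝ) (hF : IsMode ξ F) : IsMode ξ (dirDeriv m F) :=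
  .sum _ fun i => (hF.pd i).const_mul (m i)

protected lemma contDiff (hF : IsMode ξ F) : ContDiff ℝ ∞ F := by
  obtain ⟨f, h, hf, hh, rfl⟩ := hF
  exact contDiff_mode hf.1 hh.1

lemma horPeriodic {L : ℝ} (hL : L ≠ 0) (hξ : ∀ i, ∃ n : ℤ, ξ i = n / L) (hF : IsMode ξ F) :
    HorPeriodic L F := by
  obtain ⟨f, h, -, -, rfl⟩ := hF
  exact fun x => ⟨mode_add_single hL (hξ 0) x, mode_add_single hL (hξ 1) x⟩

lemma tendsto (hF : IsMode ξ F) (x₁ x₂ : ℝ) :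
    Tendsto (fun x₃ => F ![x₁, x₂, x₃]) (cocompact ℝ) (𝓝 0) := by
  obtain ⟨f, h, hf, hh, rfl⟩ := hF
  exact tendsto_mode
    (tendsto_cocompact_zero_of_memLp_two hf.hasDerivAt hf.memLp hf.deriv.memLp)
    (tendsto_cocompact_zero_of_memLp_two hh.hasDerivAt hh.memLp hh.deriv.memLp) x₁ x₂

lemma lintegral_cell_lt_top (hF : IsMode ξ F) (L : ℝ) :
    ∫⁻ x in cell L, ENNReal.ofReal (F x ^ 2) < ⊤ := by
  obtain ⟨f, h, hf, hh, rfl⟩ := hF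
  let I : ℝ → ℝ := (Set.Ioo 0 (2 * Real.pi * L)).indicator fun _ => 1
  have hI : Integrable I :=
    (integrable_indicator_iff measurableSet_Ioo).2 (by simp [integrableOn_const_iff])
  have hbound : Integrable fun x : Fin 3 → ℝ =>
      ∏ i, ![I, I, fun z => f z ^ 2 + h z ^ 2] i (x i) := by
    refine Integrable.fintype_prod fun i => ?_
    fin_cases i
    exacts [hI, hI, hf.memLp.integrable_sq.add hh.memLp.integrable_sq]
  refine lt_of_le_of_lt ?_ hbound.lintegral_lt_top
  rw [← lintegral_indicator (isOpen_cell L).measurableSet]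
  refine lintegral_mono fun x => Set.indicator_apply_le' (fun hx => ?_) fun _ => zero_le
  refine ENNReal.ofReal_le_ofReal ?_
  have hI1 : ∀ z ∈ Set.Ioo 0 (2 * Real.pi * L), I z = 1 := fun z hz => Set.indicator_of_mem hz _
  simpa only [Fin.prod_univ_three, Matrix.cons_val, hI1 _ hx.1, hI1 _ hx.2, one_mul]
    using mode_sq_le x

end IsMode

/-! ### Sobolev norms of modes -/

section hNorm

variable {L : ℝ} {k n : ℕ}

lemma hNorm_lt_top {ξ : Freq} {F : Fin n → (Fin 3 → ℝ) → ℝ} (hF : ∀ i, IsMode ξ (F i)) :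
    hNorm L k F < ⊤ :=
  ENNReal.rpow_lt_top_of_nonneg (by norm_num) (ENNReal.sum_lt_top.2 fun i _ =>
    ENNReal.sum_lt_top.2 fun _ _ => ENNReal.sum_lt_top.2 fun a _ =>
      ((hF i).mpd a).lintegral_cell_lt_top L).ne

lemma mpd_const_mul (r : ℝ) (a : Fin 3 → ℕ) (F : (Fin 3 → ℝ) → ℝ) :
    mpd a (fun x => r * F x) = fun x => r * mpd a F x := by
  have hiter : ∀ i m (G : (Fin 3 → ℝ) → ℝ),
      (pd i)^[m] (fun x => r * G x) = fun x => r * (pd i)^[m] G x := fun i m G =>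
    (Function.Semiconj.iterate_right (f := fun (G : (Fin 3 → ℝ) → ℝ) x => r * G x)
      (fun G => (pd_const_mul r i G).symm) m G).symm
  simp only [mpd, hiter]

lemma hNorm_const_mul {r : ℝ} (hr : 0 ≤ r) (F : Fin n → (Fin 3 → ℝ) → ℝ) :
    hNorm L k (fun i x => r * F i x) = ENNReal.ofReal r * hNorm L k F := by
  simp only [hNorm, mpd_const_mul, mul_pow, ENNReal.ofReal_mul (sq_nonneg r),
    lintegral_const_mul' _ _ ENNReal.ofReal_ne_top, ← Finset.mul_sum]
  rw [ENNReal.mul_rpow_of_nonneg _ _ (by norm_num),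
    ENNReal.ofReal_rpow_of_nonneg (sq_nonneg _) (by norm_num), ← Real.sqrt_eq_rpow,
    Real.sqrt_sq hr]

lemma hNorm_zero_pos {F : Fin n → (Fin 3 → ℝ) → ℝ} (i : Fin n) (hF : Continuous (F i))
    {x : Fin 3 → ℝ} (hx : x ∈ closure (cell L)) (h : F i x ≠ 0) : 0 < hNorm L 0 F := by
  have hopen : IsOpen {y | F i y ≠ 0} := isOpen_ne_fun hF continuous_const
  have hsupp : Function.support (fun y => ENNReal.ofReal (F i y ^ 2)) = {y | F i y ≠ 0} := by
    ext y
    simp [Function.mem_support]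
  have hpos : 0 < ∫⁻ y in cell L, ENNReal.ofReal (F i y ^ 2) := by
    rw [setLIntegral_pos_iff (by fun_prop), hsupp]
    exact (hopen.inter (isOpen_cell L)).measure_pos volume (mem_closure_iff.1 hx _ hopen h)
  refine ENNReal.rpow_pos_of_nonneg (hpos.trans_le ?_) (by norm_num)
  refine le_trans ?_ (Finset.single_le_sum (fun _ _ => zero_le) (Finset.mem_univ i))
  simp [mpd, Finset.Nat.antidiagonalTuple_zero_right]

end hNorm

/-! ### Exponentially growing solutions -/

/-- The field `e^{st} F` as a function of the time `t` and the position. -/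
def evolve {V : Type*} [SMul ℝ V] (s : ℝ) (F : (Fin 3 → ℝ) → V) (t : ℝ) (x : Fin 3 → ℝ) : V :=
  Real.exp (s * t) • F x

section evolve

variable {V : Type*} [NormedAddCommGroup V] [NormedSpace ℝ V] {s : ℝ}

lemma evolve_zero (s : ℝ) (F : (Fin 3 → ℝ) → V) : evolve s F 0 = F := by
  funext x
  simp [evolve]

lemma deriv_evolve (s : ℝ) (F : (Fin 3 → ℝ) → V) (x : Fin 3 → ℝ) (t : ℝ) :
    deriv (fun τ => evolve s F τ x) t = s • evolve s F t x := by
  have hexp : HasDerivAt (fun τ => Real.exp (s * τ)) (Real.exp (s * t) * s) t := by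
    simpa using ((hasDerivAt_id t).const_mul s).exp
  rw [evolve, smul_smul, mul_comm s]
  exact (hexp.smul_const (F x)).deriv

lemma contDiff_evolve {F : (Fin 3 → ℝ) → V} (hF : ContDiff ℝ ∞ F) :
    ContDiff ℝ ∞ fun p : ℝ × (Fin 3 → ℝ) => evolve s F p.1 p.2 := by
  unfold evolve
  fun_prop

lemma allComp_evolve (s t : ℝ) (R Q : (Fin 3 → ℝ) → ℝ) (U N : (Fin 3 → ℝ) → Fin 3 → ℝ) :
    allComp (evolve s R t) (evolve s U t) (evolve s N t) (evolve s Q t)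
      = fun i => evolve s (allComp R U N Q i) t := by
  funext i
  fin_cases i <;> rfl

lemma rhoNq_evolve (s t : ℝ) (R Q : (Fin 3 → ℝ) → ℝ) (N : (Fin 3 → ℝ) → Fin 3 → ℝ) :
    rhoNq (evolve s R t) (evolve s N t) (evolve s Q t) = fun i => evolve s (rhoNq R N Q i) t := by
  funext i
  fin_cases i <;> rfl

lemma hNorm_evolve {L : ℝ} {k n : ℕ} (s t : ℝ) (F : Fin n → (Fin 3 → ℝ) → ℝ) :
    hNorm L k (fun i => evolve s (F i) t) = ENNReal.ofReal (Real.exp (s * t)) * hNorm L k F :=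
  hNorm_const_mul (Real.exp_pos _).le F

lemma hNorm_evolve_singleton {L : ℝ} {k : ℕ} (s t : ℝ) (F : (Fin 3 → ℝ) → ℝ) :
    hNorm L k ![evolve s F t] = ENNReal.ofReal (Real.exp (s * t)) * hNorm L k ![F] := by
  rw [← hNorm_evolve]
  congr
  funext i
  rw [Matrix.cons_val_fin_one, Matrix.cons_val_fin_one]

end evolve

/-- `(R, U, N, Q)` is a mode of horizontal frequency `ξ` for which `e^{st} (R, U, N, Q)` solves the
linearized equations. -/
structure IsEigenmode (D : RTData) (ξ : Freq) (s : ℝ) (R : (Fin 3 → ℝ) → ℝ)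
    (U N : (Fin 3 → ℝ) → Fin 3 → ℝ) (Q : (Fin 3 → ℝ) → ℝ) : Prop where
  isMode_R : IsMode ξ R
  isMode_U : ∀ i, IsMode ξ fun x => U x i
  isMode_N : ∀ i, IsMode ξ fun x => N x i
  isMode_Q : IsMode ξ Q
  continuity : ∀ x, s * R x + deriv D.ρ (x 2) * U x 2 = 0
  momentum : ∀ x, (s * D.ρ (x 2)) • U x + grad Q x + (D.g * R x) • ![0, 0, 1]
    = D.μ • (fun i => lap (fun y => U y i) x) + curl N x ⨯₃ D.Mbar
  induction : ∀ x, s • N x = curl (fun y => U y ⨯₃ D.Mbar) x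
  div_U : ∀ x, div U x = 0
  div_N : ∀ x, div N x = 0

namespace IsEigenmode

variable {D : RTData} {ξ : Freq} {s : ℝ} {R Q : (Fin 3 → ℝ) → ℝ} {U N : (Fin 3 → ℝ) → Fin 3 → ℝ}

lemma isMode_allComp (h : IsEigenmode D ξ s R U N Q) (i : Fin 8) :
    IsMode ξ (allComp R U N Q i) := by
  fin_cases i
  exacts [h.isMode_R, h.isMode_U 0, h.isMode_U 1, h.isMode_U 2,
    h.isMode_N 0, h.isMode_N 1, h.isMode_N 2, h.isMode_Q]

lemma evolve_continuity (h : IsEigenmode D ξ s R U N Q) (t : ℝ) (x : Fin 3 → ℝ) :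
    deriv (fun τ => evolve s R τ x) t + deriv D.ρ (x 2) * evolve s U t x 2 = 0 := by
  rw [deriv_evolve]
  simp only [evolve, Pi.smul_apply, smul_eq_mul]
  linear_combination Real.exp (s * t) * h.continuity x

lemma evolve_momentum (h : IsEigenmode D ξ s R U N Q) (t : ℝ) (x : Fin 3 → ℝ) :
    D.ρ (x 2) • deriv (fun τ => evolve s U τ x) t + grad (evolve s Q t) x
        + (D.g * evolve s R t x) • ![0, 0, 1]
      = D.μ • (fun i => lap (fun y => evolve s U t y i) x) + curl (evolve s N t) x ⨯₃ D.Mbar := by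
  have hgrad : grad (evolve s Q t) x = Real.exp (s * t) • grad Q x := grad_const_mul _ Q x
  have hcurl : curl (evolve s N t) x = Real.exp (s * t) • curl N x := curl_smul _ N x
  have hlap : (fun i => lap (fun y => evolve s U t y i) x)
      = Real.exp (s * t) • fun i => lap (fun y => U y i) x :=
    funext fun i => lap_const_mul _ (fun y => U y i) x
  calc D.ρ (x 2) • deriv (fun τ => evolve s U τ x) t + grad (evolve s Q t) x
        + (D.g * evolve s R t x) • ![0, 0, 1]
      = Real.exp (s * t) •
          ((s * D.ρ (x 2)) • U x + grad Q x + (D.g * R x) • ![0, 0, 1]) := by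
        rw [deriv_evolve, hgrad]
        simp only [evolve, smul_eq_mul]
        module
    _ = D.μ • (fun i => lap (fun y => evolve s U t y i) x)
          + curl (evolve s N t) x ⨯₃ D.Mbar := by
        rw [h.momentum, hcurl, hlap, LinearMap.map_smul₂]
        module

lemma evolve_induction (h : IsEigenmode D ξ s R U N Q) (t : ℝ) (x : Fin 3 → ℝ) :
    deriv (fun τ => evolve s N τ x) t = curl (fun y => evolve s U t y ⨯₃ D.Mbar) x := by
  rw [deriv_evolve]
  simp only [evolve, LinearMap.map_smul₂, curl_smul, ← h.induction, smul_comm s]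

lemma tendsto_evolve {F : (Fin 3 → ℝ) → Fin 3 → ℝ} (hF : ∀ i, IsMode ξ fun x => F x i)
    (t x₁ x₂ : ℝ) : Tendsto (fun x₃ => evolve s F t ![x₁, x₂, x₃]) (cocompact ℝ) (𝓝 0) :=
  tendsto_pi_nhds.2 fun i => ((hF i).const_mul (Real.exp (s * t))).tendsto x₁ x₂

theorem isSolution (h : IsEigenmode D ξ s R U N Q) (hL : D.L ≠ 0) (hξ : ξ ∈ D.lattice) :
    IsSolution D (evolve s R) (evolve s U) (evolve s N) (evolve s Q) where
  smooth_ϱ := (contDiff_evolve h.isMode_R.contDiff).contDiffOn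
  smooth_u := (contDiff_evolve (contDiff_pi' fun i => (h.isMode_U i).contDiff)).contDiffOn
  smooth_N := (contDiff_evolve (contDiff_pi' fun i => (h.isMode_N i).contDiff)).contDiffOn
  smooth_q := (contDiff_evolve h.isMode_Q.contDiff).contDiffOn
  periodic_ϱ _ _ := (h.isMode_R.const_mul _).horPeriodic hL hξ
  periodic_u _ _ i := ((h.isMode_U i).const_mul _).horPeriodic hL hξ
  periodic_N _ _ i := ((h.isMode_N i).const_mul _).horPeriodic hL hξ
  periodic_q _ _ := (h.isMode_Q.const_mul _).horPeriodic hL hξ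
  continuity t _ := h.evolve_continuity t
  momentum t _ := h.evolve_momentum t
  induction t _ := h.evolve_induction t
  div_u _ _ x := (div_smul _ U x).trans (by rw [h.div_U, mul_zero])
  div_N _ _ x := (div_smul _ N x).trans (by rw [h.div_N, mul_zero])
  decay_ϱ _ _ := (h.isMode_R.const_mul _).tendsto
  decay_u t _ := tendsto_evolve h.isMode_U t
  decay_N t _ := tendsto_evolve h.isMode_N t

/-- Since `(∇ × N) × M̄ = (M̄ · ∇) N - ∇ (M̄ · N)`, subtracting the magnetic pressure
`M̄ · N` from the total pressure `P` leaves a momentum equation in which `N = s⁻¹ (M̄ · ∇) U` acts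
componentwise. -/
lemma of_total_pressure {P : (Fin 3 → ℝ) → ℝ} (hs : s ≠ 0) (hR : IsMode ξ R)
    (hU : ∀ i, IsMode ξ fun x => U x i) (hP : IsMode ξ P)
    (hcont : ∀ x, s * R x + deriv D.ρ (x 2) * U x 2 = 0) (hdiv : ∀ x, div U x = 0)
    (hmom : ∀ i x, s * D.ρ (x 2) * U x i + pd i P x + D.g * R x * (![0, 0, 1] : Fin 3 → ℝ) i
      = D.μ * lap (fun y => U y i) x
        + s⁻¹ * dirDeriv D.Mbar (dirDeriv D.Mbar fun y => U y i) x) :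
    IsEigenmode D ξ s R U (fun x i => s⁻¹ * dirDeriv D.Mbar (fun y => U y i) x)
      (fun x => P x - ∑ j, D.Mbar j * (s⁻¹ * dirDeriv D.Mbar (fun y => U y j) x)) := by
  have hN : ∀ i, IsMode ξ fun x => s⁻¹ * dirDeriv D.Mbar (fun y => U y i) x := fun i =>
    ((hU i).dirDeriv _).const_mul _
  have hd : ∀ {F}, IsMode ξ F → Differentiable ℝ F := fun hF => hF.contDiff.differentiable (by simp)
  have hQ : IsMode ξ fun x => ∑ j, D.Mbar j * (s⁻¹ * dirDeriv D.Mbar (fun y => U y j) x) :=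
    .sum _ fun j => (hN j).const_mul _
  refine ⟨hR, hU, hN, hP.sub hQ, hcont, fun x => ?_, fun x => ?_, hdiv, fun x => ?_⟩
  · funext i
    simp only [Pi.add_apply, Pi.smul_apply, smul_eq_mul, grad, curl_cross, pd_sub (hd hP) (hd hQ),
      pd_sum _ fun j => hd ((hN j).const_mul (D.Mbar j)), pd_const_mul, dirDeriv_const_mul]
    linear_combination hmom i x
  · funext i
    rw [curl_cross_const (fun j => hd (hU j)), hdiv, Pi.smul_apply, smul_eq_mul]
    field_simp
    ring
  · calc div (fun y i => s⁻¹ * dirDeriv D.Mbar (fun z => U z i) y) x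
        = s⁻¹ * div (fun y i => dirDeriv D.Mbar (fun z => U z i) y) x := div_smul _ _ x
      _ = 0 := by
        rw [div_dirDeriv fun i => contDiff_infty.1 (hU i).contDiff 2, funext hdiv]
        simp [dirDeriv, pd]

end IsEigenmode

/-! ### Construction of the eigenmodes -/

/-- The divergence-free mode with vertical component `y(x₃) (cos (ξ · x_h) + sin (ξ · x_h))` whose
horizontal component is parallel to `ξ`. -/
def velocity (ξ : Freq) (y : ℝ → ℝ) (x : Fin 3 → ℝ) : Fin 3 → ℝ :=
  ![ξ 0 / ‖ξ‖ ^ 2 * mode ξ (deriv y) (-deriv y) x, ξ 1 / ‖ξ‖ ^ 2 * mode ξ (deriv y) (-deriv y) x,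
    mode ξ y y x]

section velocity

variable {ξ : Freq} {y : ℝ → ℝ}

lemma velocity_castSucc (j : Fin 2) :
    (fun x => velocity ξ y x j.castSucc)
      = fun x => ξ j / ‖ξ‖ ^ 2 * mode ξ (deriv y) (-deriv y) x := by
  fin_cases j <;> rfl

lemma velocity_two : (fun x => velocity ξ y x 2) = mode ξ y y :=
  rfl

lemma isMode_velocity (hy : ContDiffLp 2 ⊤ y) (i : Fin 3) : IsMode ξ fun x => velocity ξ y x i := by
  induction i using Fin.lastCases with
  | last => exact isMode_mode hy hy
  | cast j =>
    rw [velocity_castSucc]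
    exact (isMode_mode hy.deriv hy.deriv.neg).const_mul _

lemma div_velocity (hξ : ξ ≠ 0) (hy : ContDiff ℝ ∞ y) (x : Fin 3 → ℝ) :
    div (velocity ξ y) x = 0 := by
  have hd : Differentiable ℝ y := hy.differentiable (by simp)
  have hd' : Differentiable ℝ (deriv y) :=
    (contDiff_infty_iff_deriv.1 hy).2.differentiable (by simp)
  have hk : ξ 0 ^ 2 + ξ 1 ^ 2 = ‖ξ‖ ^ 2 := by
    rw [EuclideanSpace.real_norm_sq_eq, Fin.sum_univ_two]
  have hk0 : ‖ξ‖ ≠ 0 := norm_ne_zero_iff.2 hξ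
  rw [div, Fin.sum_univ_castSucc]
  simp only [Fin.reduceLast, velocity_castSucc, velocity_two, pd_const_mul, pd_two_mode hd hd,
    pd_castSucc_mode hd' hd'.neg, Fin.sum_univ_two]
  simp only [mode, Pi.neg_apply]
  field_simp
  rw [← hk]
  ring

end velocity

namespace RTData

variable {D : RTData} {ξ : Freq} {s : ℝ}

/-- The second-order operator by which `μ Δ + s⁻¹ (M̄ · ∇)²` acts on the profiles of a mode. -/
def profileOp (D : RTData) (ξ : Freq) (s : ℝ) (f : ℝ → ℝ) (z : ℝ) : ℝ :=
  (D.μ + s⁻¹ * (‖ξ‖ ^ 2 * D.magneticCoeff ξ 2)) * deriv (deriv f) z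
    - (D.μ * ‖ξ‖ ^ 2 + s⁻¹ * D.magneticCoeff ξ 0) * f z

lemma profileOp_neg (f : ℝ → ℝ) : D.profileOp ξ s (-f) = -D.profileOp ξ s f := by
  funext z
  simp only [profileOp, deriv.neg', deriv.fun_neg', Pi.neg_apply]
  ring

lemma contDiffLp_profileOp {f : ℝ → ℝ} (hf : ContDiffLp 2 ⊤ f) :
    ContDiffLp 2 ⊤ (D.profileOp ξ s f) :=
  (hf.deriv.deriv.const_mul _).sub (hf.const_mul _)

lemma deriv_profileOp {f : ℝ → ℝ} (hf : ContDiffLp 2 ⊤ f) :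
    deriv (D.profileOp ξ s f) = D.profileOp ξ s (deriv f) :=
  funext fun z =>
    (((hf.deriv.deriv.hasDerivAt z).const_mul _).fun_sub ((hf.hasDerivAt z).const_mul _)).deriv

lemma dirDeriv_Mbar_horizontal (hdir : D.dir = .horizontal) (F : (Fin 3 → ℝ) → ℝ) :
    dirDeriv D.Mbar F = fun x => D.M * pd 0 F x := by
  funext x
  simp [dirDeriv, Mbar, hdir, Fin.sum_univ_three]

lemma dirDeriv_Mbar_vertical (hdir : D.dir = .vertical) (F : (Fin 3 → ℝ) → ℝ) :
    dirDeriv D.Mbar F = fun x => D.M * pd 2 F x := by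
  funext x
  simp [dirDeriv, Mbar, hdir, Fin.sum_univ_three]

lemma dirDeriv_Mbar_dirDeriv_Mbar_mode (hξ : ξ ≠ 0) {f h : ℝ → ℝ} (hf : ContDiff ℝ ∞ f)
    (hh : ContDiff ℝ ∞ h) :
    dirDeriv D.Mbar (dirDeriv D.Mbar (mode ξ f h)) = mode ξ
      (fun z => ‖ξ‖ ^ 2 * D.magneticCoeff ξ 2 * deriv (deriv f) z - D.magneticCoeff ξ 0 * f z)
      (fun z => ‖ξ‖ ^ 2 * D.magneticCoeff ξ 2 * deriv (deriv h) z - D.magneticCoeff ξ 0 * h z) := by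
  have hk : ‖ξ‖ ≠ 0 := norm_ne_zero_iff.2 hξ
  funext x
  cases hdir : D.dir with
  | horizontal =>
    have hpd := pd_castSucc_pd_castSucc_mode (ξ := ξ) (hf.differentiable (by simp))
      (hh.differentiable (by simp)) 0
    rw [Fin.castSucc_zero] at hpd
    simp only [dirDeriv_Mbar_horizontal hdir, pd_const_mul, hpd, mode, magneticCoeff, hdir,
      Matrix.cons_val]
    ring
  | vertical =>
    simp only [dirDeriv_Mbar_vertical hdir, pd_const_mul, pd_two_pd_two_mode hf hh, mode,
      magneticCoeff, hdir, Matrix.cons_val]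
    field_simp
    ring

lemma lap_add_dirDeriv_Mbar_mode (hξ : ξ ≠ 0) {f h : ℝ → ℝ} (hf : ContDiff ℝ ∞ f)
    (hh : ContDiff ℝ ∞ h) (x : Fin 3 → ℝ) :
    D.μ * lap (mode ξ f h) x + s⁻¹ * dirDeriv D.Mbar (dirDeriv D.Mbar (mode ξ f h)) x
      = mode ξ (D.profileOp ξ s f) (D.profileOp ξ s h) x := by
  rw [lap_mode hf hh, dirDeriv_Mbar_dirDeriv_Mbar_mode hξ hf hh]
  simp only [mode, profileOp]
  ring

/-- In terms of the profiles, `hp` is the horizontal and `hp'` the vertical momentum equation. -/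
lemma isEigenmode_velocity {y r p : ℝ → ℝ} (hξ : ξ ≠ 0) (hs : s ≠ 0) (hy : ContDiffLp 2 ⊤ y)
    (hrL : ContDiffLp 2 ⊤ r) (hpL : ContDiffLp 2 ⊤ p)
    (hr : ∀ z, s * r z + deriv D.ρ z * y z = 0)
    (hp : ∀ z, ‖ξ‖ ^ 2 * p z = D.profileOp ξ s (deriv y) z - s * D.ρ z * deriv y z)
    (hp' : ∀ z, deriv p z = D.profileOp ξ s y z - s * D.ρ z * y z - D.g * r z) :
    IsEigenmode D ξ s (mode ξ r r) (velocity ξ y)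
      (fun x i => s⁻¹ * dirDeriv D.Mbar (fun x => velocity ξ y x i) x)
      (fun x => mode ξ p p x
        - ∑ j, D.Mbar j * (s⁻¹ * dirDeriv D.Mbar (fun x => velocity ξ y x j) x)) := by
  have hk : ‖ξ‖ ≠ 0 := norm_ne_zero_iff.2 hξ
  have hdp : Differentiable ℝ p := hpL.1.differentiable (by simp)
  refine .of_total_pressure hs (isMode_mode hrL hrL) (isMode_velocity hy) (isMode_mode hpL hpL)
    (fun x => ?_) (div_velocity hξ hy.1) fun i x => ?_
  · change s * mode ξ r r x + deriv D.ρ (x 2) * mode ξ y y x = 0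
    simp only [mode]
    linear_combination (Real.cos (∑ j : Fin 2, ξ j * x j.castSucc)
      + Real.sin (∑ j : Fin 2, ξ j * x j.castSucc)) * hr (x 2)
  induction i using Fin.lastCases with
  | last =>
    simp only [Fin.reduceLast]
    rw [velocity_two, lap_add_dirDeriv_Mbar_mode hξ hy.1 hy.1, pd_two_mode hdp hdp,
      congrFun velocity_two x]
    simp only [mode, Matrix.cons_val]
    linear_combination (Real.cos (∑ j : Fin 2, ξ j * x j.castSucc)
      + Real.sin (∑ j : Fin 2, ξ j * x j.castSucc)) * hp' (x 2)
  | cast j =>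
    have he : (![0, 0, 1] : Fin 3 → ℝ) j.castSucc = 0 := by fin_cases j <;> rfl
    rw [velocity_castSucc, congrFun (velocity_castSucc j) x, pd_castSucc_mode hdp hdp, he]
    have hpj : ξ j * p (x 2) = ξ j / ‖ξ‖ ^ 2
        * (D.profileOp ξ s (deriv y) (x 2) - s * D.ρ (x 2) * deriv y (x 2)) := by
      rw [← hp]
      field_simp
    have hy' : ContDiff ℝ ∞ (deriv y) := hy.deriv.1
    have hneg : ContDiff ℝ ∞ (-deriv y) := hy'.neg
    calc _ = ξ j / ‖ξ‖ ^ 2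
          * mode ξ (D.profileOp ξ s (deriv y)) (D.profileOp ξ s (-deriv y)) x := by
          simp only [mode, profileOp_neg, Pi.neg_apply]
          linear_combination (Real.cos (∑ l : Fin 2, ξ l * x l.castSucc)
            - Real.sin (∑ l : Fin 2, ξ l * x l.castSucc)) * hpj
      _ = _ := by
          rw [← lap_add_dirDeriv_Mbar_mode hξ hy' hneg, lap_const_mul, dirDeriv_const_mul,
            dirDeriv_const_mul]
          ring

lemma norm_sq_mul_magneticCoeff_one (hξ : ξ ≠ 0) :
    ‖ξ‖ ^ 2 * D.magneticCoeff ξ 1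
      = D.magneticCoeff ξ 0 + ‖ξ‖ ^ 2 * (‖ξ‖ ^ 2 * D.magneticCoeff ξ 2) := by
  have hk : ‖ξ‖ ≠ 0 := norm_ne_zero_iff.2 hξ
  cases hdir : D.dir <;> simp only [magneticCoeff, hdir, Matrix.cons_val] <;> field_simp <;> ring

namespace Admissible

variable (hD : D.Admissible)
include hD

lemma exists_isEigenmode (hξ : ξ ≠ 0) (hs : D.IsGrowthRate ξ s) :
    ∃ y R Q, ContDiffLp 2 ⊤ y ∧ y ≠ 0 ∧ IsEigenmode D ξ s R (velocity ξ y)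
      (fun x i => s⁻¹ * dirDeriv D.Mbar (fun x => velocity ξ y x i) x) Q := by
  obtain ⟨y, hy, hy0, hode⟩ := hD.exists_eigenfunction hξ hs
  have hs0 : s ≠ 0 := ((hD.isGrowthRate_iff hξ).1 hs).1.ne'
  have hk : ‖ξ‖ ≠ 0 := norm_ne_zero_iff.2 hξ
  have hρ := hD.contDiffLp_ρ
  let r : ℝ → ℝ := fun z => -s⁻¹ * (deriv D.ρ z * y z)
  let p : ℝ → ℝ := fun z => (‖ξ‖ ^ 2)⁻¹
    * (D.profileOp ξ s (deriv y) z + -s * (D.ρ z * deriv y z))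
  have hrL : ContDiffLp 2 ⊤ r := (hρ.deriv.mul hy).const_mul _
  have hpL : ContDiffLp 2 ⊤ p :=
    ((contDiffLp_profileOp hy.deriv).add ((hρ.mul hy.deriv).const_mul _)).const_mul _
  have hp' : ∀ z, deriv p z = (‖ξ‖ ^ 2)⁻¹ * (D.profileOp ξ s (deriv (deriv y)) z
      + -s * (deriv D.ρ z * deriv y z + D.ρ z * deriv (deriv y) z)) := fun z => by
    rw [← deriv_profileOp hy.deriv]
    exact ((((contDiffLp_profileOp hy.deriv).hasDerivAt z).add
      (((hρ.hasDerivAt z).mul (hy.deriv.hasDerivAt z)).const_mul _)).const_mul _).deriv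
  refine ⟨y, _, _, hy, hy0, isEigenmode_velocity hξ hs0 hy hrL hpL (fun z => ?_) (fun z => ?_)
    fun z => ?_⟩
  · simp only [r]
    field_simp
    ring
  · simp only [p]
    field_simp
    ring
  · rw [hp']
    simp only [profileOp, r]
    field_simp
    linear_combination hode z + deriv (deriv y) z * norm_sq_mul_magneticCoeff_one (D := D) hξ

end Admissible

end RTData

/-! ### Growth rates on the lattice -/

namespace RTData

variable {D : RTData} {ξ : Freq} {s : ℝ}

namespace Admissible

variable (hD : D.Admissible)
include hD

lemma exists_isEigenmode_hNorm_pos (hξ : ξ ≠ 0) (hs : D.IsGrowthRate ξ s) :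
    ∃ R U N Q, IsEigenmode D ξ s R U N Q ∧
      0 < hNorm D.L 0 ![fun x => U x 0, fun x => U x 1] ∧ 0 < hNorm D.L 0 ![fun x => U x 2] ∧
      (D.dir = .vertical → 0 < hNorm D.L 0 ![fun x => N x 2]) := by
  obtain ⟨y, R, Q, hy, hy0, hE⟩ := hD.exists_isEigenmode hξ hs
  obtain ⟨z, hz⟩ : ∃ z, y z ≠ 0 := Function.ne_iff.1 hy0
  obtain ⟨z', hz'⟩ := hy.exists_deriv_ne_zero hy0
  have hmode : ∀ (f h : ℝ → ℝ) z, mode ξ f h ![0, 0, z] = f z := fun f h z => by simp [mode]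
  have hcell := mem_closure_cell hD.L_pos
  refine ⟨R, _, _, Q, hE, ?_, ?_, fun hdir => ?_⟩
  · obtain ⟨j, hj⟩ : ∃ j, ξ j ≠ 0 := by
      by_contra! h
      exact hξ (PiLp.ext h)
    have hcomp : ![fun x => velocity ξ y x 0, fun x => velocity ξ y x 1] j
        = fun x => velocity ξ y x j.castSucc := by fin_cases j <;> rfl
    refine hNorm_zero_pos j ?_ (hcell z') ?_
    · rw [hcomp]
      exact (hE.isMode_U _).contDiff.continuous
    · simp only [hcomp]
      rw [congrFun (velocity_castSucc j) ![0, 0, z'], hmode]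
      exact mul_ne_zero (div_ne_zero hj (pow_ne_zero 2 (norm_ne_zero_iff.2 hξ))) hz'
  · refine hNorm_zero_pos 0 (hE.isMode_U 2).contDiff.continuous (hcell z) ?_
    exact (hmode y y z).trans_ne hz
  · refine hNorm_zero_pos 0 (hE.isMode_N 2).contDiff.continuous (hcell z') ?_
    have hd : Differentiable ℝ y := hy.1.differentiable (by simp)
    have hs0 : s ≠ 0 := ((hD.isGrowthRate_iff hξ).1 hs).1.ne'
    simp only [Matrix.cons_val_fin_one, velocity_two, dirDeriv_Mbar_vertical hdir,
      pd_two_mode hd hd, hmode]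
    exact mul_ne_zero (inv_ne_zero hs0) (mul_ne_zero hD.M_ne hz')

lemma existsUnique_isGrowthRate (h : ξ ∈ D.solvable) : ∃! s, D.IsGrowthRate ξ s :=
  let ⟨_, hψ⟩ := hD.exists_E0_neg h
  hD.existsUnique_growthRate (ne_zero_of_mem_solvable h) hψ

lemma isGrowthRate_growthRate (h : ξ ∈ D.solvable) : D.IsGrowthRate ξ (D.growthRate ξ) :=
  Classical.epsilon_spec (hD.existsUnique_isGrowthRate h).exists

lemma latticeRates_nonempty : D.latticeRates.Nonempty := by
  refine Set.Nonempty.image _ ?_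
  cases hdir : D.dir with
  | horizontal =>
    refine ⟨!₂[0, 1 / D.L], ?_, fun i => ?_⟩
    · rw [solvable, hdir]
      refine ⟨Or.inr rfl, fun h => (one_div_pos.2 hD.L_pos).ne' ?_⟩
      exact congrArg (fun ξ : Freq => ξ 1) (Set.mem_singleton_iff.1 h)
    · fin_cases i
      exacts [⟨0, by simp⟩, ⟨1, by simp⟩]
  | vertical =>
    obtain ⟨n, hn⟩ := exists_nat_gt (D.xiVc * D.L)
    refine ⟨!₂[n / D.L, 0], ?_, fun i => ?_⟩
    · rw [solvable, hdir]
      calc D.xiVc < n / D.L := (lt_div_iff₀ hD.L_pos).2 hn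
        _ ≤ ‖n / D.L‖ := le_abs_self _
        _ ≤ ‖(!₂[n / D.L, 0] : Freq)‖ := PiLp.norm_apply_le (!₂[n / D.L, 0] : Freq) 0
    · fin_cases i
      exacts [⟨n, by simp⟩, ⟨0, by simp⟩]

lemma bddAbove_latticeRates : BddAbove D.latticeRates := by
  obtain ⟨C, hC⟩ := hD.exists_growthRate_le
  refine ⟨C, ?_⟩
  rintro _ ⟨ξ, hξ, rfl⟩
  exact hC ξ (ne_zero_of_mem_solvable hξ.1) _ (hD.isGrowthRate_growthRate hξ.1)

lemma growthRate_pos (h : ξ ∈ D.solvable) : 0 < D.growthRate ξ :=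
  ((hD.isGrowthRate_iff (ne_zero_of_mem_solvable h)).1 (hD.isGrowthRate_growthRate h)).1

lemma Lam_pos : 0 < D.Lam := by
  obtain ⟨_, ξ, hξ, rfl⟩ := hD.latticeRates_nonempty
  exact (hD.growthRate_pos hξ.1).trans_le
    (le_csSup hD.bddAbove_latticeRates (Set.mem_image_of_mem _ hξ))

end Admissible

end RTData

end RTMHD

end

open RTMHD in
theorem theorem2p3 (D : RTData) (hD : D.Admissible) :
    -- `λ(ξ)` is well defined on the solvable domain, and `Λ` is a genuine, positive supremum
    (∀ ξ ∈ D.solvable, ∃! s : ℝ, D.IsGrowthRate ξ s) ∧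
    D.latticeRates.Nonempty ∧ IsLUB D.latticeRates D.Lam ∧ 0 < D.Lam ∧
    ∃ Λs : ℝ, 0 < Λs ∧ 2 * D.Lam / 3 < Λs ∧ Λs ≤ D.Lam ∧
      ∃ (ϱ : ℝ → (Fin 3 → ℝ) → ℝ) (u N : ℝ → (Fin 3 → ℝ) → Fin 3 → ℝ)
        (q : ℝ → (Fin 3 → ℝ) → ℝ),
        IsSolution D ϱ u N q ∧
        (∀ k : ℕ, hNorm D.L k (allComp (ϱ 0) (u 0) (N 0) (q 0)) < ⊤) ∧
        (∀ k : ℕ, ∀ t : ℝ, 0 < t →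
          hNorm D.L k (allComp (ϱ t) (u t) (N t) (q t)) < ⊤ ∧
          hNorm D.L k (rhoNq (ϱ t) (N t) (q t)) =
            ENNReal.ofReal (Real.exp (Λs * t)) * hNorm D.L k (rhoNq (ϱ 0) (N 0) (q 0)) ∧
          ∀ i : Fin 8, hNorm D.L k ![allComp (ϱ t) (u t) (N t) (q t) i] =
            ENNReal.ofReal (Real.exp (Λs * t)) *
              hNorm D.L k ![allComp (ϱ 0) (u 0) (N 0) (q 0) i]) ∧
        (∀ x, div (u 0) x = 0 ∧ div (N 0) x = 0) ∧
        0 < hNorm D.L 0 ![fun x => u 0 x 0, fun x => u 0 x 1] *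
          hNorm D.L 0 ![fun x => u 0 x 2] ∧
        (D.dir = .vertical → 0 < hNorm D.L 0 ![fun x => N 0 x 2]) := by
  refine ⟨fun ξ => hD.existsUnique_isGrowthRate, hD.latticeRates_nonempty,
    isLUB_csSup hD.latticeRates_nonempty hD.bddAbove_latticeRates, hD.Lam_pos, ?_⟩
  obtain ⟨_, ⟨ξ, hξ, rfl⟩, hlt⟩ := exists_lt_of_lt_csSup hD.latticeRates_nonempty
    (show 2 * D.Lam / 3 < D.Lam by linarith [hD.Lam_pos])
  have hle : D.growthRate ξ ≤ D.Lam :=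
    le_csSup hD.bddAbove_latticeRates (Set.mem_image_of_mem _ hξ)
  obtain ⟨R, U, N, Q, hE, hU, hU₃, hN₃⟩ := hD.exists_isEigenmode_hNorm_pos
    (RTData.ne_zero_of_mem_solvable hξ.1) (hD.isGrowthRate_growthRate hξ.1)
  refine ⟨D.growthRate ξ, hD.growthRate_pos hξ.1, hlt, hle, evolve _ R, evolve _ U, evolve _ N,
    evolve _ Q, hE.isSolution hD.L_pos.ne' hξ.2, ?_⟩
  simp only [evolve_zero, allComp_evolve, rhoNq_evolve, hNorm_evolve, hNorm_evolve_singleton]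
  have hfin : ∀ k, hNorm D.L k (allComp R U N Q) < ⊤ := fun k => hNorm_lt_top hE.isMode_allComp
  exact ⟨hfin, fun k _ _ => ⟨ENNReal.mul_lt_top ENNReal.ofReal_lt_top (hfin k), trivial,
    fun _ => trivial⟩, fun x => ⟨hE.div_U x, hE.div_N x⟩, ENNReal.mul_pos hU.ne' hU₃.ne', hN₃⟩
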